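/- **Setting.** Let $U\subseteq\mathbb R^4$ be open, with coordinates $(x^a)_{a=0,\dots,3}=(t,x^1,x^2,x^3)$. Let $(g_\varepsilon)_{\varepsilon\in(0,1]}$ be a net of smooth Lorentzian metrics of signature $(-,+,+,+)$ on $U$, with inverse components $g_\varepsilon^{ab}$ and Levi-Civita connection $\nabla^\varepsilon$. Statements with "$O(\cdot)$", and those said to hold for small $\varepsilon$, are asymptotic as $\varepsilon\to0^+$. Put $\xi_a:=-(dt)_a$, $\xi_\varepsilon^a:=g_\varepsilon^{ab}\xi_b$, $V_\varepsilon:=\sqrt{-g_\varepsilon(\xi_\varepsilon,\xi_\varepsilon)}$, $\hat\xi_\varepsilon:=\xi_\varepsilon/V_\varepsilon$ (with lowered index $\hat\xi^\varepsilon_a$), and $e^\varepsilon_{ab}:=g^\varepsilon_{ab}+2\hat\xi^\varepsilon_a\hat\xi^\varepsilon_b$, with inverse $e_\varepsilon^{ab}$. Assume: * there is $M_0>0$ with $g_\varepsilon^{-1}(dt,dt)\le-1/M_0^2$ on $U$ for all small $\varepsilon$; * for every compact $K\subset U$ and every $k\ge0$, all partial derivatives of order $k$ of all components $g^\varepsilon_{ab}$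 and $g_\varepsilon^{ab}$ are $O(\varepsilon^{-k})$, uniformly on $K$; * for every compact $K\subset U$, the components of $\nabla^\varepsilon\xi_\varepsilon$ are $O(1)$, uniformly on $K$. Let $\gamma>0$, and let $\Omega$ be open with $\overline\Omega$ compact and contained in $U$. Assume that the boundary of $\Omega\cap\{t\ge0\}$, without $\Omega\cap\{t=0\}$ and up to time $t=\gamma$, is a space-like hypersurface with $\Omega$ on its past side. Precisely, every boundary point $q$ of $\Omega\cap\{t\ge0\}$ with $q\notin\Omega$ and $t(q)\le\gamma$ has an open neighbourhood $N$ and a $C^1$ function $\varphi$ on $N$ such that $\Omega\cap N\cap\{t\ge0\}=\{\varphi<0\}\cap N\cap\{t\ge0\}$ and, for all small $\varepsilon$, $g_\varepsilon^{-1}(d\varphi,d\varphi)<0$ and $g_\varepsilon^{-1}(d\varphi,dt)<0$ at all such boundary points in $N$. Let $S_\tau:=\Omega\cap\{t=\tau\}$ and $\mu^\varepsilon_\tau:=|\det g_\varepsilon|^{1/2}\,dx^1\wedge dx^2\wedge dx^3$. For a smooth function $u$ on $U$ define $$T^{ab,0}_\varepsilon(u)=-\tfrac12 g_\varepsilon^{ab}u^2,$$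 $$T^{ab,k}_\varepsilon(u)=\bigl(g_\varepsilon^{ac}g_\varepsilon^{bd}-\tfrac12g_\varepsilon^{ab}g_\varepsilon^{cd}\bigr)e_\varepsilon^{p_1q_1}\cdots e_\varepsilon^{p_{k-1}q_{k-1}}\bigl(\nabla^\varepsilon_c\nabla^\varepsilon_{p_1}\cdots\nabla^\varepsilon_{p_{k-1}}u\bigr)\bigl(\nabla^\varepsilon_d\nabla^\varepsilon_{q_1}\cdots\nabla^\varepsilon_{q_{k-1}}u\bigr)\quad(k\ge1),$$ $$E^k_{\tau,\varepsilon}(u)=\sum_{j=0}^k\int_{S_\tau}T^{ab,j}_\varepsilon(u)\,\xi_a\hat\xi^\varepsilon_b\,\mu^\varepsilon_\tau .$$ A net $(r_\varepsilon)$ of real numbers is *moderate* if $r_\varepsilon=O(\varepsilon^{-N})$ for some $N\in\mathbb N$, and *negligible* if $r_\varepsilon=O(\varepsilon^m)$ for every $m\in\mathbb N$. A net $(f_\varepsilon)_{\varepsilon\in(0,1]}$ of smooth functions on $U$ is *negligible* if, on every compact subset of $U$, every partial derivative of $f_\varepsilon$ (of any order, including zero) is uniformly $O(\varepsilon^q)$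 for every $q\in\mathbb N$. **Corollary 2.** Let $(f_\varepsilon)$ be a negligible net on $U$. For all small $\varepsilon$, let $u_\varepsilon$ be a smooth solution on $U$ of the initial value problem $$\Box^\varepsilon u_\varepsilon=|\det g_\varepsilon|^{-1/2}\partial_a\bigl(|\det g_\varepsilon|^{1/2}g_\varepsilon^{ab}\partial_bu_\varepsilon\bigr)=f_\varepsilon,\qquad u_\varepsilon|_{t=0}=v_\varepsilon,\qquad \mathscr L_{\hat\xi_\varepsilon}u_\varepsilon|_{t=0}=w_\varepsilon .$$ Then, for every $k$ and all small $\varepsilon$, the energies $E^k_{\tau,\varepsilon}(u_\varepsilon)$ are bounded above for $\tau\in[0,\gamma]$. Moreover: * if $(E^k_{0,\varepsilon}(u_\varepsilon))_\varepsilon$ is moderate for every $k\ge1$, then $\bigl(\sup_{0\le\tau\le\gamma}E^k_{\tau,\varepsilon}(u_\varepsilon)\bigr)_\varepsilon$ is moderate for every $k\ge1$; * if $(E^k_{0,\varepsilon}(u_\varepsilon))_\varepsilon$ is negligible for every $k\ge1$, then $\bigl(\sup_{0\le\tau\le\gamma}E^k_{\tau,\varepsilon}(u_\varepsilon)\bigr)_\varepsilon$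 is negligible for every $k\ge1$. -/

import Mathlib

open Set Filter Topology MeasureTheory
open scoped ContDiff

namespace WaveEnergy

noncomputable section

/-- Coordinate space `ℝ⁴`, with coordinates `(x⁰, x¹, x², x³) = (t, x¹, x², x³)`. -/
abbrev Pt : Type := Fin 4 → ℝ

/-- Components of a `(0,2)`- or `(2,0)`-tensor at one point. -/
abbrev Mat : Type := Matrix (Fin 4) (Fin 4) ℝ

/-! ### Partial derivatives, nets -/

/-- The partial derivative `∂ₐ F`. -/
def pd (a : Fin 4) (F : Pt → ℝ) : Pt → ℝ :=
  fun x => fderiv ℝ F x (Pi.single a 1)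

/-- The iterated partial derivative `∂_{a₁} ⋯ ∂_{a_k} F`, for the list `[a₁, …, a_k]`. -/
def iterPd (l : List (Fin 4)) (F : Pt → ℝ) : Pt → ℝ :=
  l.foldr pd F

/-- A moderate net of real numbers: `r ε = O(ε⁻ᴺ)` for some `N`, as `ε → 0+`. -/
def ModerateNet (r : ℝ → ℝ) : Prop :=
  ∃ N : ℕ, r =O[𝓝[>] 0] fun ε : ℝ => (ε ^ N)⁻¹

/-- A negligible net of real numbers: `r ε = O(εᵐ)` for every `m`, as `ε → 0+`. -/
def NegligibleNet (r : ℝ → ℝ) : Prop :=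
  ∀ m : ℕ, r =O[𝓝[>] 0] fun ε : ℝ => ε ^ m

/-- A negligible net of smooth functions on the open set `U`: on each compact subset of `U`,
each partial derivative is `O(ε^q)`, uniformly, for every `q`. -/
structure NegligibleFunNet (U : Set Pt) (f : ℝ → Pt → ℝ) : Prop where
  smooth : ∀ ε ∈ Ioc (0 : ℝ) 1, ContDiffOn ℝ ∞ (f ε) U
  estimate : ∀ K : Set Pt, IsCompact K → K ⊆ U → ∀ (l : List (Fin 4)) (q : ℕ),
    ∃ C : ℝ, ∀ᶠ ε in 𝓝[>] (0 : ℝ), ∀ x ∈ K, |iterPd l (f ε) x| ≤ C * ε ^ q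

/-! ### Lorentzian metrics in coordinates

A metric is given by its components `g x a b = g_{ab}(x)`; the matrix inverse `(g x)⁻¹ a b` has
the components `g^{ab}(x)` of the inverse metric. -/

/-- A symmetric matrix of signature `(-,+,+,+)`. -/
def IsLorentzian (A : Mat) : Prop :=
  ∃ P : Mat, IsUnit P.det ∧ P.transpose * A * P = Matrix.diagonal ![-1, 1, 1, 1]

/-- The value `g⁻¹(α, β)` of the inverse metric on two covectors at `x`. -/
def coInner (g : Pt → Mat) (x : Pt) (α β : Fin 4 → ℝ) : ℝ :=
  ∑ a, ∑ b, (g x)⁻¹ a b * α a * β b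

/-- The components of the covector `dt`. -/
def dt : Fin 4 → ℝ := Pi.single 0 1

/-- The components of the differential of `F` at `x`. -/
def dF (F : Pt → ℝ) (x : Pt) : Fin 4 → ℝ := fun a => pd a F x

/-- The Christoffel symbol `Γ^c_{ab}` of the Levi-Civita connection of `g`. -/
def christoffel (g : Pt → Mat) (c a b : Fin 4) (x : Pt) : ℝ :=
  (1 / 2) * ∑ d, (g x)⁻¹ c d *
    (pd a (fun y => g y b d) x + pd b (fun y => g y a d) x - pd d (fun y => g y a b) x)

/-- The normal covector `σ = -dt`, i.e. `ξ_a`. -/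
def sig (a : Fin 4) : ℝ := -dt a

/-- The normal vector field `ξ`, given by `σ = g(ξ, ·)`. -/
def xi (g : Pt → Mat) (a : Fin 4) (x : Pt) : ℝ :=
  ∑ b, (g x)⁻¹ a b * sig b

/-- The function `V`, with `V² = -g(ξ, ξ)`. -/
def lapse (g : Pt → Mat) (x : Pt) : ℝ :=
  Real.sqrt (-∑ a, ∑ b, g x a b * xi g a x * xi g b x)

/-- The normalised normal vector field `ξ / V`. -/
def xiHat (g : Pt → Mat) (a : Fin 4) (x : Pt) : ℝ := xi g a x / lapse g x

/-- The normalised normal covector field `g(ξ / V, ·)`. -/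
def sigHat (g : Pt → Mat) (a : Fin 4) (x : Pt) : ℝ := ∑ b, g x a b * xiHat g b x

/-- The associated Riemannian metric `e = g + 2 σ̂ ⊗ σ̂` (lower indices). -/
def eLow (g : Pt → Mat) (x : Pt) : Mat :=
  Matrix.of fun a b => g x a b + 2 * sigHat g a x * sigHat g b x

/-- The inverse `e^{ab}` of the Riemannian metric `e`. -/
def eUp (g : Pt → Mat) (x : Pt) : Mat := (eLow g x)⁻¹

/-- The density `|det g|^{1/2}` of the volume form. -/
def volDensity (g : Pt → Mat) (x : Pt) : ℝ := Real.sqrt |(g x).det|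

/-- The covariant derivative `∇_a X^b` of a vector field. -/
def covVec (g : Pt → Mat) (X : Fin 4 → Pt → ℝ) (a b : Fin 4) (x : Pt) : ℝ :=
  pd a (X b) x + ∑ c, christoffel g b a c x * X c x

/-- The covariant derivative of a `(0,k)`-tensor field; the new index comes first:
`(∇T)_{a i₁ … i_k} = ∂_a T_{i₁ … i_k} - ∑_s Γ^c_{a i_s} T_{i₁ … c … i_k}`. -/
def covD (g : Pt → Mat) {k : ℕ} (T : (Fin k → Fin 4) → Pt → ℝ) :
    (Fin (k + 1) → Fin 4) → Pt → ℝ :=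
  fun I x => pd (I 0) (T (Fin.tail I)) x -
    ∑ s, ∑ c, christoffel g c (I 0) (Fin.tail I s) x * T (Function.update (Fin.tail I) s c) x

/-- The components `∇_{p₁} ⋯ ∇_{p_k} u` of the `k`-th covariant derivative of a function. -/
def nabla (g : Pt → Mat) (u : Pt → ℝ) : (k : ℕ) → (Fin k → Fin 4) → Pt → ℝ
  | 0 => fun _ => u
  | k + 1 => covD g (nabla g u k)

/-- The d'Alembertian `|g|^{-1/2} ∂_a (|g|^{1/2} g^{ab} ∂_b u)`. -/
def box (g : Pt → Mat) (u : Pt → ℝ) (x : Pt) : ℝ :=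
  (volDensity g x)⁻¹ *
    ∑ a, pd a (fun y => volDensity g y * ∑ b, (g y)⁻¹ a b * pd b u y) x

/-! ### Energies -/

/-- The energy momentum tensors `T^{ab,k}(u)`. -/
def energyTensor (g : Pt → Mat) (u : Pt → ℝ) : ℕ → Fin 4 → Fin 4 → Pt → ℝ
  | 0, a, b, x => -(1 / 2) * (g x)⁻¹ a b * u x ^ 2
  | k + 1, a, b, x =>
      ∑ c, ∑ d, ∑ I : Fin k → Fin 4, ∑ J : Fin k → Fin 4,
        ((g x)⁻¹ a c * (g x)⁻¹ b d - (1 / 2) * (g x)⁻¹ a b * (g x)⁻¹ c d) *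
          (∏ s, eUp g x (I s) (J s)) *
          nabla g u (k + 1) (Fin.cons c I) x * nabla g u (k + 1) (Fin.cons d J) x

/-- The point `(τ, y)` of `ℝ⁴`. -/
def slicePt (τ : ℝ) (y : Fin 3 → ℝ) : Pt := Matrix.vecCons τ y

/-- The energy integral
`E^k_τ(u) = ∑_{j ≤ k} ∫_{S_τ} T^{ab,j}(u) ξ_a ξ̂_b μ_τ`, where `S_τ = Ω ∩ {t = τ}` and
`μ_τ = |g|^{1/2} dx¹ ∧ dx² ∧ dx³`, so that `dt ∧ μ_τ` is the volume form of `g`. -/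
def energy (Ω : Set Pt) (g : Pt → Mat) (u : Pt → ℝ) (k : ℕ) (τ : ℝ) : ℝ :=
  ∑ j ∈ Finset.range (k + 1), ∫ y in {y : Fin 3 → ℝ | slicePt τ y ∈ Ω},
    (∑ a, ∑ b, energyTensor g u j a b (slicePt τ y) * sig a * sigHat g b (slicePt τ y)) *
      volDensity g (slicePt τ y)

/-- The supremum of `E^k_τ(u)` over `0 ≤ τ ≤ γ`. -/
def supEnergy (Ω : Set Pt) (g : Pt → Mat) (u : Pt → ℝ) (k : ℕ) (γ : ℝ) : ℝ :=
  ⨆ τ : Icc (0 : ℝ) γ, energy Ω g u k τ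

/-! ### The class of metrics, the domain and the initial value problem -/

/-- The assumptions on the net of Lorentzian metrics `g ε`, `ε ∈ (0, 1]`, on the coordinate
domain `U`. -/
structure AdmissibleMetricNet (U : Set Pt) (g : ℝ → Pt → Mat) : Prop where
  smooth : ∀ ε ∈ Ioc (0 : ℝ) 1, ∀ a b, ContDiffOn ℝ ∞ (fun x => g ε x a b) U
  lorentzian : ∀ ε ∈ Ioc (0 : ℝ) 1, ∀ x ∈ U, IsLorentzian (g ε x)
  /-- The level sets of `t` are uniformly space-like. -/
  timelike : ∃ M₀ : ℝ, 0 < M₀ ∧ ∀ᶠ ε in 𝓝[>] (0 : ℝ), ∀ x ∈ U,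
    coInner (g ε) x dt dt ≤ -1 / M₀ ^ 2
  /-- Derivatives of order `k` of the metric are `O(ε^{-k})` on compact sets. -/
  metric_bound : ∀ K : Set Pt, IsCompact K → K ⊆ U → ∀ (l : List (Fin 4)) (a b : Fin 4),
    ∃ C : ℝ, ∀ᶠ ε in 𝓝[>] (0 : ℝ), ∀ x ∈ K,
      |iterPd l (fun y => g ε y a b) x| ≤ C * (ε ^ l.length)⁻¹
  /-- Derivatives of order `k` of the inverse metric are `O(ε^{-k})` on compact sets. -/
  inverse_bound : ∀ K : Set Pt, IsCompact K → K ⊆ U → ∀ (l : List (Fin 4)) (a b : Fin 4),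
    ∃ C : ℝ, ∀ᶠ ε in 𝓝[>] (0 : ℝ), ∀ x ∈ K,
      |iterPd l (fun y => (g ε y)⁻¹ a b) x| ≤ C * (ε ^ l.length)⁻¹
  /-- The covariant derivative of the normal vector field is `O(1)` on compact sets. -/
  normal_bound : ∀ K : Set Pt, IsCompact K → K ⊆ U → ∀ a b : Fin 4,
    ∃ C : ℝ, ∀ᶠ ε in 𝓝[>] (0 : ℝ), ∀ x ∈ K, |covVec (g ε) (xi (g ε)) a b x| ≤ C

/-- The part with `t ≤ γ` of the boundary of `Ω ∩ {t ≥ 0}` that lies outside `Ω`, i.e. the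
boundary without the bottom `S_0 = Ω ∩ {t = 0}`. -/
def outerBoundary (Ω : Set Pt) (γ : ℝ) : Set Pt :=
  {q | q ∈ frontier (Ω ∩ {x | 0 ≤ x 0}) ∧ q ∉ Ω ∧ q 0 ≤ γ}

/-- `Ω` is open, its closure is a compact subset of `U`, and the boundary of `Ω ∩ {t ≥ 0}` is,
up to the time `γ`, a space-like `C¹` hypersurface (for all small `ε`) whose outer side is its
future side: near each of its points, `Ω ∩ {t ≥ 0}` is `{φ < 0} ∩ {t ≥ 0}`, where `dφ` is
time-like and in the same half of the cone as `dt` on the boundary. -/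
structure EnergyDomain (U Ω : Set Pt) (γ : ℝ) (g : ℝ → Pt → Mat) : Prop where
  isOpen : IsOpen Ω
  compact_closure : IsCompact (closure Ω)
  closure_subset : closure Ω ⊆ U
  spacelike : ∀ q ∈ outerBoundary Ω γ, ∃ (N : Set Pt) (φ : Pt → ℝ),
    IsOpen N ∧ q ∈ N ∧ ContDiffOn ℝ 1 φ N ∧
    (∀ x ∈ N, 0 ≤ x 0 → (x ∈ Ω ↔ φ x < 0)) ∧
    ∀ᶠ ε in 𝓝[>] (0 : ℝ), ∀ x ∈ N ∩ outerBoundary Ω γ,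
      coInner (g ε) x (dF φ x) (dF φ x) < 0 ∧ coInner (g ε) x (dF φ x) dt < 0

/-- `u` is a smooth solution on `U` of the initial value problem `□u = f`,
`u = v` and `ξ̂ u = w` on `{t = 0}`. -/
structure SolvesIVP (U : Set Pt) (g : Pt → Mat) (f : Pt → ℝ) (v w : (Fin 3 → ℝ) → ℝ)
    (u : Pt → ℝ) : Prop where
  smooth : ContDiffOn ℝ ∞ u U
  equation : ∀ x ∈ U, box g u x = f x
  initial_value : ∀ y, slicePt 0 y ∈ U → u (slicePt 0 y) = v y
  initial_velocity : ∀ y, slicePt 0 y ∈ U →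
    ∑ a, xiHat g a (slicePt 0 y) * pd a u (slicePt 0 y) = w y

end

end WaveEnergy

namespace WaveEnergy

noncomputable section

/-! ### Partial derivatives -/

/-! The proof is an energy estimate whose Grönwall constant does not depend on `ε`. The current `J_j
= -T^{ab,j} ξ̂_b` has as its time component the energy density of order `j`. This density is half
the lapse times the `e`-norm squared of `∇ʲu` (`current_time`), so it controls all components of
`∇ʲu`. On the outer boundary the dominant energy condition makes `J_j` point outwards
(`current_flux_nonneg`). By `flux_le`, the energy on `S_τ` then exceeds the energy on `S_0` by at
most the integral of the divergence.

The divergence of `J_{k+1}` (`div_current_succ`) has two kinds of terms. The first are quadratic in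
`∇^{k+1}u`, with coefficients built from `g⁻¹`, `ξ̂` and `∇ξ̂`: the connection is metric, so `∇e`
comes from `∇ξ̂` alone. These coefficients are `O(1)` although the Christoffel symbols may grow like
`1/ε`, because `∇ξ̂` is expressed through `∇ξ` (`covVec_xiHat`). The second pair `∇^{k+1}u` with
`□∇ᵏu` or with a commutator `[∇_a, ∇_b]∇ᵏu`. By the Ricci identity and `□u = f`, these factors
contain only `∇ʲu` with `j ≤ k` and derivatives of `f`, with coefficients of size `ε⁻ᴺ`
(`lower_boxNabla`, `lower_commNabla`). For `k = 0` no derivative of `u` appears in them.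

A plain Grönwall argument would turn such `ε⁻ᴺ` into `exp(ε⁻ᴺ)`. Instead the energies are added with
weights that are larger by a power of `ε⁻¹` at each lower order (`orderWeight`). The large
coefficients then feed only into terms that already carry a larger weight, and the weighted
divergence is at most an `ε`-independent multiple `l` of the weighted density plus a negligible term
(`weighted_div_le`). Orders 0 and 1 share a weight: order 1 does not see order 0, and order 0 sees
order 1 only with bounded coefficients.

Inserting the factor `e^{-lt}` into the current gives `E^k_τ ≤ C ε⁻ᴺ E^k_0 + O(ε^q)` for every `q`,
with `C` and `N` fixed before `q` (`energy_le`, `exists_energy_le`). Boundedness, moderateness and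
negligibility follow from this inequality. -/

theorem pd_congr {F G : Pt → ℝ} {x : Pt} (h : F =ᶠ[𝓝 x] G) (a : Fin 4) : pd a F x = pd a G x := by
  simp only [pd, h.fderiv_eq]

theorem pd_mul {F G : Pt → ℝ} {x : Pt} (hF : DifferentiableAt ℝ F x) (hG : DifferentiableAt ℝ G x)
    (a : Fin 4) : pd a (fun y => F y * G y) x = pd a F x * G x + F x * pd a G x := by
  simp only [pd]
  rw [fderiv_fun_mul hF hG]
  simp only [add_apply, smul_apply, smul_eq_mul]
  ring

theorem pd_add {F G : Pt → ℝ} {x : Pt} (hF : DifferentiableAt ℝ F x) (hG : DifferentiableAt ℝ G x)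
    (a : Fin 4) : pd a (fun y => F y + G y) x = pd a F x + pd a G x := by
  simp only [pd]
  rw [fderiv_fun_add hF hG]
  rfl

theorem pd_sub {F G : Pt → ℝ} {x : Pt} (hF : DifferentiableAt ℝ F x) (hG : DifferentiableAt ℝ G x)
    (a : Fin 4) : pd a (fun y => F y - G y) x = pd a F x - pd a G x := by
  simp only [pd]
  rw [fderiv_fun_sub hF hG]
  rfl

theorem pd_neg {F : Pt → ℝ} {x : Pt} (a : Fin 4) : pd a (fun y => -F y) x = -pd a F x := by
  simp only [pd, fderiv_fun_neg]
  rfl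

theorem pd_const (c : ℝ) (x : Pt) (a : Fin 4) : pd a (fun _ => c) x = 0 := by
  simp [pd]

theorem pd_const_mul {F : Pt → ℝ} {x : Pt} (hF : DifferentiableAt ℝ F x) (c : ℝ)
    (a : Fin 4) : pd a (fun y => c * F y) x = c * pd a F x := by
  rw [pd_mul (differentiableAt_const c) hF, pd_const]
  ring

theorem pd_sum {ι : Type*} (s : Finset ι) {F : ι → Pt → ℝ} {x : Pt}
    (hF : ∀ i ∈ s, DifferentiableAt ℝ (F i) x) (a : Fin 4) :
    pd a (fun y => ∑ i ∈ s, F i y) x = ∑ i ∈ s, pd a (F i) x := by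
  simp only [pd]
  rw [fderiv_fun_sum hF]
  simp

theorem pd_comp {F : Pt → ℝ} {h : ℝ → ℝ} {x : Pt} {h' : ℝ} (hh : HasDerivAt h h' (F x))
    (hF : DifferentiableAt ℝ F x) (a : Fin 4) :
    pd a (fun y => h (F y)) x = h' * pd a F x := by
  change fderiv ℝ (h ∘ F) x _ = h' * fderiv ℝ F x _
  rw [(hh.comp_hasFDerivAt x hF.hasFDerivAt).fderiv]
  rfl

theorem contDiffOn_pd {U : Set Pt} (hU : IsOpen U) {F : Pt → ℝ} {m n : WithTop ℕ∞}
    (hF : ContDiffOn ℝ n F U) (hmn : m + 1 ≤ n) (a : Fin 4) : ContDiffOn ℝ m (pd a F) U :=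
  (hF.fderiv_of_isOpen hU hmn).clm_apply contDiffOn_const

/-! ### The divergence theorem in a slab -/

/-- The closed slab `0 ≤ t ≤ τ`. -/
def slab (τ : ℝ) : Set Pt := {x | 0 ≤ x 0 ∧ x 0 ≤ τ}

theorem isClosed_slab (τ : ℝ) : IsClosed (slab τ) :=
  (isClosed_le continuous_const (continuous_apply 0)).inter
    (isClosed_le (continuous_apply 0) continuous_const)

theorem continuous_slicePt (τ : ℝ) : Continuous (slicePt τ) := by
  refine continuous_pi fun i => ?_
  refine Fin.cases ?_ (fun j => ?_) i
  · exact continuous_const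
  · exact continuous_apply j

theorem norm_le_slicePt (τ : ℝ) (y : Fin 3 → ℝ) : ‖y‖ ≤ ‖slicePt τ y‖ := by
  refine (pi_norm_le_iff_of_nonneg (norm_nonneg _)).2 fun i => ?_
  exact norm_le_pi_norm (slicePt τ y) i.succ

/-- Compact support allows the slab to be cut down to a box `[0, τ] × [-R, R]³` whose lateral faces
carry no flux, so the divergence theorem for boxes leaves only the two horizontal faces. -/
theorem slab_divergence (X : Fin 4 → Pt → ℝ) (hX : ∀ a, ContDiff ℝ 1 (X a))
    (hc : ∀ a, HasCompactSupport (X a)) {τ : ℝ} (hτ : 0 ≤ τ) :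
    ∫ x in slab τ, ∑ a, pd a (X a) x =
      (∫ y, X 0 (slicePt τ y)) - ∫ y, X 0 (slicePt 0 y) := by
  have hR : ∃ R : ℝ, 0 < R ∧ ∀ a x, R ≤ ‖x‖ → X a x = 0 ∧ pd a (X a) x = 0 := by
    have : IsCompact (⋃ a, tsupport (X a)) := isCompact_iUnion hc
    obtain ⟨R, hR⟩ := this.isBounded.exists_norm_le
    -- The extra 1 makes the fields vanish already where the norm equals the new radius, hence on
    -- the lateral faces themselves.
    refine ⟨max R 0 + 1, by positivity, fun a x hx => ?_⟩
    have hx' : x ∉ tsupport (X a) := fun h => by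
      have := hR x (mem_iUnion_of_mem a h)
      have := le_max_left R 0
      linarith
    refine ⟨image_eq_zero_of_notMem_tsupport hx', ?_⟩
    have : x ∉ tsupport (fderiv ℝ (X a)) := fun h => hx' (tsupport_fderiv_subset ℝ h)
    simp [pd, image_eq_zero_of_notMem_tsupport this]
  obtain ⟨R, hR0, hR⟩ := hR
  set A : Pt := Fin.cons 0 (fun _ => -R) with hA
  set B : Pt := Fin.cons τ (fun _ => R) with hB
  have hAB : A ≤ B := by
    intro i
    refine Fin.cases ?_ (fun j => ?_) i
    · simpa [hA, hB] using hτ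
    · simp only [hA, hB, Fin.cons_succ]; linarith
  have hcont : Continuous fun x => ∑ a, pd a (X a) x :=
    continuous_finsetSum _ fun a _ =>
      ((hX a).continuous_fderiv (by norm_num)).clm_apply continuous_const
  have key := integral_divergence_of_hasFDerivAt_off_countable' A B hAB X
    (fun a => fderiv ℝ (X a)) ∅ countable_empty (fun a => (hX a).continuous.continuousOn)
    (fun x _ a => ((hX a).differentiable (by norm_num)).differentiableAt.hasFDerivAt)
    (hcont.integrableOn_Icc)
  have h1 : ∫ x in slab τ, ∑ a, pd a (X a) x = ∫ x in Icc A B, ∑ a, pd a (X a) x := by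
    refine setIntegral_eq_of_subset_of_forall_sdiff_eq_zero (isClosed_slab τ).measurableSet ?_ ?_
    · intro x hx
      exact ⟨by simpa [hA] using hx.1 0, by simpa [hB] using hx.2 0⟩
    · intro x hx
      refine Finset.sum_eq_zero fun a _ => (hR a x ?_).2
      by_contra hlt
      push Not at hlt
      refine hx.2 ⟨fun i => ?_, fun i => ?_⟩ <;> refine Fin.cases ?_ (fun j => ?_) i
      · simpa [hA] using hx.1.1
      · have := (abs_le.1 ((norm_le_pi_norm x j.succ).trans hlt.le)).1
        simpa [hA] using this
      · simpa [hB] using hx.1.2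
      · have := (abs_le.1 ((norm_le_pi_norm x j.succ).trans hlt.le)).2
        simpa [hB] using this
  have hface : ∀ s : ℝ, ∫ y in Icc (A ∘ Fin.succAbove 0) (B ∘ Fin.succAbove 0),
      X 0 (Fin.insertNth (0 : Fin 4) s y) = ∫ y, X 0 (slicePt s y) := by
    intro s
    have : ∀ y : Fin 3 → ℝ, (Fin.insertNth (0 : Fin 4) s y : Pt) = slicePt s y := fun y => by
      rw [Fin.insertNth_zero]; rfl
    simp_rw [this]
    refine setIntegral_eq_integral_of_forall_compl_eq_zero fun y hy => (hR 0 _ ?_).1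
    refine le_trans ?_ (norm_le_slicePt s y)
    by_contra hlt
    push Not at hlt
    refine hy ⟨fun j => ?_, fun j => ?_⟩
    · have := (abs_le.1 ((norm_le_pi_norm y j).trans hlt.le)).1
      simpa [hA] using this
    · have := (abs_le.1 ((norm_le_pi_norm y j).trans hlt.le)).2
      simpa [hB] using this
  have hside : ∀ (j : Fin 3) (s : ℝ), |s| = R → ∀ y : Fin 3 → ℝ,
      X j.succ (Fin.insertNth (j.succ : Fin 4) s y) = 0 := by
    intro j s hs y
    refine (hR _ _ ?_).1
    have := norm_le_pi_norm (Fin.insertNth (j.succ : Fin 4) s y : Pt) j.succ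
    simpa [hs] using this
  rw [h1]
  refine key.trans ?_
  rw [Fin.sum_univ_succ, Finset.sum_eq_zero, add_zero]
  · rw [hface, hface]
    simp [hA, hB]
  · intro j _
    have e1 : B j.succ = R := by simp [hB]
    have e2 : A j.succ = -R := by simp [hA]
    simp_rw [e1, e2, hside j R (abs_of_pos hR0), hside j (-R) (by rw [abs_neg, abs_of_pos hR0])]
    simp

/-! ### Flux through a chart of the boundary -/

theorem eventuallyEq_zero_of_notMem_tsupport {ψ F : Pt → ℝ} (h : ∀ x, ψ x = 0 → F x = 0) {x : Pt}
    (hx : x ∉ tsupport ψ) : F =ᶠ[𝓝 x] fun _ => 0 :=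
  (notMem_tsupport_iff_eventuallyEq.1 hx).mono fun y hy => h y hy

/-- Off `tsupport ψ` the function vanishes locally. Data that are regular only inside a chart thus
become global after multiplication by a cutoff, as `slab_divergence` requires. -/
theorem contDiff_of_contDiffAt_tsupport {ψ F : Pt → ℝ} {n : WithTop ℕ∞}
    (h : ∀ x, ψ x = 0 → F x = 0) (hF : ∀ x ∈ tsupport ψ, ContDiffAt ℝ n F x) :
    ContDiff ℝ n F := by
  refine contDiff_iff_contDiffAt.2 fun x => ?_
  by_cases hx : x ∈ tsupport ψ
  · exact hF x hx
  · exact contDiffAt_const.congr_of_eventuallyEq (eventuallyEq_zero_of_notMem_tsupport h hx)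

theorem hasCompactSupport_of_zero {ψ F : Pt → ℝ} (h : ∀ x, ψ x = 0 → F x = 0)
    (hψ : HasCompactSupport ψ) : HasCompactSupport F :=
  hψ.mono fun x hx h0 => hx (h x h0)

theorem hasCompactSupport_comp_slicePt {F : Pt → ℝ} (hF : HasCompactSupport F) (τ : ℝ) :
    HasCompactSupport fun y => F (slicePt τ y) := by
  obtain ⟨R, hR⟩ := hF.isCompact.isBounded.exists_norm_le
  refine HasCompactSupport.of_support_subset_isCompact (isCompact_closedBall 0 R) fun y hy => ?_
  rw [mem_closedBall_zero_iff]
  exact (norm_le_slicePt τ y).trans (hR _ (subset_tsupport _ hy))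

/-- These are the smooth approximations to the indicator of `{φ < 0}`, with `c = φ x`. At `c = 0`
every term is 0, which matches the strict inequality that describes `Ω`. -/
theorem tendsto_smoothTransition_mul {c : ℝ} :
    Tendsto (fun n : ℕ => Real.smoothTransition (-(n : ℝ) * c)) atTop
      (𝓝 (if c < 0 then 1 else 0)) := by
  split_ifs with h
  · refine tendsto_const_nhds.congr' ?_
    obtain ⟨m, hm⟩ := exists_nat_ge (1 / (-c))
    filter_upwards [eventually_ge_atTop m] with n hn
    refine (Real.smoothTransition.one_of_one_le ?_).symm
    have : (m : ℝ) ≤ n := by exact_mod_cast hn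
    have h2 := (div_le_iff₀ (neg_pos.2 h)).1 (hm.trans this)
    linarith
  · refine tendsto_const_nhds.congr fun n => (Real.smoothTransition.zero_of_nonpos ?_).symm
    have : (0 : ℝ) ≤ n := by positivity
    nlinarith [not_lt.1 h]

/-- The divergence theorem for `ψ J` on `Ω ∩ {0 ≤ t ≤ τ}`, where `ψ` is supported in a chart in
which `Ω` is `{φ < 0}` and `J` points outwards. -/
theorem chart_flux {Ω N : Set Pt} (hΩ : IsOpen Ω) (hN : IsOpen N) {φ ψ : Pt → ℝ}
    {J : Fin 4 → Pt → ℝ} (hJ : ∀ a, ContDiffOn ℝ 1 (J a) N) (hφ : ContDiffOn ℝ 1 φ N)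
    (hψ : ContDiff ℝ 1 ψ) (hψ0 : ∀ x, 0 ≤ ψ x) (hψc : HasCompactSupport ψ)
    (hψN : tsupport ψ ⊆ N) (hΩφ : ∀ x ∈ N, 0 ≤ x 0 → (x ∈ Ω ↔ φ x < 0))
    (hout : ∀ x ∈ N, 0 ≤ ∑ a, J a x * pd a φ x) {τ : ℝ} (hτ : 0 ≤ τ) :
    (∫ y in {y | slicePt τ y ∈ Ω}, ψ (slicePt τ y) * J 0 (slicePt τ y)) -
      (∫ y in {y | slicePt 0 y ∈ Ω}, ψ (slicePt 0 y) * J 0 (slicePt 0 y)) ≤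
      ∫ x in slab τ ∩ Ω, ∑ a, pd a (fun y => ψ y * J a y) x := by
  -- Multiplying the field by `η n` replaces the integral over the curved boundary by a bulk term
  -- with a sign, so no surface measure is needed.
  set η : ℕ → Pt → ℝ := fun n x => Real.smoothTransition (-(n : ℝ) * φ x) with hη
  have hη0 : ∀ n x, 0 ≤ η n x := fun n x => Real.smoothTransition.nonneg _
  have hη1 : ∀ n x, |η n x| ≤ 1 := fun n x => by
    rw [abs_of_nonneg (hη0 n x)]; exact Real.smoothTransition.le_one _
  have hNn : ∀ x ∈ tsupport ψ, N ∈ 𝓝 x := fun x hx => hN.mem_nhds (hψN hx)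
  have hηc : ∀ n, ∀ x ∈ tsupport ψ, ContDiffAt ℝ 1 (η n) x := fun n x hx =>
    (Real.smoothTransition.contDiffAt (n := 1)).comp x
      (contDiffAt_const.mul (hφ.contDiffAt (hNn x hx)))
  have hψJ : ∀ a, ContDiff ℝ 1 (fun y => ψ y * J a y) := fun a =>
    contDiff_of_contDiffAt_tsupport (ψ := ψ) (fun x hx => by simp [hx]) fun x hx =>
      hψ.contDiffAt.mul ((hJ a).contDiffAt (hNn x hx))
  have hψJs : ∀ a, HasCompactSupport (fun y => ψ y * J a y) := fun a =>
    hasCompactSupport_of_zero (fun x hx => by simp [hx]) hψc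
  set D : Pt → ℝ := fun x => ∑ a, pd a (fun y => ψ y * J a y) x with hD
  have hDc : Continuous D := continuous_finsetSum _ fun a _ =>
      ((hψJ a).continuous_fderiv (by norm_num)).clm_apply continuous_const
  have hD0 : ∀ x, x ∉ tsupport ψ → D x = 0 := fun x hx =>
    Finset.sum_eq_zero fun a _ => by
      rw [pd_congr (eventuallyEq_zero_of_notMem_tsupport (ψ := ψ) (fun x hx => by simp [hx]) hx),
        pd_const]
  have hDs : HasCompactSupport D := HasCompactSupport.intro hψc hD0
  have hX : ∀ n a, ContDiff ℝ 1 (fun y => η n y * (ψ y * J a y)) := fun n a =>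
    contDiff_of_contDiffAt_tsupport (ψ := ψ) (fun x hx => by simp [hx]) fun x hx =>
      (hηc n x hx).mul (hψJ a).contDiffAt
  have hXs : ∀ n a, HasCompactSupport (fun y => η n y * (ψ y * J a y)) := fun n a =>
    hasCompactSupport_of_zero (fun x hx => by simp [hx]) hψc
  have hηD : ∀ n, Continuous fun x => η n x * D x := fun n => by
    refine continuous_iff_continuousAt.2 fun x => ?_
    by_cases hx : x ∈ tsupport ψ
    · exact (hηc n x hx).continuousAt.mul hDc.continuousAt
    · refine (continuousAt_const (y := (0 : ℝ))).congr ?_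
      filter_upwards [(isClosed_tsupport ψ).isOpen_compl.mem_nhds hx] with y hy
      rw [hD0 y hy, mul_zero]
  -- The gradient of `η n` is a nonpositive multiple of `dφ`, since the transition function is
  -- monotone. As `ψ ≥ 0` and `J` points outwards, the term containing this gradient is nonpositive
  -- and is dropped.
  have hle : ∀ n x, ∑ a, pd a (fun y => η n y * (ψ y * J a y)) x ≤ η n x * D x := by
    intro n x
    by_cases hx : x ∈ tsupport ψ
    · have hφx : DifferentiableAt ℝ φ x := (hφ.contDiffAt (hNn x hx)).differentiableAt (by norm_num)
      have h1 : ∀ a, pd a (η n) x = -(deriv Real.smoothTransition (-(n : ℝ) * φ x) * n) *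
          pd a φ x := fun a => by
        have hd : HasDerivAt Real.smoothTransition
            (deriv Real.smoothTransition (-(n : ℝ) * φ x)) (-(n : ℝ) * φ x) :=
          ((Real.smoothTransition.contDiff (n := 1)).differentiable
            (by norm_num)).differentiableAt.hasDerivAt
        have := pd_comp (F := fun y => -(n : ℝ) * φ y) hd (hφx.const_mul _) a
        rw [pd_const_mul hφx] at this
        rw [hη, this]; ring
      have h2 : ∀ a, pd a (fun y => η n y * (ψ y * J a y)) x =
          η n x * pd a (fun y => ψ y * J a y) x -
            (deriv Real.smoothTransition (-(n : ℝ) * φ x) * n) * ψ x * (J a x * pd a φ x) :=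
        fun a => by
        rw [pd_mul ((hηc n x hx).differentiableAt (by norm_num))
          ((hψJ a).differentiable (by norm_num)).differentiableAt, h1]
        ring
      simp_rw [h2, Finset.sum_sub_distrib, ← Finset.mul_sum]
      have h3 : 0 ≤ deriv Real.smoothTransition (-(n : ℝ) * φ x) :=
        Real.smoothTransition.monotone.deriv_nonneg
      have := mul_nonneg (mul_nonneg (mul_nonneg h3 (Nat.cast_nonneg n)) (hψ0 x))
        (hout x (hψN hx))
      linarith
    · rw [hD0 x hx, mul_zero]
      refine (Finset.sum_eq_zero fun a _ => ?_).le
      rw [pd_congr (eventuallyEq_zero_of_notMem_tsupport (ψ := ψ) (fun x hx => by simp [hx]) hx),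
        pd_const]
  have hcD : ∀ n, Continuous fun x => ∑ a, pd a (fun y => η n y * (ψ y * J a y)) x := fun n =>
    continuous_finsetSum _ fun a _ =>
      ((hX n a).continuous_fderiv (by norm_num)).clm_apply continuous_const
  have hcDs : ∀ n, HasCompactSupport fun x => ∑ a, pd a (fun y => η n y * (ψ y * J a y)) x :=
    fun n => HasCompactSupport.intro hψc fun x hx => Finset.sum_eq_zero fun a _ => by
      rw [pd_congr (eventuallyEq_zero_of_notMem_tsupport (ψ := ψ) (fun x hx => by simp [hx]) hx),
        pd_const]
  have hηDi : ∀ n, Integrable (fun x => η n x * D x) := fun n =>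
    (hηD n).integrable_of_hasCompactSupport
      (HasCompactSupport.intro hψc fun x hx => by rw [hD0 x hx, mul_zero])
  have main : ∀ n, (∫ y, η n (slicePt τ y) * (ψ (slicePt τ y) * J 0 (slicePt τ y))) -
      (∫ y, η n (slicePt 0 y) * (ψ (slicePt 0 y) * J 0 (slicePt 0 y))) ≤
      ∫ x in slab τ, η n x * D x := fun n => by
    rw [← slab_divergence (fun a y => η n y * (ψ y * J a y)) (hX n) (hXs n) hτ]
    exact integral_mono
      ((hcD n).integrable_of_hasCompactSupport (hcDs n)).integrableOn
      (hηDi n).integrableOn (hle n)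
  have hlim : ∀ x ∈ tsupport ψ, 0 ≤ x 0 → ∀ c : ℝ,
      Tendsto (fun n => η n x * c) atTop (𝓝 (Ω.indicator (fun _ => c) x)) := by
    intro x hx h0 c
    have := (tendsto_smoothTransition_mul (c := φ x)).mul_const c
    convert this using 2
    by_cases h : x ∈ Ω
    · simp [h, (hΩφ x (hψN hx) h0).1 h]
    · have h' : ¬ φ x < 0 := fun h' => h ((hΩφ x (hψN hx) h0).2 h')
      simp [h, h']
  have hslice : ∀ s : ℝ, 0 ≤ s → Tendsto
      (fun n => ∫ y, η n (slicePt s y) * (ψ (slicePt s y) * J 0 (slicePt s y))) atTop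
      (𝓝 (∫ y in {y | slicePt s y ∈ Ω}, ψ (slicePt s y) * J 0 (slicePt s y))) := by
    intro s hs
    have hms : MeasurableSet {y | slicePt s y ∈ Ω} :=
      (hΩ.preimage (continuous_slicePt s)).measurableSet
    rw [← integral_indicator hms]
    refine tendsto_integral_of_dominated_convergence
      (fun y => |ψ (slicePt s y) * J 0 (slicePt s y)|) ?_ ?_ ?_ ?_
    · exact fun n => ((hX n 0).continuous.comp (continuous_slicePt s)).aestronglyMeasurable
    · exact (((hψJ 0).continuous.comp (continuous_slicePt s)).integrable_of_hasCompactSupport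
        (hasCompactSupport_comp_slicePt (hψJs 0) s)).abs
    · refine fun n => ae_of_all _ fun y => ?_
      rw [Real.norm_eq_abs, abs_mul]
      exact mul_le_of_le_one_left (abs_nonneg _) (hη1 n _)
    · refine ae_of_all _ fun y => ?_
      by_cases hy : slicePt s y ∈ tsupport ψ
      · exact hlim _ hy hs _
      · have : ψ (slicePt s y) = 0 := image_eq_zero_of_notMem_tsupport hy
        simp [this, indicator]
  have hvol : Tendsto (fun n => ∫ x in slab τ, η n x * D x) atTop
      (𝓝 (∫ x in slab τ ∩ Ω, D x)) := by
    rw [← setIntegral_indicator hΩ.measurableSet]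
    refine tendsto_integral_of_dominated_convergence (fun x => |D x|) ?_ ?_ ?_ ?_
    · exact fun n => (hηD n).aestronglyMeasurable
    · exact (hDc.integrable_of_hasCompactSupport hDs).integrableOn.abs
    · refine fun n => ae_of_all _ fun y => ?_
      rw [Real.norm_eq_abs, abs_mul]
      exact mul_le_of_le_one_left (abs_nonneg _) (hη1 n _)
    · refine (ae_restrict_iff' (isClosed_slab τ).measurableSet).2 (ae_of_all _ fun x hxs => ?_)
      by_cases hx : x ∈ tsupport ψ
      · exact hlim _ hx hxs.1 _
      · simp [hD0 x hx, indicator]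
  exact le_of_tendsto_of_tendsto' ((hslice τ hτ).sub (hslice 0 le_rfl)) hvol main


open scoped Manifold in
/-- The flux inequality: if the vector field `J` points outwards on the outer boundary of
`Ω ∩ {t ≥ 0}`, then the flux through `S_τ` is at most the flux through `S_0` plus the integral of
the divergence. -/
theorem flux_le {U Ω : Set Pt} (hU : IsOpen U) (hΩ : IsOpen Ω) (hcpt : IsCompact (closure Ω))
    (hsub : closure Ω ⊆ U) {J : Fin 4 → Pt → ℝ} (hJ : ∀ a, ContDiffOn ℝ 1 (J a) U) {γ : ℝ}
    (hb : ∀ q ∈ outerBoundary Ω γ, ∃ (N : Set Pt) (φ : Pt → ℝ), IsOpen N ∧ q ∈ N ∧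
      ContDiffOn ℝ 1 φ N ∧ (∀ x ∈ N, 0 ≤ x 0 → (x ∈ Ω ↔ φ x < 0)) ∧
      ∀ x ∈ N ∩ U, 0 ≤ ∑ a, J a x * pd a φ x) {τ : ℝ} (hτ : 0 ≤ τ) (hτγ : τ ≤ γ) :
    (∫ y in {y | slicePt τ y ∈ Ω}, J 0 (slicePt τ y)) -
      (∫ y in {y | slicePt 0 y ∈ Ω}, J 0 (slicePt 0 y)) ≤
      ∫ x in slab τ ∩ Ω, ∑ a, pd a (J a) x := by
  set K : Set Pt := closure (Ω ∩ {x | 0 ≤ x 0}) ∩ {x | x 0 ≤ γ} with hK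
  have hKcl : IsClosed K := isClosed_closure.inter (isClosed_le (continuous_apply 0) continuous_const)
  have hKsub : K ⊆ closure Ω := fun x hx => closure_mono inter_subset_left hx.1
  have hKc : IsCompact K := hcpt.of_isClosed_subset hKcl hKsub
  -- Charts are intersected with a fixed ball so that the functions of the partition of unity have
  -- compact support.
  obtain ⟨R, hR⟩ := hKc.isBounded.exists_norm_le
  have hcharts : ∀ q ∈ K, ∃ (N : Set Pt) (φ : Pt → ℝ), IsOpen N ∧ q ∈ N ∧ N ⊆ U ∧
      N ⊆ Metric.ball 0 (R + 1) ∧ ContDiffOn ℝ 1 φ N ∧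
      (∀ x ∈ N, 0 ≤ x 0 → (x ∈ Ω ↔ φ x < 0)) ∧ ∀ x ∈ N, 0 ≤ ∑ a, J a x * pd a φ x := by
    intro q hq
    have hqR : q ∈ Metric.ball (0 : Pt) (R + 1) := by
      rw [mem_ball_zero_iff]; linarith [hR q hq]
    by_cases hqΩ : q ∈ Ω
    -- At points of `Ω` the constant `φ = -1` serves as a chart: its differential vanishes, so the
    -- outward condition is trivial.
    · refine ⟨Ω ∩ Metric.ball 0 (R + 1), fun _ => -1, hΩ.inter Metric.isOpen_ball, ⟨hqΩ, hqR⟩,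
        inter_subset_left.trans (subset_closure.trans hsub), inter_subset_right,
        contDiffOn_const, fun x hx _ => ?_, fun x _ => ?_⟩
      · simp [hx.1]
      · simp [pd_const]
    · have hqo : q ∈ outerBoundary Ω γ :=
        ⟨⟨hq.1, fun h => hqΩ (interior_subset h).1⟩, hqΩ, hq.2⟩
      obtain ⟨N, φ, hN, hqN, hφ, hiff, hout⟩ := hb q hqo
      refine ⟨N ∩ U ∩ Metric.ball 0 (R + 1), φ, (hN.inter hU).inter Metric.isOpen_ball,
        ⟨⟨hqN, hsub (hKsub hq)⟩, hqR⟩, fun x hx => hx.1.2, inter_subset_right,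
        hφ.mono fun x hx => hx.1.1, fun x hx => hiff x hx.1.1, fun x hx => hout x hx.1⟩
  choose! N φ hNo hqN hNU hNb hφ hiff hout using hcharts
  obtain ⟨t, htK, hcov⟩ := hKc.elim_nhds_subcover N fun q hq => (hNo q hq).mem_nhds (hqN q hq)
  obtain ⟨f, hf⟩ := SmoothPartitionOfUnity.exists_isSubordinate 𝓘(ℝ, Pt) hKcl
    (fun i : t => N i) (fun i => hNo i (htK i i.2)) (fun x hx => by
      obtain ⟨q, hq, hxq⟩ := mem_iUnion₂.1 (hcov hx)
      exact mem_iUnion.2 ⟨⟨q, hq⟩, hxq⟩)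
  have hsum : ∀ x ∈ K, ∑ i, f i x = 1 := fun x hx => by
    rw [← finsum_eq_sum_of_fintype]; exact f.sum_eq_one hx
  have hfs : ∀ i, ContDiff ℝ 1 (f i) := fun i => by
    have := (f i).contMDiff.contDiff
    exact this.of_le (by exact_mod_cast le_top)
  have hfc : ∀ i, HasCompactSupport (f i) := fun i =>
    (isCompact_closedBall (0 : Pt) (R + 1)).of_isClosed_subset (isClosed_tsupport _)
      ((hf i).trans ((hNb i (htK i i.2)).trans Metric.ball_subset_closedBall))
  have hfJ : ∀ i a, ContDiff ℝ 1 (fun y => f i y * J a y) := fun i a =>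
    contDiff_of_contDiffAt_tsupport (ψ := f i) (fun x hx => by simp [hx]) fun x hx =>
      (hfs i).contDiffAt.mul ((hJ a).contDiffAt (hU.mem_nhds (hNU i (htK i i.2) (hf i hx))))
  have hfJs : ∀ i a, HasCompactSupport (fun y => f i y * J a y) := fun i a =>
    hasCompactSupport_of_zero (fun x hx => by simp [hx]) (hfc i)
  have hchart := Finset.sum_le_sum fun (i : t) (_ : i ∈ Finset.univ) =>
    chart_flux hΩ (hNo i (htK i i.2)) (fun a => (hJ a).mono (hNU i (htK i i.2)))
      (hφ i (htK i i.2)) (hfs i) (fun x => f.nonneg i x) (hfc i) (hf i)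
      (hiff i (htK i i.2)) (hout i (htK i i.2)) hτ
  have hslice : ∀ s : ℝ, 0 ≤ s → s ≤ γ →
      ∑ i, ∫ y in {y | slicePt s y ∈ Ω}, f i (slicePt s y) * J 0 (slicePt s y) =
        ∫ y in {y | slicePt s y ∈ Ω}, J 0 (slicePt s y) := by
    intro s hs hsγ
    have hms : MeasurableSet {y | slicePt s y ∈ Ω} :=
      (hΩ.preimage (continuous_slicePt s)).measurableSet
    rw [← integral_finsetSum]
    · refine setIntegral_congr_fun hms fun y hy => ?_
      change ∑ i, f i (slicePt s y) * J 0 (slicePt s y) = _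
      rw [← Finset.sum_mul, hsum _ ⟨subset_closure ⟨hy, hs⟩, hsγ⟩, one_mul]
    · exact fun i _ => (((hfJ i 0).continuous.comp
        (continuous_slicePt s)).integrable_of_hasCompactSupport
          (hasCompactSupport_comp_slicePt (hfJs i 0) s)).integrableOn
  have hvol : ∑ i, ∫ x in slab τ ∩ Ω, ∑ a, pd a (fun y => f i y * J a y) x =
      ∫ x in slab τ ∩ Ω, ∑ a, pd a (J a) x := by
    rw [← integral_finsetSum]
    -- The partition sums to 1 only on `K`. At `t = 0` and `t = τ` this need not hold on a full
    -- neighbourhood, so its derivatives need not cancel there; both hyperplanes are null sets.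
    · have hnull : ∀ c : ℝ, ∀ᵐ x : Pt, x 0 ≠ c := fun c =>
        compl_mem_ae_iff.2 (Measure.pi_hyperplane (fun _ : Fin 4 => (volume : Measure ℝ)) 0 c)
      refine setIntegral_congr_ae ((isClosed_slab τ).measurableSet.inter hΩ.measurableSet) ?_
      filter_upwards [hnull 0, hnull τ] with x h0 hτ' hx
      rw [Finset.sum_comm]
      refine Finset.sum_congr rfl fun a _ => ?_
      rw [← pd_sum _ fun i _ => ((hfJ i a).differentiable (by norm_num)).differentiableAt]
      refine pd_congr ?_ a
      have hopen : IsOpen (Ω ∩ {x | 0 < x 0 ∧ x 0 < τ}) :=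
        hΩ.inter ((isOpen_lt continuous_const (continuous_apply 0)).inter
          (isOpen_lt (continuous_apply 0) continuous_const))
      filter_upwards [hopen.mem_nhds ⟨hx.2, lt_of_le_of_ne hx.1.1 (Ne.symm h0),
        lt_of_le_of_ne hx.1.2 hτ'⟩] with y hy
      rw [← Finset.sum_mul, hsum _ ⟨subset_closure ⟨hy.1, hy.2.1.le⟩, hy.2.2.le.trans hτγ⟩, one_mul]
    · refine fun i _ => Integrable.integrableOn ?_
      refine integrable_finsetSum _ fun a _ => ?_
      exact (((hfJ i a).continuous_fderiv (by norm_num)).clm_apply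
        continuous_const).integrable_of_hasCompactSupport
          ((hfJs i a).fderiv ℝ |>.mono fun x hx h => hx (by simp [h]))
  rw [Finset.sum_sub_distrib, hslice τ hτ hτγ, hslice 0 le_rfl (hτ.trans hτγ), hvol] at hchart
  exact hchart

/-! ### Linear algebra of Lorentzian metrics -/

/-- Multiplied by `a₀² > 0`, the difference of the two sides is a sum of squares with nonnegative
coefficients in the spatial components `zᵢ` of `a₀ p - p₀ a`. -/
theorem minkowski_reverse_cauchy_schwarz {a p : Fin 4 → ℝ}
    (h : -(a 0 * a 0) + a 1 * a 1 + a 2 * a 2 + a 3 * a 3 < 0) :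
    (-(a 0 * a 0) + a 1 * a 1 + a 2 * a 2 + a 3 * a 3) *
      (-(p 0 * p 0) + p 1 * p 1 + p 2 * p 2 + p 3 * p 3) ≤
      (-(a 0 * p 0) + a 1 * p 1 + a 2 * p 2 + a 3 * p 3) ^ 2 := by
  have h0 : 0 < a 0 ^ 2 := by nlinarith [sq_nonneg (a 1), sq_nonneg (a 2), sq_nonneg (a 3)]
  set z1 := a 0 * p 1 - p 0 * a 1
  set z2 := a 0 * p 2 - p 0 * a 2
  set z3 := a 0 * p 3 - p 0 * a 3
  have key : a 0 ^ 2 * ((-(a 0 * p 0) + a 1 * p 1 + a 2 * p 2 + a 3 * p 3) ^ 2 -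
      (-(a 0 * a 0) + a 1 * a 1 + a 2 * a 2 + a 3 * a 3) *
      (-(p 0 * p 0) + p 1 * p 1 + p 2 * p 2 + p 3 * p 3)) =
      -(-(a 0 * a 0) + a 1 * a 1 + a 2 * a 2 + a 3 * a 3) * (z1 ^ 2 + z2 ^ 2 + z3 ^ 2) +
        (a 1 * z1 + a 2 * z2 + a 3 * z3) ^ 2 := by ring
  have h1 : 0 ≤ -(-(a 0 * a 0) + a 1 * a 1 + a 2 * a 2 + a 3 * a 3) *
      (z1 ^ 2 + z2 ^ 2 + z3 ^ 2) + (a 1 * z1 + a 2 * z2 + a 3 * z3) ^ 2 :=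
    add_nonneg (mul_nonneg (by linarith) (by positivity)) (sq_nonneg _)
  rw [← key] at h1
  exact sub_nonneg.1 (nonneg_of_mul_nonneg_right h1 h0)

/-- The bilinear form with matrix `A`. -/
abbrev form {ι : Type*} [Fintype ι] [DecidableEq ι] (A : Matrix ι ι ℝ) :
    LinearMap.BilinForm ℝ (ι → ℝ) := Matrix.toBilin' A

theorem coInner_eq_form (g : Pt → Mat) (x : Pt) (α β : Fin 4 → ℝ) :
    coInner g x α β = form (g x)⁻¹ α β := by
  rw [form, Matrix.toBilin'_apply, coInner]
  exact Finset.sum_congr rfl fun a _ => Finset.sum_congr rfl fun b _ => by ring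

theorem form_comm {ι : Type*} [Fintype ι] [DecidableEq ι] {A : Matrix ι ι ℝ}
    (hA : A.transpose = A) (v w : ι → ℝ) : form A v w = form A w v := by
  simp only [form, Matrix.toBilin'_apply']
  conv_lhs => rw [← hA]
  rw [Matrix.dotProduct_mulVec, Matrix.vecMul_transpose, dotProduct_comm]

theorem IsLorentzian.isUnit_det {A : Mat} (h : IsLorentzian A) : IsUnit A.det := by
  obtain ⟨P, hP, h⟩ := h
  have := congrArg Matrix.det h
  rw [Matrix.det_mul, Matrix.det_mul, Matrix.det_transpose, Matrix.det_diagonal] at this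
  have h4 : ∏ i, (![-1, 1, 1, 1] : Fin 4 → ℝ) i = -1 := by simp [Fin.prod_univ_four]
  rw [h4] at this
  refine isUnit_iff_ne_zero.2 fun h0 => ?_
  rw [h0] at this
  norm_num at this

/-- Inverting `PᵀAP = η` and using `η² = 1` exhibits `A⁻¹` as the Minkowski form pulled back by
`Pᵀ`. Symmetry and the reverse Cauchy–Schwarz inequality are both read off from this. -/
theorem IsLorentzian.inv_eq {A : Mat} (h : IsLorentzian A) :
    ∃ P : Mat, A⁻¹ = P * Matrix.diagonal ![-1, 1, 1, 1] * P.transpose := by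
  obtain ⟨P, hP, h⟩ := h
  refine ⟨P, Matrix.inv_eq_right_inv ?_⟩
  have hPT : IsUnit P.transpose := by
    rw [Matrix.isUnit_iff_isUnit_det, Matrix.det_transpose]; exact hP
  refine hPT.mul_left_cancel ?_
  have hD : (Matrix.diagonal ![-1, 1, 1, 1] : Mat) * Matrix.diagonal ![-1, 1, 1, 1] = 1 := by
    rw [Matrix.diagonal_mul_diagonal, ← Matrix.diagonal_one]
    congr 1
    ext i
    fin_cases i <;> simp
  calc P.transpose * (A * (P * Matrix.diagonal ![-1, 1, 1, 1] * P.transpose))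
      = (P.transpose * A * P) * Matrix.diagonal ![-1, 1, 1, 1] * P.transpose := by
        simp only [Matrix.mul_assoc]
    _ = P.transpose * 1 := by rw [h, hD, one_mul, mul_one]

theorem IsLorentzian.inv_transpose {A : Mat} (h : IsLorentzian A) : A⁻¹.transpose = A⁻¹ := by
  obtain ⟨P, hP⟩ := h.inv_eq
  rw [hP]
  simp [Matrix.mul_assoc]

theorem IsLorentzian.transpose {A : Mat} (h : IsLorentzian A) : A.transpose = A := by
  have h1 := h.inv_transpose
  rw [Matrix.transpose_nonsing_inv] at h1
  have h2 : IsUnit A.transpose.det := by rw [Matrix.det_transpose]; exact h.isUnit_det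
  rw [← Matrix.nonsing_inv_nonsing_inv _ h2, h1, Matrix.nonsing_inv_nonsing_inv _ h.isUnit_det]

theorem IsLorentzian.reverse_cauchy_schwarz {A : Mat} (h : IsLorentzian A) {n : Fin 4 → ℝ}
    (hn : form A⁻¹ n n < 0) (p : Fin 4 → ℝ) :
    form A⁻¹ n n * form A⁻¹ p p ≤ form A⁻¹ n p ^ 2 := by
  obtain ⟨P, hP⟩ := h.inv_eq
  have key : ∀ v w, form A⁻¹ v w =
      -((P.transpose.mulVec v) 0 * (P.transpose.mulVec w) 0) +
      (P.transpose.mulVec v) 1 * (P.transpose.mulVec w) 1 +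
      (P.transpose.mulVec v) 2 * (P.transpose.mulVec w) 2 +
      (P.transpose.mulVec v) 3 * (P.transpose.mulVec w) 3 := by
    intro v w
    rw [form, Matrix.toBilin'_apply', hP, ← Matrix.mulVec_mulVec, ← Matrix.mulVec_mulVec,
      Matrix.dotProduct_mulVec, ← Matrix.mulVec_transpose]
    simp [dotProduct, Fin.sum_univ_four, Matrix.mulVec_diagonal]
  rw [key] at hn
  simp only [key]
  exact minkowski_reverse_cauchy_schwarz hn

/-- The dominant energy condition for a single covector. -/
theorem IsLorentzian.dominant_energy {A : Mat} (h : IsLorentzian A) {α β : Fin 4 → ℝ}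
    (hα : form A⁻¹ α α < 0) (hβ : form A⁻¹ β β < 0) (hαβ : form A⁻¹ α β < 0) (p : Fin 4 → ℝ) :
    0 ≤ form A⁻¹ α p * form A⁻¹ β p - 1 / 2 * form A⁻¹ α β * form A⁻¹ p p := by
  set B := form A⁻¹ with hB
  have hsymm : ∀ v w, B v w = B w v := form_comm h.inv_transpose
  -- The form `k(v,w) = -B(α,α)B(v,w) + B(α,v)B(α,w)` is positive semidefinite by reverse
  -- Cauchy–Schwarz and degenerate along `α`. Ordinary Cauchy–Schwarz for `k` on `β` and `p`, with
  -- `k(β,β) ≤ B(α,β)²`, gives the claim.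
  let k : LinearMap.BilinForm ℝ (Fin 4 → ℝ) :=
    -(B α α) • B + (LinearMap.mul ℝ ℝ).compl₁₂ (B α) (B α)
  have hk : ∀ v w, k v w = -(B α α) * B v w + B α v * B α w := fun v w => by
    simp [k]
  have hk0 : ∀ v, 0 ≤ k v v := fun v => by
    rw [hk]
    have := h.reverse_cauchy_schwarz hα v
    nlinarith
  have hks : LinearMap.IsSymm k :=
    ⟨fun v w => by change k v w = k w v; rw [hk, hk, hsymm v w]; ring⟩
  have hcs := k.apply_sq_le_of_symm hk0 hks β p
  have hβ' : k β β ≤ B α β ^ 2 := by rw [hk]; nlinarith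
  have h1 : k β p ^ 2 ≤ B α β ^ 2 * k p p :=
    hcs.trans (mul_le_mul_of_nonneg_right hβ' (hk0 p))
  set N := -(B α α)
  have hN : 0 < N := by simp only [N]; linarith
  have e1 : N * B β p = k β p - B α β * B α p := by rw [hk]; ring
  have e2 : N * B p p = k p p - B α p ^ 2 := by rw [hk]; ring
  -- Up to positive factors the wanted quantity is a square plus the deficit in the inequality for
  -- `k`.
  have e3 : 2 * (-(B α β)) * (N * (B α p * B β p - 1 / 2 * B α β * B p p)) =
      (B α β * B α p - k β p) ^ 2 + (B α β ^ 2 * k p p - k β p ^ 2) := by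
    linear_combination (2 * (-(B α β)) * B α p) * e1 + B α β ^ 2 * e2
  have h2 : 0 ≤ 2 * (-(B α β)) * (N * (B α p * B β p - 1 / 2 * B α β * B p p)) := by
    rw [e3]; nlinarith [sq_nonneg (B α β * B α p - k β p)]
  have h3 := nonneg_of_mul_nonneg_right h2 (by linarith)
  exact nonneg_of_mul_nonneg_right h3 hN

/-! ### The unit normal and the associated Riemannian metric at a point -/

section Normal

variable {g : Pt → Mat} {x : Pt}

theorem form_sig : form (g x)⁻¹ sig sig = coInner g x dt dt := by
  have : sig = -dt := rfl
  rw [coInner_eq_form, this]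
  simp

theorem xi_eq_mulVec : (fun a => xi g a x) = (g x)⁻¹.mulVec sig := by
  ext a; simp [xi, Matrix.mulVec, dotProduct]

theorem xi_dot (p : Fin 4 → ℝ) (h : IsLorentzian (g x)) :
    ∑ a, xi g a x * p a = form (g x)⁻¹ sig p := by
  rw [form_comm h.inv_transpose, form, Matrix.toBilin'_apply', ← xi_eq_mulVec, dotProduct]
  exact Finset.sum_congr rfl fun a _ => mul_comm _ _

theorem lapse_sq_sum (h : IsLorentzian (g x)) :
    -∑ a, ∑ b, g x a b * xi g a x * xi g b x = -coInner g x dt dt := by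
  rw [← form_sig, ← xi_dot _ h]
  have : ∀ a, ∑ b, g x a b * xi g a x * xi g b x = xi g a x * sig a := fun a => by
    have h1 : (g x).mulVec ((g x)⁻¹.mulVec sig) = sig := by
      rw [Matrix.mulVec_mulVec, Matrix.mul_nonsing_inv _ h.isUnit_det, Matrix.one_mulVec]
    have h2 := congrFun h1 a
    rw [← xi_eq_mulVec] at h2
    rw [← h2, Matrix.mulVec, dotProduct, Finset.mul_sum]
    exact Finset.sum_congr rfl fun b _ => by ring
  simp_rw [this]

theorem lapse_sq (h : IsLorentzian (g x)) (ht : coInner g x dt dt < 0) :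
    lapse g x ^ 2 = -coInner g x dt dt := by
  rw [lapse, lapse_sq_sum h, Real.sq_sqrt (by linarith)]

theorem lapse_pos (h : IsLorentzian (g x)) (ht : coInner g x dt dt < 0) : 0 < lapse g x := by
  rw [lapse, lapse_sq_sum h]
  exact Real.sqrt_pos.2 (by linarith)

theorem sigHat_eq (h : IsLorentzian (g x)) (a : Fin 4) : sigHat g a x = sig a / lapse g x := by
  have h1 : (g x).mulVec ((g x)⁻¹.mulVec sig) = sig := by
    rw [Matrix.mulVec_mulVec, Matrix.mul_nonsing_inv _ h.isUnit_det, Matrix.one_mulVec]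
  have h2 := congrFun h1 a
  rw [← xi_eq_mulVec] at h2
  rw [← h2, Matrix.mulVec, dotProduct, sigHat, Finset.sum_div]
  exact Finset.sum_congr rfl fun b _ => by rw [xiHat]; ring

theorem form_sigHat (h : IsLorentzian (g x)) (ht : coInner g x dt dt < 0) :
    form (g x)⁻¹ (fun a => sigHat g a x) (fun a => sigHat g a x) = -1 := by
  have h1 : (fun a => sigHat g a x) = (lapse g x)⁻¹ • sig := by
    ext a; rw [sigHat_eq h]; simp [div_eq_inv_mul]
  rw [h1]
  simp only [map_smul, LinearMap.smul_apply, smul_eq_mul]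
  rw [form_sig]
  have := lapse_sq h ht
  have := lapse_pos h ht
  field_simp
  linarith

theorem xiHat_dot (p : Fin 4 → ℝ) (h : IsLorentzian (g x)) :
    ∑ a, xiHat g a x * p a = form (g x)⁻¹ (fun a => sigHat g a x) p := by
  have h1 : (fun a => sigHat g a x) = (lapse g x)⁻¹ • sig := by
    ext a; rw [sigHat_eq h]; simp [div_eq_inv_mul]
  rw [h1, map_smul, LinearMap.smul_apply, ← xi_dot _ h, smul_eq_mul, Finset.mul_sum]
  exact Finset.sum_congr rfl fun a _ => by rw [xiHat]; ring

theorem inv_mulVec_sigHat (h : IsLorentzian (g x)) :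
    (g x)⁻¹.mulVec (fun a => sigHat g a x) = fun a => xiHat g a x := by
  have h1 : (fun a => sigHat g a x) = (g x).mulVec (fun a => xiHat g a x) := by
    ext a; simp [sigHat, Matrix.mulVec, dotProduct]
  rw [h1, Matrix.mulVec_mulVec, Matrix.nonsing_inv_mul _ h.isUnit_det, Matrix.one_mulVec]

theorem sigHat_dot_xiHat (h : IsLorentzian (g x)) (ht : coInner g x dt dt < 0) :
    (fun a => sigHat g a x) ⬝ᵥ (fun a => xiHat g a x) = -1 := by
  rw [← form_sigHat h ht, form, Matrix.toBilin'_apply', inv_mulVec_sigHat h]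

theorem eLow_eq : eLow g x =
    g x + (2 : ℝ) • Matrix.vecMulVec (fun a => sigHat g a x) (fun a => sigHat g a x) := by
  ext a b
  simp [eLow, Matrix.vecMulVec_apply, mul_assoc]

/-- Since `σ̂(ξ̂) = -1`, the rank-one terms of the product have coefficients `2 + 2 - 4 = 0`. -/
theorem eLow_mul (h : IsLorentzian (g x)) (ht : coInner g x dt dt < 0) :
    eLow g x * ((g x)⁻¹ +
      (2 : ℝ) • Matrix.vecMulVec (fun a => xiHat g a x) (fun a => xiHat g a x)) = 1 := by
  have h1 : (g x).mulVec (fun a => xiHat g a x) = fun a => sigHat g a x := by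
    ext a; simp [sigHat, Matrix.mulVec, dotProduct]
  have h2 : Matrix.vecMul (fun a => sigHat g a x) (g x)⁻¹ = fun a => xiHat g a x := by
    rw [← Matrix.mulVec_transpose, h.inv_transpose, inv_mulVec_sigHat h]
  rw [eLow_eq, add_mul, mul_add, mul_add, Matrix.mul_nonsing_inv _ h.isUnit_det,
    Matrix.mul_smul, Matrix.smul_mul, Matrix.smul_mul, Matrix.mul_smul, Matrix.mul_vecMulVec,
    Matrix.vecMulVec_mul, Matrix.vecMulVec_mul_vecMulVec, h1, h2, sigHat_dot_xiHat h ht,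
    neg_one_smul, Matrix.vecMulVec_neg]
  module

theorem eUp_eq (h : IsLorentzian (g x)) (ht : coInner g x dt dt < 0) :
    eUp g x = (g x)⁻¹ +
      (2 : ℝ) • Matrix.vecMulVec (fun a => xiHat g a x) (fun a => xiHat g a x) :=
  Matrix.inv_eq_right_inv (eLow_mul h ht)

theorem eUp_apply (h : IsLorentzian (g x)) (ht : coInner g x dt dt < 0) (a b : Fin 4) :
    eUp g x a b = (g x)⁻¹ a b + 2 * xiHat g a x * xiHat g b x := by
  rw [eUp_eq h ht]
  simp [Matrix.vecMulVec_apply, mul_assoc]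

theorem eLow_mul_eUp (h : IsLorentzian (g x)) (ht : coInner g x dt dt < 0) :
    eLow g x * eUp g x = 1 := by
  rw [eUp_eq h ht, eLow_mul h ht]

/-- As a quadratic form this is `g⁻¹(p,p) + 2 g⁻¹(σ̂,p)²`, and reverse Cauchy–Schwarz with
`g⁻¹(σ̂,σ̂) = -1` gives `g⁻¹(p,p) ≥ -g⁻¹(σ̂,p)²`. -/
theorem eUp_posSemidef (h : IsLorentzian (g x)) (ht : coInner g x dt dt < 0) :
    (eUp g x).PosSemidef := by
  refine Matrix.posSemidef_iff_dotProduct_mulVec.2 ⟨?_, fun p => ?_⟩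
  · rw [eUp_eq h ht, Matrix.IsHermitian, Matrix.conjTranspose_eq_transpose_of_trivial,
      Matrix.transpose_add, h.inv_transpose, Matrix.transpose_smul, Matrix.transpose_vecMulVec]
  · have h1 : star p ⬝ᵥ (eUp g x).mulVec p =
        form (g x)⁻¹ p p + 2 * form (g x)⁻¹ (fun a => sigHat g a x) p ^ 2 := by
      rw [star_trivial, eUp_eq h ht, Matrix.add_mulVec, dotProduct_add, ← xiHat_dot p h,
        form, Matrix.toBilin'_apply', Matrix.smul_mulVec, Matrix.vecMulVec_mulVec,
        dotProduct_smul]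
      simp only [dotProduct, Pi.smul_apply, smul_eq_mul, MulOpposite.smul_eq_mul_unop,
        MulOpposite.unop_op, ← mul_assoc, ← Finset.sum_mul]
      simp_rw [mul_comm (p _) (xiHat g _ x)]
      ring
    rw [h1]
    have h2 := h.reverse_cauchy_schwarz
      (by rw [form_sigHat h ht]; norm_num : form (g x)⁻¹ (fun a => sigHat g a x) _ < 0) p
    rw [form_sigHat h ht] at h2
    nlinarith [sq_nonneg (form (g x)⁻¹ (fun a => sigHat g a x) p)]

theorem eLow_posSemidef (h : IsLorentzian (g x)) (ht : coInner g x dt dt < 0) :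
    (eLow g x).PosSemidef := by
  have h1 := (eUp_posSemidef h ht).inv
  have h2 : (eUp g x)⁻¹ = eLow g x := Matrix.inv_eq_left_inv (eLow_mul_eUp h ht)
  rwa [h2] at h1

end Normal

/-! ### Tensor powers of a quadratic form -/

/-- The components `E_{i₁ j₁} ⋯ E_{i_k j_k}` of a tensor power. -/
def tprod (E : Mat) {k : ℕ} (I J : Fin k → Fin 4) : ℝ := ∏ s, E (I s) (J s)

/-- The bilinear form on tensors of rank `k` induced by `E`. -/
def pairing (E : Mat) {k : ℕ} (v w : (Fin k → Fin 4) → ℝ) : ℝ :=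
  ∑ I, ∑ J, tprod E I J * v I * w J

theorem tprod_comm {E : Mat} (hE : E.transpose = E) {k : ℕ} (I J : Fin k → Fin 4) :
    tprod E I J = tprod E J I :=
  Finset.prod_congr rfl fun s _ => by
    conv_lhs => rw [← hE]
    rfl

theorem pairing_comm {E : Mat} (hE : E.transpose = E) {k : ℕ} (v w : (Fin k → Fin 4) → ℝ) :
    pairing E v w = pairing E w v := by
  rw [pairing, Finset.sum_comm]
  exact Finset.sum_congr rfl fun I _ => Finset.sum_congr rfl fun J _ => by
    rw [tprod_comm hE J I]; ring

theorem tprod_mul (E F : Mat) {k : ℕ} (I J : Fin k → Fin 4) :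
    ∑ K, tprod E I K * tprod F K J = tprod (E * F) I J := by
  simp only [tprod, Matrix.mul_apply, ← Finset.prod_mul_distrib]
  rw [Finset.prod_univ_sum]
  simp [Fintype.piFinset_univ]

theorem tprod_one {k : ℕ} (I J : Fin k → Fin 4) :
    tprod 1 I J = if I = J then 1 else 0 := by
  simp only [tprod, Matrix.one_apply]
  split_ifs with h
  · simp [h]
  · obtain ⟨s, hs⟩ := Function.ne_iff.1 h
    exact Finset.prod_eq_zero (Finset.mem_univ s) (if_neg hs)

/-- A positive semidefinite matrix is a sum of squares of linear forms; products of these forms do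
the same for the tensor power. Inequalities for tensors thereby reduce to inequalities for
covectors. -/
theorem exists_pairing_eq {E : Mat} (hE : E.PosSemidef) (k : ℕ) :
    ∃ (r : ℕ) (B : (Fin k → Fin r) → (Fin k → Fin 4) → ℝ), ∀ v w,
      pairing E v w = ∑ M, (∑ I, B M I * v I) * ∑ J, B M J * w J := by
  obtain ⟨r, b, hb⟩ := Matrix.posSemidef_iff_eq_sum_vecMulVec.1 hE
  have hb' : ∀ i j, E i j = ∑ m, b m i * b m j := fun i j => by
    rw [hb, Matrix.sum_apply]
    simp [Matrix.vecMulVec_apply]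
  refine ⟨r, fun M I => ∏ s, b (M s) (I s), fun v w => ?_⟩
  have h1 : ∀ I J : Fin k → Fin 4, tprod E I J =
      ∑ M : Fin k → Fin r, (∏ s, b (M s) (I s)) * ∏ s, b (M s) (J s) := fun I J => by
    simp only [tprod, hb', ← Finset.prod_mul_distrib]
    rw [Finset.prod_univ_sum]
    simp [Fintype.piFinset_univ]
  simp only [pairing, h1, Finset.sum_mul]
  rw [Finset.sum_congr rfl fun I _ => Finset.sum_comm, Finset.sum_comm]
  refine Finset.sum_congr rfl fun M _ => Finset.sum_congr rfl fun I _ => ?_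
  rw [Finset.mul_sum]
  exact Finset.sum_congr rfl fun J _ => by ring

theorem pairing_self_nonneg {E : Mat} (hE : E.PosSemidef) {k : ℕ} (v : (Fin k → Fin 4) → ℝ) :
    0 ≤ pairing E v v := by
  obtain ⟨r, B, h⟩ := exists_pairing_eq hE k
  rw [h]
  exact Finset.sum_nonneg fun M _ => mul_self_nonneg _

/-- With `u = Bv` one has `|v|² = A(v,u)` and `A(u,u) = B(v,v)`. Cauchy–Schwarz for `A` gives `|v|⁴
≤ A(v,v) B(v,v)`, and `A(v,v)` is at most `C` times the dimension times `|v|²`; one factor `|v|²`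
cancels. -/
theorem sq_sum_le_of_inverse {ι : Type*} [Fintype ι] [DecidableEq ι] {A B : Matrix ι ι ℝ}
    (hA : A.transpose = A) (hA0 : ∀ v, 0 ≤ form A v v) (hAB : A * B = 1) {C : ℝ}
    (hC : ∀ i j, |A i j| ≤ C) (v : ι → ℝ) :
    ∑ i, v i ^ 2 ≤ C * Fintype.card ι * form B v v := by
  rcases isEmpty_or_nonempty ι with hι | ⟨⟨i₀⟩⟩
  · simp
  have hC0 : 0 ≤ C := (abs_nonneg _).trans (hC i₀ i₀)
  set u := B.mulVec v with hu
  have hAu : A.mulVec u = v := by rw [hu, Matrix.mulVec_mulVec, hAB, Matrix.one_mulVec]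
  have h1 : form A v u = ∑ i, v i ^ 2 := by
    rw [form, Matrix.toBilin'_apply', hAu, dotProduct]
    exact Finset.sum_congr rfl fun i _ => (sq _).symm
  have h2 : form A u u = form B v v := by
    rw [form, Matrix.toBilin'_apply', hAu, dotProduct_comm, hu, form, Matrix.toBilin'_apply']
  have hs : LinearMap.IsSymm (form A) := ⟨fun v w => form_comm hA v w⟩
  have h3 := (form A).apply_sq_le_of_symm hA0 hs v u
  rw [h1, h2] at h3
  have h4 : form A v v ≤ C * (Fintype.card ι * ∑ i, v i ^ 2) := by
    rw [form, Matrix.toBilin'_apply]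
    calc ∑ i, ∑ j, v i * A i j * v j ≤ ∑ i, ∑ j, C * (|v i| * |v j|) := by
          refine Finset.sum_le_sum fun i _ => Finset.sum_le_sum fun j _ => ?_
          refine (le_abs_self _).trans ?_
          rw [abs_mul, abs_mul]
          nlinarith [mul_le_mul_of_nonneg_right (hC i j)
            (mul_nonneg (abs_nonneg (v i)) (abs_nonneg (v j)))]
      _ = C * (∑ i, |v i|) ^ 2 := by
          rw [sq, Finset.sum_mul_sum, Finset.mul_sum]
          exact Finset.sum_congr rfl fun i _ => (Finset.mul_sum _ _ _).symm
      _ ≤ C * (Fintype.card ι * ∑ i, v i ^ 2) := by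
          refine mul_le_mul_of_nonneg_left ?_ hC0
          have := sq_sum_le_card_mul_sum_sq (s := Finset.univ) (f := fun i => |v i|)
          simpa using this
  set q := ∑ i, v i ^ 2
  have hq0 : 0 ≤ q := Finset.sum_nonneg fun i _ => sq_nonneg _
  have hB0 : 0 ≤ form B v v := h2 ▸ hA0 u
  rcases hq0.eq_or_lt with h | h
  · rw [← h]; positivity
  · have h5 : q * q ≤ q * (C * Fintype.card ι * form B v v) := by
      have := mul_le_mul_of_nonneg_right h4 hB0
      nlinarith
    exact le_of_mul_le_mul_left h5 h

theorem abs_tprod_le {E : Mat} {C : ℝ} (hC : ∀ a b, |E a b| ≤ C) {k : ℕ} (I J : Fin k → Fin 4) :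
    |tprod E I J| ≤ C ^ k := by
  rw [tprod, Finset.abs_prod]
  refine (Finset.prod_le_prod (fun s _ => abs_nonneg _) fun s _ => hC (I s) (J s)).trans ?_
  simp

theorem form_tprod (E : Mat) {k : ℕ} (v w : (Fin k → Fin 4) → ℝ) :
    form (Matrix.of fun I J => tprod E I J) v w = pairing E v w := by
  rw [form, Matrix.toBilin'_apply, pairing]
  exact Finset.sum_congr rfl fun I _ => Finset.sum_congr rfl fun J _ => by
    rw [Matrix.of_apply]; ring

/-- A tensor power of a Riemannian metric is bounded below in terms of a bound for the components
of the inverse metric. -/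
theorem sq_sum_le_pairing {E F : Mat} (hE : E.PosSemidef) (hEF : E * F = 1) {C : ℝ}
    (hC : ∀ a b, |E a b| ≤ C) {k : ℕ} (v : (Fin k → Fin 4) → ℝ) :
    ∑ I, v I ^ 2 ≤ C ^ k * 4 ^ k * pairing F v v := by
  have hE' : E.transpose = E := by
    simpa [Matrix.IsHermitian, Matrix.conjTranspose_eq_transpose_of_trivial] using hE.1
  have := sq_sum_le_of_inverse (A := Matrix.of fun I J : Fin k → Fin 4 => tprod E I J)
    (B := Matrix.of fun I J => tprod F I J) (by ext I J; exact tprod_comm hE' J I)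
    (fun v => by rw [form_tprod]; exact pairing_self_nonneg hE v)
    (by
      ext I J
      simp only [Matrix.mul_apply, Matrix.of_apply]
      rw [tprod_mul, hEF, tprod_one, Matrix.one_apply])
    (C := C ^ k) (fun I J => abs_tprod_le hC I J) v
  rw [form_tprod] at this
  simpa using this

theorem sum_cons {k : ℕ} (F : (Fin (k + 1) → Fin 4) → ℝ) :
    ∑ I, F I = ∑ c, ∑ I : Fin k → Fin 4, F (Fin.cons c I) := by
  rw [← (Fin.consEquiv fun _ : Fin (k + 1) => Fin 4).sum_comp, Fintype.sum_prod_type]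
  rfl

theorem pairing_cons (E : Mat) {k : ℕ} (v w : (Fin (k + 1) → Fin 4) → ℝ) :
    pairing E v w = ∑ c, ∑ d, E c d *
      pairing E (fun I : Fin k → Fin 4 => v (Fin.cons c I)) (fun J => w (Fin.cons d J)) := by
  simp only [pairing, sum_cons]
  refine Finset.sum_congr rfl fun c _ => ?_
  rw [Finset.sum_comm]
  refine Finset.sum_congr rfl fun d _ => ?_
  rw [Finset.mul_sum]
  refine Finset.sum_congr rfl fun I _ => ?_
  rw [Finset.mul_sum]
  refine Finset.sum_congr rfl fun J _ => ?_
  simp only [tprod, Fin.prod_univ_succ, Fin.cons_zero, Fin.cons_succ]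
  ring

/-- The dominant energy condition for tensors. -/
theorem IsLorentzian.dominant_energy_pairing {A E : Mat} (h : IsLorentzian A)
    (hE : E.PosSemidef) {α β : Fin 4 → ℝ} (hα : form A⁻¹ α α < 0) (hβ : form A⁻¹ β β < 0)
    (hαβ : form A⁻¹ α β < 0) {k : ℕ} (P : Fin 4 → (Fin k → Fin 4) → ℝ) :
    0 ≤ ∑ c, ∑ d, (A⁻¹.mulVec α c * A⁻¹.mulVec β d - 1 / 2 * form A⁻¹ α β * A⁻¹ c d) *
      pairing E (P c) (P d) := by
  obtain ⟨r, B, hB⟩ := exists_pairing_eq hE k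
  -- Each square in the decomposition of `E` contracts `P` to a single covector `p M`, to which the
  -- scalar inequality applies.
  obtain ⟨p, h1⟩ : ∃ p : (Fin k → Fin r) → Fin 4 → ℝ, ∀ c d,
      pairing E (P c) (P d) = ∑ M, p M c * p M d :=
    ⟨fun M c => ∑ I, B M I * P c I, fun c d => hB _ _⟩
  have h2 : ∑ c, ∑ d, (A⁻¹.mulVec α c * A⁻¹.mulVec β d - 1 / 2 * form A⁻¹ α β * A⁻¹ c d) *
      pairing E (P c) (P d) = ∑ M, (form A⁻¹ α (p M) * form A⁻¹ β (p M) -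
        1 / 2 * form A⁻¹ α β * form A⁻¹ (p M) (p M)) := by
    have hf : ∀ γ q, form A⁻¹ γ q = ∑ c, A⁻¹.mulVec γ c * q c := fun γ q => by
      rw [form_comm h.inv_transpose, form, Matrix.toBilin'_apply', dotProduct]
      exact Finset.sum_congr rfl fun c _ => mul_comm _ _
    have hg : ∀ q, form A⁻¹ q q = ∑ c, ∑ d, A⁻¹ c d * (q c * q d) := fun q => by
      rw [form, Matrix.toBilin'_apply]
      exact Finset.sum_congr rfl fun c _ => Finset.sum_congr rfl fun d _ => by ring
    simp_rw [h1, Finset.mul_sum]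
    rw [Finset.sum_congr rfl fun c _ => Finset.sum_comm, Finset.sum_comm]
    refine Finset.sum_congr rfl fun M _ => ?_
    rw [hf α (p M), hf β (p M), hg (p M), Finset.sum_mul_sum, Finset.mul_sum,
      ← Finset.sum_sub_distrib]
    refine Finset.sum_congr rfl fun c _ => ?_
    rw [Finset.mul_sum, ← Finset.sum_sub_distrib]
    exact Finset.sum_congr rfl fun d _ => by ring
  rw [h2]
  exact Finset.sum_nonneg fun M _ => h.dominant_energy hα hβ hαβ (p M)

/-! ### Smooth Lorentzian metrics -/

/-- A smooth Lorentzian metric on the open set `U`, for which the level sets of `t` are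
space-like. -/
structure SmoothLorentz (U : Set Pt) (g : Pt → Mat) : Prop where
  isOpen : IsOpen U
  smooth : ∀ a b, ContDiffOn ℝ ∞ (fun x => g x a b) U
  lorentzian : ∀ x ∈ U, IsLorentzian (g x)
  timelike : ∀ x ∈ U, coInner g x dt dt < 0

theorem differentiableAt_of_smooth {U : Set Pt} (hU : IsOpen U) {F : Pt → ℝ}
    (hF : ContDiffOn ℝ ∞ F U) {x : Pt} (hx : x ∈ U) : DifferentiableAt ℝ F x :=
  (hF.contDiffAt (hU.mem_nhds hx)).differentiableAt (by simp)

theorem smooth_pd {U : Set Pt} (hU : IsOpen U) {F : Pt → ℝ} (hF : ContDiffOn ℝ ∞ F U)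
    (a : Fin 4) : ContDiffOn ℝ ∞ (pd a F) U :=
  contDiffOn_pd hU hF (by simp) a

theorem smooth_det {U : Set Pt} {A : Pt → Mat} (hA : ∀ a b, ContDiffOn ℝ ∞ (fun x => A x a b) U) :
    ContDiffOn ℝ ∞ (fun x => (A x).det) U := by
  simp only [Matrix.det_apply']
  exact ContDiffOn.sum fun σ _ => contDiffOn_const.mul (contDiffOn_prod fun i _ => hA _ _)

/-- The matrix of the Christoffel symbols `Γ^c_{ab}` for fixed `a`. -/
def connMat (g : Pt → Mat) (a : Fin 4) (x : Pt) : Mat := Matrix.of fun c b => christoffel g c a b x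

/-- The componentwise partial derivative of a matrix field. -/
def pdMat (a : Fin 4) (A : Pt → Mat) (x : Pt) : Mat := Matrix.of fun b c => pd a (fun y => A y b c) x

theorem pdMat_mul {A B : Pt → Mat} {x : Pt} (hA : ∀ b c, DifferentiableAt ℝ (fun y => A y b c) x)
    (hB : ∀ b c, DifferentiableAt ℝ (fun y => B y b c) x) (a : Fin 4) :
    pdMat a (fun y => A y * B y) x = pdMat a A x * B x + A x * pdMat a B x := by
  ext b c
  simp only [pdMat, Matrix.of_apply, Matrix.mul_apply, Matrix.add_apply]
  rw [pd_sum (F := fun d y => A y b d * B y d c) _ fun d _ => (hA b d).mul (hB d c),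
    ← Finset.sum_add_distrib]
  exact Finset.sum_congr rfl fun d _ => pd_mul (hA b d) (hB d c) a

/-- Jacobi's formula. -/
theorem pd_det {A : Pt → Mat} {x : Pt} (hA : ∀ b c, DifferentiableAt ℝ (fun y => A y b c) x)
    (a : Fin 4) : pd a (fun y => (A y).det) x = ((A x).adjugate * pdMat a A x).trace := by
  -- By Cramer's rule a diagonal entry of the product is the determinant with one column
  -- differentiated; summing over columns is Leibniz' rule for the determinant.
  have h1 : ∀ i, ((A x).adjugate * pdMat a A x) i i =
      ((A x).updateCol i fun b => pdMat a A x b i).det := fun i => by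
    rw [← Matrix.cramer_apply, Matrix.cramer_eq_adjugate_mulVec]
    rfl
  simp only [Matrix.trace, Matrix.diag_apply, h1, Matrix.det_apply']
  rw [pd_sum]
  · rw [Finset.sum_comm]
    refine Finset.sum_congr rfl fun σ _ => ?_
    rw [pd_const_mul (HasFDerivAt.finsetProd fun i _ => (hA _ _).hasFDerivAt).differentiableAt, ← Finset.mul_sum]
    congr 1
    rw [pd, fderiv_finsetProd fun i _ => hA _ _]
    simp only [sum_apply, smul_apply, smul_eq_mul]
    refine Finset.sum_congr rfl fun i _ => ?_
    rw [← Finset.mul_prod_erase Finset.univ _ (Finset.mem_univ i), Matrix.updateCol_self, mul_comm]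
    congr 1
    refine Finset.prod_congr rfl fun j hj => ?_
    rw [Matrix.updateCol_ne (Finset.ne_of_mem_erase hj)]
  · exact fun σ _ => (differentiableAt_const _).mul
      (HasFDerivAt.finsetProd fun i _ => (hA _ _).hasFDerivAt).differentiableAt

theorem christoffel_symm_of_symm {g : Pt → Mat} {x : Pt}
    (hs : ∀ᶠ y in 𝓝 x, (g y).transpose = g y) (c a b : Fin 4) :
    christoffel g c a b x = christoffel g c b a x := by
  have h : ∀ d, pd d (fun y => g y a b) x = pd d (fun y => g y b a) x := fun d =>
    pd_congr (hs.mono fun y hy => congrFun (congrFun hy.symm a) b) d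
  simp only [christoffel]
  congr 1
  exact Finset.sum_congr rfl fun d _ => by rw [h d]; ring

namespace SmoothLorentz

variable {U : Set Pt} {g : Pt → Mat} (hg : SmoothLorentz U g)
include hg

theorem smooth_inv (a b : Fin 4) : ContDiffOn ℝ ∞ (fun x => (g x)⁻¹ a b) U := by
  have hdet := smooth_det hg.smooth
  have hadj : ContDiffOn ℝ ∞ (fun x => (g x).adjugate a b) U := by
    simp only [Matrix.adjugate_apply]
    refine smooth_det fun c d => ?_
    by_cases h : c = b
    · subst h; simpa using contDiffOn_const
    · simpa [Matrix.updateRow_ne h] using hg.smooth c d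
  refine ((hdet.inv fun x hx => (hg.lorentzian x hx).isUnit_det.ne_zero).mul hadj).congr
    fun x hx => ?_
  simp [Matrix.inv_def, Ring.inverse_eq_inv']

theorem smooth_christoffel (c a b : Fin 4) : ContDiffOn ℝ ∞ (christoffel g c a b) U :=
  contDiffOn_const.mul (ContDiffOn.sum fun d _ => (hg.smooth_inv c d).mul
    (((smooth_pd hg.isOpen (hg.smooth b d) a).add (smooth_pd hg.isOpen (hg.smooth a d) b)).sub
      (smooth_pd hg.isOpen (hg.smooth a b) d)))

theorem smooth_xi (a : Fin 4) : ContDiffOn ℝ ∞ (xi g a) U :=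
  ContDiffOn.sum fun b _ => (hg.smooth_inv a b).mul contDiffOn_const

theorem lapse_pos {x : Pt} (hx : x ∈ U) : 0 < lapse g x :=
  WaveEnergy.lapse_pos (hg.lorentzian x hx) (hg.timelike x hx)

theorem smooth_lapse : ContDiffOn ℝ ∞ (lapse g) U := by
  refine ContDiffOn.sqrt (ContDiffOn.neg (ContDiffOn.sum fun a _ => ContDiffOn.sum fun b _ =>
    ((hg.smooth a b).mul (hg.smooth_xi a)).mul (hg.smooth_xi b))) fun x hx => ?_
  rw [lapse_sq_sum (hg.lorentzian x hx)]
  exact (neg_pos.2 (hg.timelike x hx)).ne'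

theorem smooth_xiHat (a : Fin 4) : ContDiffOn ℝ ∞ (xiHat g a) U :=
  (hg.smooth_xi a).div hg.smooth_lapse fun _ hx => (hg.lapse_pos hx).ne'

theorem smooth_sigHat (a : Fin 4) : ContDiffOn ℝ ∞ (sigHat g a) U :=
  ContDiffOn.sum fun b _ => (hg.smooth a b).mul (hg.smooth_xiHat b)

theorem eUp_apply {x : Pt} (hx : x ∈ U) (a b : Fin 4) :
    eUp g x a b = (g x)⁻¹ a b + 2 * xiHat g a x * xiHat g b x :=
  WaveEnergy.eUp_apply (hg.lorentzian x hx) (hg.timelike x hx) a b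

theorem smooth_eUp (a b : Fin 4) : ContDiffOn ℝ ∞ (fun x => eUp g x a b) U :=
  ((hg.smooth_inv a b).add ((contDiffOn_const (c := (2 : ℝ)).mul (hg.smooth_xiHat a)).mul
    (hg.smooth_xiHat b))).congr fun _ hx => hg.eUp_apply hx a b

theorem smooth_volDensity : ContDiffOn ℝ ∞ (volDensity g) U := by
  have h0 : ∀ x ∈ U, (g x).det ≠ 0 := fun x hx => (hg.lorentzian x hx).isUnit_det.ne_zero
  exact ((smooth_det hg.smooth).abs h0).sqrt fun x hx => (abs_pos.2 (h0 x hx)).ne'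

theorem volDensity_pos {x : Pt} (hx : x ∈ U) : 0 < volDensity g x :=
  Real.sqrt_pos.2 (abs_pos.2 (hg.lorentzian x hx).isUnit_det.ne_zero)

theorem christoffel_symm {x : Pt} (hx : x ∈ U) (c a b : Fin 4) :
    christoffel g c a b x = christoffel g c b a x :=
  christoffel_symm_of_symm (eventually_of_mem (hg.isOpen.mem_nhds hx) fun y hy =>
    (hg.lorentzian y hy).transpose) c a b

/-- The Levi-Civita connection is metric. -/
theorem pdMat_metric {x : Pt} (hx : x ∈ U) (a : Fin 4) :
    pdMat a g x = (connMat g a x).transpose * g x + g x * connMat g a x := by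
  have hs : ∀ d b c, pd d (fun y => g y b c) x = pd d (fun y => g y c b) x := fun d b c =>
    pd_congr (eventually_of_mem (hg.isOpen.mem_nhds hx) fun y hy => by
      conv_lhs => rw [← (hg.lorentzian y hy).transpose]
      rfl) d
  -- `L` is the Christoffel symbol with its upper index lowered. In `L + Lᵀ` the derivatives in the
  -- directions other than `a` cancel.
  set L : Mat := Matrix.of fun d b => (1 / 2 : ℝ) *
    (pd a (fun y => g y b d) x + pd b (fun y => g y a d) x - pd d (fun y => g y a b) x) with hL
  have hΓ : connMat g a x = (g x)⁻¹ * L := by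
    ext c b
    simp only [connMat, Matrix.of_apply, christoffel, Matrix.mul_apply, hL, Finset.mul_sum]
    exact Finset.sum_congr rfl fun d _ => by ring
  have h1 : g x * connMat g a x = L := by
    rw [hΓ, ← Matrix.mul_assoc, Matrix.mul_nonsing_inv _ (hg.lorentzian x hx).isUnit_det, one_mul]
  have h2 : (connMat g a x).transpose * g x = L.transpose := by
    rw [← h1, Matrix.transpose_mul, (hg.lorentzian x hx).transpose]
  rw [h1, h2]
  ext b c
  simp only [pdMat, hL, Matrix.add_apply, Matrix.transpose_apply, Matrix.of_apply]
  rw [hs a c b, hs b a c, hs c a b]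
  ring

/-- Differentiation of `g⁻¹ g = 1` combined with metricity: the coordinate form of `∇g⁻¹ = 0`. -/
theorem pdMat_inv {x : Pt} (hx : x ∈ U) (a : Fin 4) :
    pdMat a (fun y => (g y)⁻¹) x =
      -(connMat g a x * (g x)⁻¹ + (g x)⁻¹ * (connMat g a x).transpose) := by
  have hdet := (hg.lorentzian x hx).isUnit_det
  have h1 : pdMat a (fun y => (g y)⁻¹ * g y) x = 0 := by
    ext b c
    have : (fun y => ((g y)⁻¹ * g y) b c) =ᶠ[𝓝 x] fun _ => (1 : Mat) b c :=
      eventually_of_mem (hg.isOpen.mem_nhds hx) fun y hy => by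
        simp only [Matrix.nonsing_inv_mul _ (hg.lorentzian y hy).isUnit_det]
    simp only [pdMat, Matrix.of_apply, Matrix.zero_apply]
    rw [pd_congr this, pd_const]
  rw [pdMat_mul (fun b c => differentiableAt_of_smooth hg.isOpen (hg.smooth_inv b c) hx)
    (fun b c => differentiableAt_of_smooth hg.isOpen (hg.smooth b c) hx),
    hg.pdMat_metric hx] at h1
  have h2 : pdMat a (fun y => (g y)⁻¹) x * g x * (g x)⁻¹ = pdMat a (fun y => (g y)⁻¹) x := by
    rw [Matrix.mul_assoc, Matrix.mul_nonsing_inv _ hdet, mul_one]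
  rw [← h2, eq_neg_of_add_eq_zero_left h1, neg_mul, mul_add, add_mul]
  congr 1
  rw [add_comm]
  congr 1
  · rw [← Matrix.mul_assoc, Matrix.nonsing_inv_mul _ hdet, one_mul]
  · rw [Matrix.mul_assoc, Matrix.mul_assoc, Matrix.mul_nonsing_inv _ hdet, mul_one]

theorem pd_volDensity {x : Pt} (hx : x ∈ U) (a : Fin 4) :
    pd a (volDensity g) x = volDensity g x * ∑ b, christoffel g b b a x := by
  have hd0 := (hg.lorentzian x hx).isUnit_det.ne_zero
  have hdet : pd a (fun y => (g y).det) x = (g x).det * (2 * ∑ b, christoffel g b b a x) := by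
    rw [pd_det (fun b c => differentiableAt_of_smooth hg.isOpen (hg.smooth b c) hx)]
    have hadj : (g x).adjugate = (g x).det • (g x)⁻¹ := by
      rw [Matrix.inv_def, smul_smul, Ring.inverse_eq_inv', mul_inv_cancel₀ hd0, one_smul]
    rw [hadj, hg.pdMat_metric hx, Matrix.smul_mul, Matrix.trace_smul, smul_eq_mul, mul_add,
      Matrix.trace_add, ← Matrix.mul_assoc, ← Matrix.mul_assoc,
      Matrix.nonsing_inv_mul _ (hg.lorentzian x hx).isUnit_det, one_mul, Matrix.trace_mul_comm,
      ← Matrix.mul_assoc, Matrix.mul_nonsing_inv _ (hg.lorentzian x hx).isUnit_det, one_mul,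
      Matrix.trace_transpose, ← two_mul]
    congr 2
    simp only [Matrix.trace, Matrix.diag_apply, connMat, Matrix.of_apply]
    exact Finset.sum_congr rfl fun b _ => hg.christoffel_symm hx b a b
  have hsm := differentiableAt_of_smooth hg.isOpen (smooth_det hg.smooth) hx
  have hpos := hg.volDensity_pos hx
  -- The fourth power of the density is the polynomial `det²`. Differentiating this identity removes
  -- both the root and the absolute value.
  have hsq : (fun y => volDensity g y * volDensity g y * (volDensity g y * volDensity g y))
      = fun y => (g y).det * (g y).det := by
    ext y
    simp only [volDensity]
    rw [Real.mul_self_sqrt (abs_nonneg _), abs_mul_abs_self]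
  have hv := differentiableAt_of_smooth hg.isOpen hg.smooth_volDensity hx
  have h2 := congrArg (fun F => pd a F x) hsq
  rw [pd_mul (hv.fun_mul hv) (hv.fun_mul hv), pd_mul hv hv, pd_mul hsm hsm, hdet] at h2
  have h3 := congrFun hsq x
  have h4 : 4 * (volDensity g x ^ 3) * (pd a (volDensity g) x -
      volDensity g x * ∑ b, christoffel g b b a x) = 0 := by
    linear_combination h2 - 4 * (∑ b, christoffel g b b a x) * h3
  have h5 : (4 * (volDensity g x ^ 3)) ≠ 0 := by positivity
  exact sub_eq_zero.1 ((mul_eq_zero.1 h4).resolve_left h5)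

/-- The formula `∂_a |g|^{1/2} = |g|^{1/2} Γ^b_{ba}` turns a coordinate divergence into a covariant
one. The flux inequality in `ℝ⁴` can therefore be applied to `|g|^{1/2} X`. -/
theorem div_density {x : Pt} (hx : x ∈ U) {X : Fin 4 → Pt → ℝ}
    (hX : ∀ a, DifferentiableAt ℝ (X a) x) :
    ∑ a, pd a (fun y => volDensity g y * X a y) x =
      volDensity g x * ∑ a, covVec g X a a x := by
  have hv := differentiableAt_of_smooth hg.isOpen hg.smooth_volDensity hx
  have h1 : ∀ a, pd a (fun y => volDensity g y * X a y) x =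
      volDensity g x * ((∑ b, christoffel g b b a x * X a x) + pd a (X a) x) := fun a => by
    rw [pd_mul hv (hX a), hg.pd_volDensity hx, ← Finset.sum_mul]; ring
  simp_rw [h1, ← Finset.mul_sum]
  congr 1
  simp only [covVec, Finset.sum_add_distrib]
  rw [Finset.sum_comm, add_comm]

end SmoothLorentz

/-! ### The connection on tensors -/

/-- The connection term `∑_s γ^c_{i_s} T_{i₁ … c … i_k}`. -/
def conn (γ : Fin 4 → Fin 4 → ℝ) {k : ℕ} (T : (Fin k → Fin 4) → ℝ) (I : Fin k → Fin 4) : ℝ :=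
  ∑ s, ∑ c, γ c (I s) * T (Function.update I s c)

/-- The derivation of `pairing E` in the direction `H`. -/
def pairingD (E H : Mat) {k : ℕ} (v w : (Fin k → Fin 4) → ℝ) : ℝ :=
  ∑ I, ∑ J, (∑ s, (∏ r ∈ Finset.univ.erase s, E (I r) (J r)) * H (I s) (J s)) * v I * w J

/-- Exchanging the `s`-th entry of `I` with `c` is an involution of the index set. -/
theorem sum_update_swap {k : ℕ} (s : Fin k) (F : (Fin k → Fin 4) → Fin 4 → ℝ) :
    ∑ I, ∑ c, F I c = ∑ I, ∑ c, F (Function.update I s c) (I s) := by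
  rw [← Fintype.sum_prod_type', ← Fintype.sum_prod_type']
  refine (Equiv.sum_comp (Function.Involutive.toPerm
    (fun p : (Fin k → Fin 4) × Fin 4 => (Function.update p.1 s p.2, p.1 s)) fun p => ?_) _).symm
  simp

theorem tprod_update (E : Mat) {k : ℕ} (I J : Fin k → Fin 4) (s : Fin k) (c : Fin 4) :
    tprod E (Function.update I s c) J =
      (∏ r ∈ Finset.univ.erase s, E (I r) (J r)) * E c (J s) := by
  rw [tprod, ← Finset.mul_prod_erase Finset.univ _ (Finset.mem_univ s), Function.update_self,
    mul_comm]
  congr 1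
  exact Finset.prod_congr rfl fun r hr => by
    rw [Function.update_of_ne (Finset.ne_of_mem_erase hr)]

/-- A linear map acting on one factor `E` can be moved onto the corresponding slot of the tensor.
This makes the connection terms in the derivative of `e` cancel against those hidden in partial
derivatives of tensors. -/
theorem pairingD_mul_left (E G : Mat) {k : ℕ} (v w : (Fin k → Fin 4) → ℝ) :
    pairingD E (G * E) v w = pairing E (conn (fun c b => G c b) v) w := by
  rw [pairingD, pairing, Finset.sum_comm]
  conv_rhs => rw [Finset.sum_comm]
  refine Finset.sum_congr rfl fun J _ => ?_
  rw [← Finset.sum_mul, ← Finset.sum_mul]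
  congr 1
  simp only [conn, Finset.mul_sum, Finset.sum_mul, Matrix.mul_apply]
  rw [Finset.sum_comm]
  conv_rhs => rw [Finset.sum_comm]
  refine Finset.sum_congr rfl fun s _ => ?_
  rw [sum_update_swap s]
  refine Finset.sum_congr rfl fun I _ => Finset.sum_congr rfl fun c _ => ?_
  have := tprod_update E (Function.update I s c) J s (I s)
  rw [Function.update_idem, Function.update_eq_self] at this
  rw [Function.update_self, this]
  ring

theorem pairingD_swap (E H : Mat) {k : ℕ} (v w : (Fin k → Fin 4) → ℝ) :
    pairingD E H v w = pairingD E.transpose H.transpose w v := by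
  rw [pairingD, Finset.sum_comm, pairingD]
  exact Finset.sum_congr rfl fun I _ => Finset.sum_congr rfl fun J _ => by
    simp only [Matrix.transpose_apply]; ring

theorem pairing_swap (E : Mat) {k : ℕ} (v w : (Fin k → Fin 4) → ℝ) :
    pairing E v w = pairing E.transpose w v := by
  rw [pairing, Finset.sum_comm, pairing]
  exact Finset.sum_congr rfl fun I _ => Finset.sum_congr rfl fun J _ => by
    simp only [tprod, Matrix.transpose_apply]; ring

theorem pairingD_mul_right (E G : Mat) {k : ℕ} (v w : (Fin k → Fin 4) → ℝ) :
    pairingD E (E * G.transpose) v w = pairing E v (conn (fun c b => G c b) w) := by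
  rw [pairingD_swap, Matrix.transpose_mul, Matrix.transpose_transpose, pairingD_mul_left,
    pairing_swap, Matrix.transpose_transpose]

theorem pairingD_add (E H H' : Mat) {k : ℕ} (v w : (Fin k → Fin 4) → ℝ) :
    pairingD E (H + H') v w = pairingD E H v w + pairingD E H' v w := by
  simp only [pairingD, Matrix.add_apply, mul_add, Finset.sum_add_distrib, add_mul]

theorem pairingD_neg (E H : Mat) {k : ℕ} (v w : (Fin k → Fin 4) → ℝ) :
    pairingD E (-H) v w = -pairingD E H v w := by
  simp only [pairingD, Matrix.neg_apply, mul_neg, Finset.sum_neg_distrib, neg_mul]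

theorem pairing_add_left (E : Mat) {k : ℕ} (u v w : (Fin k → Fin 4) → ℝ) :
    pairing E (fun I => u I + v I) w = pairing E u w + pairing E v w := by
  simp only [pairing, mul_add, add_mul, Finset.sum_add_distrib]

theorem pairing_sub_left (E : Mat) {k : ℕ} (u v w : (Fin k → Fin 4) → ℝ) :
    pairing E (fun I => u I - v I) w = pairing E u w - pairing E v w := by
  simp only [pairing, mul_sub, sub_mul, Finset.sum_sub_distrib]

theorem pairing_smul_left (E : Mat) {k : ℕ} (c : ℝ) (v w : (Fin k → Fin 4) → ℝ) :
    pairing E (fun I => c * v I) w = c * pairing E v w := by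
  simp only [pairing, Finset.mul_sum]
  exact Finset.sum_congr rfl fun I _ => Finset.sum_congr rfl fun J _ => by ring

theorem pairing_sum_left (E : Mat) {k : ℕ} {ι : Type*} (t : Finset ι)
    (v : ι → (Fin k → Fin 4) → ℝ) (w : (Fin k → Fin 4) → ℝ) :
    pairing E (fun I => ∑ i ∈ t, v i I) w = ∑ i ∈ t, pairing E (v i) w := by
  simp only [pairing, Finset.mul_sum, Finset.sum_mul]
  rw [Finset.sum_congr rfl fun I _ => Finset.sum_comm, Finset.sum_comm]

theorem pairing_add_right (E : Mat) {k : ℕ} (u v w : (Fin k → Fin 4) → ℝ) :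
    pairing E w (fun I => u I + v I) = pairing E w u + pairing E w v := by
  simp only [pairing_swap E w, pairing_add_left]

theorem pairing_sub_right (E : Mat) {k : ℕ} (u v w : (Fin k → Fin 4) → ℝ) :
    pairing E w (fun I => u I - v I) = pairing E w u - pairing E w v := by
  simp only [pairing_swap E w, pairing_sub_left]

theorem pairing_smul_right (E : Mat) {k : ℕ} (c : ℝ) (v w : (Fin k → Fin 4) → ℝ) :
    pairing E w (fun I => c * v I) = c * pairing E w v := by
  simp only [pairing_swap E w, pairing_smul_left]

theorem pairing_sum_right (E : Mat) {k : ℕ} {ι : Type*} (t : Finset ι)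
    (v : ι → (Fin k → Fin 4) → ℝ) (w : (Fin k → Fin 4) → ℝ) :
    pairing E w (fun I => ∑ i ∈ t, v i I) = ∑ i ∈ t, pairing E w (v i) := by
  simp only [pairing_swap E w, pairing_sum_left]

theorem covD_cons (g : Pt → Mat) {k : ℕ} (T : (Fin k → Fin 4) → Pt → ℝ) (a : Fin 4)
    (I : Fin k → Fin 4) (x : Pt) :
    covD g T (Fin.cons a I) x =
      pd a (T I) x - conn (fun c b => christoffel g c a b x) (fun K => T K x) I := by
  simp only [covD, Fin.cons_zero, Fin.tail_cons, conn]

theorem conn_cons (γ : Fin 4 → Fin 4 → ℝ) {k : ℕ} (T : (Fin (k + 1) → Fin 4) → ℝ) (b : Fin 4)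
    (I : Fin k → Fin 4) :
    conn γ T (Fin.cons b I) =
      (∑ c, γ c b * T (Fin.cons c I)) + conn γ (fun K => T (Fin.cons b K)) I := by
  simp only [conn, Fin.sum_univ_succ (n := k), Fin.cons_zero, Fin.cons_succ, Fin.update_cons_zero,
    Fin.cons_update]

namespace SmoothLorentz

variable {U : Set Pt} {g : Pt → Mat} (hg : SmoothLorentz U g)
include hg

theorem smooth_covD {k : ℕ} {T : (Fin k → Fin 4) → Pt → ℝ} (hT : ∀ I, ContDiffOn ℝ ∞ (T I) U)
    (I : Fin (k + 1) → Fin 4) : ContDiffOn ℝ ∞ (covD g T I) U :=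
  (smooth_pd hg.isOpen (hT _) _).sub (ContDiffOn.sum fun _ _ => ContDiffOn.sum fun _ _ =>
    (hg.smooth_christoffel _ _ _).mul (hT _))

theorem smooth_nabla {u : Pt → ℝ} (hu : ContDiffOn ℝ ∞ u U) :
    ∀ (k : ℕ) (I : Fin k → Fin 4), ContDiffOn ℝ ∞ (nabla g u k I) U
  | 0, _ => hu
  | k + 1, I => hg.smooth_covD (smooth_nabla hu k) I

/-- The covariant derivative of the inverse Riemannian metric `e^{bc}`. -/
theorem pdMat_eUp {x : Pt} (hx : x ∈ U) (a : Fin 4) :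
    pdMat a (eUp g) x = -(connMat g a x * eUp g x + eUp g x * (connMat g a x).transpose) +
      Matrix.of fun b c => 2 * (covVec g (xiHat g) a b x * xiHat g c x +
        xiHat g b x * covVec g (xiHat g) a c x) := by
  ext b c
  have hd : ∀ i, DifferentiableAt ℝ (xiHat g i) x := fun i =>
    differentiableAt_of_smooth hg.isOpen (hg.smooth_xiHat i) hx
  have hdG := differentiableAt_of_smooth hg.isOpen (hg.smooth_inv b c) hx
  have h1 : pd a (fun y => eUp g y b c) x =
      pd a (fun y => (g y)⁻¹ b c + 2 * (xiHat g b y * xiHat g c y)) x :=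
    pd_congr (eventually_of_mem (hg.isOpen.mem_nhds hx) fun y hy => by
      simp only [hg.eUp_apply hy b c]; ring) a
  have h2 := congrFun (congrFun (hg.pdMat_inv hx a) b) c
  simp only [pdMat, Matrix.of_apply] at h2
  rw [pdMat, Matrix.of_apply, h1, pd_add hdG (((hd b).fun_mul (hd c)).const_mul 2),
    pd_const_mul ((hd b).fun_mul (hd c)), pd_mul (hd b) (hd c), h2]
  simp only [covVec, connMat, Matrix.add_apply, Matrix.neg_apply, Matrix.mul_apply,
    Matrix.transpose_apply, Matrix.of_apply, hg.eUp_apply hx, Fin.sum_univ_four]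
  ring

/-- The product rule for the contraction of two tensors with the Riemannian metric. -/
theorem pd_pairing {x : Pt} (hx : x ∈ U) {k : ℕ} {v w : (Fin k → Fin 4) → Pt → ℝ}
    (hv : ∀ I, DifferentiableAt ℝ (v I) x) (hw : ∀ I, DifferentiableAt ℝ (w I) x) (a : Fin 4) :
    pd a (fun y => pairing (eUp g y) (fun I => v I y) fun I => w I y) x =
      pairing (eUp g x) (fun I => covD g v (Fin.cons a I) x) (fun I => w I x) +
      pairing (eUp g x) (fun I => v I x) (fun I => covD g w (Fin.cons a I) x) +
      pairingD (eUp g x) (Matrix.of fun b c => 2 * (covVec g (xiHat g) a b x * xiHat g c x +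
        xiHat g b x * covVec g (xiHat g) a c x)) (fun I => v I x) (fun I => w I x) := by
  have hde : ∀ b c, DifferentiableAt ℝ (fun y => eUp g y b c) x := fun b c =>
    differentiableAt_of_smooth hg.isOpen (hg.smooth_eUp b c) hx
  have hdt : ∀ I J : Fin k → Fin 4, DifferentiableAt ℝ (fun y => tprod (eUp g y) I J) x :=
    fun I J => (HasFDerivAt.finsetProd fun s _ => (hde (I s) (J s)).hasFDerivAt).differentiableAt
  have hpt : ∀ I J : Fin k → Fin 4, pd a (fun y => tprod (eUp g y) I J) x =
      ∑ s, (∏ r ∈ Finset.univ.erase s, eUp g x (I r) (J r)) * pdMat a (eUp g) x (I s) (J s) :=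
    fun I J => by
    simp only [tprod]
    rw [pd, fderiv_finsetProd fun s _ => hde (I s) (J s)]
    simp only [sum_apply, smul_apply, smul_eq_mul]
    rfl
  have h1 : pd a (fun y => pairing (eUp g y) (fun I => v I y) fun I => w I y) x =
      pairingD (eUp g x) (pdMat a (eUp g) x) (fun I => v I x) (fun I => w I x) +
      pairing (eUp g x) (fun I => pd a (v I) x) (fun I => w I x) +
      pairing (eUp g x) (fun I => v I x) (fun I => pd a (w I) x) := by
    simp only [pairing, pairingD, ← Finset.sum_add_distrib]
    rw [pd_sum _ fun I _ => DifferentiableAt.fun_sum fun J _ =>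
      ((hdt I J).fun_mul (hv I)).fun_mul (hw J)]
    refine Finset.sum_congr rfl fun I _ => ?_
    rw [pd_sum _ fun J _ => ((hdt I J).fun_mul (hv I)).fun_mul (hw J)]
    refine Finset.sum_congr rfl fun J _ => ?_
    rw [pd_mul ((hdt I J).fun_mul (hv I)) (hw J), pd_mul (hdt I J) (hv I), hpt]
    ring
  -- The connection part of the derivative of `e` completes the partial derivatives of `v` and `w`
  -- to covariant ones; only the contribution of `∇e` remains.
  rw [h1, hg.pdMat_eUp hx, pairingD_add, pairingD_neg, pairingD_add, pairingD_mul_left,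
    pairingD_mul_right]
  simp only [covD_cons, pairing_sub_left, pairing_sub_right, connMat, Matrix.of_apply]
  ring

end SmoothLorentz

/-! ### The energy currents and their divergence -/

/-- The current `-T^{ab,j}(u) ξ̂_b`; its flux through `S_τ` is the energy. -/
def current (g : Pt → Mat) (u : Pt → ℝ) (j : ℕ) (a : Fin 4) (x : Pt) : ℝ :=
  -∑ b, energyTensor g u j a b x * sigHat g b x

/-- The contraction of `∇_c W` and `∇_d W` with the Riemannian metric, for `W = ∇ᵏu`. -/
def stress (g : Pt → Mat) (u : Pt → ℝ) (k : ℕ) (x : Pt) : Mat :=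
  Matrix.of fun c d => pairing (eUp g x) (fun I : Fin k → Fin 4 => nabla g u (k + 1) (Fin.cons c I) x)
    fun I => nabla g u (k + 1) (Fin.cons d I) x

/-- The covariant derivative `∇_a e^{bc}`. -/
def covE (g : Pt → Mat) (a : Fin 4) (x : Pt) : Mat :=
  Matrix.of fun b c => 2 * (covVec g (xiHat g) a b x * xiHat g c x +
    xiHat g b x * covVec g (xiHat g) a c x)

/-- The components of `g^{ab}∇_a∇_b W`, for `W = ∇ᵏu`. -/
def boxNabla (g : Pt → Mat) (u : Pt → ℝ) (k : ℕ) (I : Fin k → Fin 4) (x : Pt) : ℝ :=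
  ∑ a, ∑ b, (g x)⁻¹ a b * nabla g u (k + 2) (Fin.cons a (Fin.cons b I)) x

/-- The commutator `[∇_a, ∇_b] W`, for `W = ∇ᵏu`. -/
def commNabla (g : Pt → Mat) (u : Pt → ℝ) (k : ℕ) (a b : Fin 4) (I : Fin k → Fin 4) (x : Pt) : ℝ :=
  nabla g u (k + 2) (Fin.cons a (Fin.cons b I)) x - nabla g u (k + 2) (Fin.cons b (Fin.cons a I)) x

/-- With `c` frozen, the tensor is differentiated as one of rank `k`, without the connection term
for the slot of `c`. The sum on the right restores that term. -/
theorem covD_slot (g : Pt → Mat) {k : ℕ} (T : (Fin (k + 1) → Fin 4) → Pt → ℝ) (a c : Fin 4)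
    (I : Fin k → Fin 4) (x : Pt) :
    covD g (fun K => T (Fin.cons c K)) (Fin.cons a I) x =
      covD g T (Fin.cons a (Fin.cons c I)) x +
        ∑ f, christoffel g f a c x * T (Fin.cons f I) x := by
  rw [covD_cons, covD_cons, conn_cons]
  ring

theorem energyTensor_succ (g : Pt → Mat) (u : Pt → ℝ) (k : ℕ) (a b : Fin 4) (x : Pt) :
    energyTensor g u (k + 1) a b x = ∑ c, ∑ d,
      ((g x)⁻¹ a c * (g x)⁻¹ b d - (1 / 2) * (g x)⁻¹ a b * (g x)⁻¹ c d) * stress g u k x c d := by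
  simp only [energyTensor, stress, pairing, Matrix.of_apply, Finset.mul_sum, tprod]
  exact Finset.sum_congr rfl fun c _ => Finset.sum_congr rfl fun d _ =>
    Finset.sum_congr rfl fun I _ => Finset.sum_congr rfl fun J _ => by ring

namespace SmoothLorentz

variable {U : Set Pt} {g : Pt → Mat} (hg : SmoothLorentz U g)
include hg

theorem smooth_tprod_eUp {k : ℕ} (I J : Fin k → Fin 4) :
    ContDiffOn ℝ ∞ (fun y => tprod (eUp g y) I J) U :=
  contDiffOn_prod fun s _ => hg.smooth_eUp (I s) (J s)

theorem smooth_stress {u : Pt → ℝ} (hu : ContDiffOn ℝ ∞ u U) (k : ℕ) (c d : Fin 4) :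
    ContDiffOn ℝ ∞ (fun y => stress g u k y c d) U :=
  ContDiffOn.sum fun I _ => ContDiffOn.sum fun J _ =>
    ((hg.smooth_tprod_eUp I J).mul (hg.smooth_nabla hu _ _)).mul (hg.smooth_nabla hu _ _)

theorem smooth_energyTensor {u : Pt → ℝ} (hu : ContDiffOn ℝ ∞ u U) (j : ℕ) (a b : Fin 4) :
    ContDiffOn ℝ ∞ (energyTensor g u j a b) U := by
  cases j with
  | zero => exact (contDiffOn_const.mul (hg.smooth_inv a b)).mul (hu.pow 2)
  | succ k =>
    refine ContDiffOn.sum fun c _ => ContDiffOn.sum fun d _ => ContDiffOn.sum fun I _ =>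
      ContDiffOn.sum fun J _ => (((((hg.smooth_inv a c).mul (hg.smooth_inv b d)).sub
        ((contDiffOn_const.mul (hg.smooth_inv a b)).mul (hg.smooth_inv c d))).mul
        (hg.smooth_tprod_eUp I J)).mul (hg.smooth_nabla hu _ _)).mul (hg.smooth_nabla hu _ _)

theorem smooth_current {u : Pt → ℝ} (hu : ContDiffOn ℝ ∞ u U) (j : ℕ) (a : Fin 4) :
    ContDiffOn ℝ ∞ (current g u j a) U :=
  (ContDiffOn.sum fun b _ => (hg.smooth_energyTensor hu j a b).mul (hg.smooth_sigHat b)).neg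

theorem inv_sigHat {x : Pt} (hx : x ∈ U) (a : Fin 4) :
    ∑ b, (g x)⁻¹ a b * sigHat g b x = xiHat g a x :=
  congrFun (inv_mulVec_sigHat (hg.lorentzian x hx)) a

theorem current_zero (u : Pt → ℝ) {x : Pt} (hx : x ∈ U) (a : Fin 4) :
    current g u 0 a x = 1 / 2 * (xiHat g a x * (u x * u x)) := by
  rw [← hg.inv_sigHat hx, current, Finset.sum_mul, Finset.mul_sum, ← Finset.sum_neg_distrib]
  exact Finset.sum_congr rfl fun b _ => by simp only [energyTensor]; ring

theorem inv_symm {x : Pt} (hx : x ∈ U) (a b : Fin 4) : (g x)⁻¹ a b = (g x)⁻¹ b a :=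
  congrFun (congrFun (hg.lorentzian x hx).inv_transpose.symm a) b

theorem current_succ (u : Pt → ℝ) (k : ℕ) {x : Pt} (hx : x ∈ U) (a : Fin 4) :
    current g u (k + 1) a x =
      1 / 2 * (xiHat g a x * ∑ c, ∑ d, (g x)⁻¹ c d * stress g u k x c d) -
      ∑ c, ∑ d, (g x)⁻¹ a c * xiHat g d x * stress g u k x c d := by
  rw [current]
  simp_rw [energyTensor_succ, Finset.sum_mul]
  rw [Finset.sum_comm, Finset.mul_sum, Finset.mul_sum, ← Finset.sum_neg_distrib,
    ← Finset.sum_sub_distrib]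
  refine Finset.sum_congr rfl fun c _ => ?_
  rw [Finset.sum_comm, Finset.mul_sum, Finset.mul_sum, ← Finset.sum_neg_distrib,
    ← Finset.sum_sub_distrib]
  refine Finset.sum_congr rfl fun d _ => ?_
  rw [← hg.inv_sigHat hx a, ← hg.inv_sigHat hx d, Finset.mul_sum, Finset.sum_mul, Finset.sum_mul,
    Finset.mul_sum, ← Finset.sum_sub_distrib, ← Finset.sum_neg_distrib]
  exact Finset.sum_congr rfl fun b _ => by rw [hg.inv_symm hx d b]; ring

theorem eUp_transpose {x : Pt} (hx : x ∈ U) : (eUp g x).transpose = eUp g x := by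
  simpa [Matrix.IsHermitian, Matrix.conjTranspose_eq_transpose_of_trivial] using
    (eUp_posSemidef (hg.lorentzian x hx) (hg.timelike x hx)).1

/-- The covariant derivative of the tensor field `stress`. -/
theorem pdMat_stress {u : Pt → ℝ} (hu : ContDiffOn ℝ ∞ u U) (k : ℕ) {x : Pt} (hx : x ∈ U)
    (a : Fin 4) :
    pdMat a (stress g u k) x = (Matrix.of fun c d =>
      pairing (eUp g x) (fun I => nabla g u (k + 2) (Fin.cons a (Fin.cons c I)) x)
        (fun I => nabla g u (k + 1) (Fin.cons d I) x) +
      pairing (eUp g x) (fun I => nabla g u (k + 1) (Fin.cons c I) x)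
        (fun I => nabla g u (k + 2) (Fin.cons a (Fin.cons d I)) x) +
      pairingD (eUp g x) (covE g a x) (fun I : Fin k → Fin 4 => nabla g u (k + 1) (Fin.cons c I) x)
        fun I => nabla g u (k + 1) (Fin.cons d I) x) +
      ((connMat g a x).transpose * stress g u k x + stress g u k x * connMat g a x) := by
  have hd : ∀ K : Fin (k + 1) → Fin 4, DifferentiableAt ℝ (nabla g u (k + 1) K) x := fun K =>
    differentiableAt_of_smooth hg.isOpen (hg.smooth_nabla hu _ K) hx
  ext c d
  have h1 := hg.pd_pairing hx (v := fun I : Fin k → Fin 4 => nabla g u (k + 1) (Fin.cons c I))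
    (w := fun I => nabla g u (k + 1) (Fin.cons d I)) (fun I => hd _) (fun I => hd _) a
  simp only [covD_slot, pairing_add_left, pairing_add_right, pairing_sum_left, pairing_sum_right,
    pairing_smul_left, pairing_smul_right] at h1
  simp only [pdMat, stress, Matrix.of_apply, Matrix.add_apply, Matrix.mul_apply,
    Matrix.transpose_apply, connMat]
  rw [h1]
  simp only [nabla, covE, mul_comm (pairing _ _ _) (christoffel _ _ _ _ _)]
  ring

/-- Product rule for `g^{bc} S_{cd} X^d`. -/
theorem covVec_contract {x : Pt} (hx : x ∈ U) {S : Pt → Mat} {X : Fin 4 → Pt → ℝ}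
    (hS : ∀ c d, DifferentiableAt ℝ (fun y => S y c d) x) (hX : ∀ d, DifferentiableAt ℝ (X d) x)
    {a : Fin 4} {R : Mat} (hR : pdMat a S x = R + ((connMat g a x).transpose * S x +
      S x * connMat g a x)) (b : Fin 4) :
    covVec g (fun b y => ∑ c, ∑ d, (g y)⁻¹ b c * X d y * S y c d) a b x =
      ∑ c, ∑ d, (g x)⁻¹ b c * (X d x * R c d + covVec g X a d x * S x c d) := by
  have hG : ∀ c, DifferentiableAt ℝ (fun y => (g y)⁻¹ b c) x := fun c =>
    differentiableAt_of_smooth hg.isOpen (hg.smooth_inv b c) hx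
  have h1 : pd a (fun y => ∑ c, ∑ d, (g y)⁻¹ b c * X d y * S y c d) x =
      (pdMat a (fun y => (g y)⁻¹) x).mulVec ((S x).mulVec fun d => X d x) b +
      (g x)⁻¹.mulVec ((pdMat a S x).mulVec fun d => X d x) b +
      (g x)⁻¹.mulVec ((S x).mulVec fun d => pd a (X d) x) b := by
    simp only [Matrix.mulVec, dotProduct, Finset.mul_sum, ← Finset.sum_add_distrib]
    rw [pd_sum _ fun c _ => DifferentiableAt.fun_sum fun d _ =>
      ((hG c).fun_mul (hX d)).fun_mul (hS c d)]
    refine Finset.sum_congr rfl fun c _ => ?_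
    rw [pd_sum _ fun d _ => ((hG c).fun_mul (hX d)).fun_mul (hS c d)]
    refine Finset.sum_congr rfl fun d _ => ?_
    rw [pd_mul ((hG c).fun_mul (hX d)) (hS c d), pd_mul (hG c) (hX d)]
    simp only [pdMat, Matrix.of_apply]
    ring
  have h2 : (fun d => pd a (X d) x) =
      (fun d => covVec g X a d x) - (connMat g a x).mulVec fun d => X d x := by
    ext d
    simp [covVec, connMat, Matrix.mulVec, dotProduct]
  have h3 : ∑ c, christoffel g b a c x * ∑ c', ∑ d, (g x)⁻¹ c c' * X d x * S x c' d =
      (connMat g a x).mulVec ((g x)⁻¹.mulVec ((S x).mulVec fun d => X d x)) b := by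
    simp only [connMat, Matrix.mulVec, dotProduct, Matrix.of_apply, Finset.mul_sum]
    exact Finset.sum_congr rfl fun c _ => Finset.sum_congr rfl fun c' _ =>
      Finset.sum_congr rfl fun d _ => by ring
  have h4 : ∑ c, ∑ d, (g x)⁻¹ b c * (X d x * R c d + covVec g X a d x * S x c d) =
      ((g x)⁻¹.mulVec (R.mulVec fun d => X d x) +
        (g x)⁻¹.mulVec ((S x).mulVec fun d => covVec g X a d x)) b := by
    simp only [Pi.add_apply, Matrix.mulVec, dotProduct, Finset.mul_sum, ← Finset.sum_add_distrib]
    exact Finset.sum_congr rfl fun c _ => Finset.sum_congr rfl fun d _ => by ring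
  rw [covVec, h1, h3, h4, h2, hR, hg.pdMat_inv hx, ← Pi.add_apply, ← Pi.add_apply, ← Pi.add_apply]
  refine congrFun ?_ b
  simp only [Matrix.mulVec_add, Matrix.mulVec_sub, Matrix.mulVec_mulVec, neg_add, Matrix.add_mul,
    Matrix.neg_mul, Matrix.mul_assoc, Matrix.add_mulVec, Matrix.neg_mulVec]
  abel

/-- Product rule for `g^{cd} S_{cd}`. -/
theorem pd_contract {x : Pt} (hx : x ∈ U) {S : Pt → Mat}
    (hS : ∀ c d, DifferentiableAt ℝ (fun y => S y c d) x)
    {a : Fin 4} {R : Mat} (hR : pdMat a S x = R + ((connMat g a x).transpose * S x +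
      S x * connMat g a x)) :
    pd a (fun y => ∑ c, ∑ d, (g y)⁻¹ c d * S y c d) x = ∑ c, ∑ d, (g x)⁻¹ c d * R c d := by
  have hG : ∀ b c, DifferentiableAt ℝ (fun y => (g y)⁻¹ b c) x := fun b c =>
    differentiableAt_of_smooth hg.isOpen (hg.smooth_inv b c) hx
  have htr : ∀ A B : Mat, ∑ c, ∑ d, A c d * B c d = (A * B.transpose).trace := fun A B => by
    simp [Matrix.trace, Matrix.mul_apply]
  have h1 : pd a (fun y => ∑ c, ∑ d, (g y)⁻¹ c d * S y c d) x =
      ∑ c, ∑ d, pdMat a (fun y => (g y)⁻¹) x c d * S x c d +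
        ∑ c, ∑ d, (g x)⁻¹ c d * pdMat a S x c d := by
    simp only [← Finset.sum_add_distrib]
    rw [pd_sum _ fun c _ => DifferentiableAt.fun_sum fun d _ => (hG c d).fun_mul (hS c d)]
    refine Finset.sum_congr rfl fun c _ => ?_
    rw [pd_sum _ fun d _ => (hG c d).fun_mul (hS c d)]
    exact Finset.sum_congr rfl fun d _ => pd_mul (hG c d) (hS c d) a
  rw [h1, htr, htr, htr, hR, hg.pdMat_inv hx]
  simp only [Matrix.transpose_add, Matrix.transpose_mul, Matrix.transpose_transpose, mul_add,
    Matrix.neg_mul, add_mul, Matrix.trace_add, Matrix.trace_neg]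
  rw [Matrix.mul_assoc (connMat g a x), Matrix.trace_mul_comm (connMat g a x)]
  simp only [Matrix.mul_assoc]
  ring

end SmoothLorentz

/-! ### Product rules for vector fields and the divergence of the currents -/

theorem covVec_mul (g : Pt → Mat) (X : Fin 4 → Pt → ℝ) (F : Pt → ℝ) {x : Pt}
    (hX : ∀ b, DifferentiableAt ℝ (X b) x) (hF : DifferentiableAt ℝ F x) (a b : Fin 4) :
    covVec g (fun b y => X b y * F y) a b x = covVec g X a b x * F x + X b x * pd a F x := by
  simp only [covVec]
  rw [pd_mul (hX b) hF, add_mul, Finset.sum_mul]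
  simp_rw [mul_assoc]
  ring

theorem covVec_sub (g : Pt → Mat) {X Y : Fin 4 → Pt → ℝ} {x : Pt}
    (hX : ∀ b, DifferentiableAt ℝ (X b) x) (hY : ∀ b, DifferentiableAt ℝ (Y b) x) (a b : Fin 4) :
    covVec g (fun b y => X b y - Y b y) a b x = covVec g X a b x - covVec g Y a b x := by
  simp only [covVec, mul_sub, Finset.sum_sub_distrib]
  rw [pd_sub (hX b) (hY b)]
  ring

theorem covVec_const_mul (g : Pt → Mat) {X : Fin 4 → Pt → ℝ} {x : Pt}
    (hX : ∀ b, DifferentiableAt ℝ (X b) x) (c : ℝ) (a b : Fin 4) :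
    covVec g (fun b y => c * X b y) a b x = c * covVec g X a b x := by
  simp only [covVec]
  rw [pd_const_mul (hX b), mul_add, Finset.mul_sum]
  congr 1
  exact Finset.sum_congr rfl fun d _ => by ring

theorem covVec_congr (g : Pt → Mat) {X Y : Fin 4 → Pt → ℝ} {x : Pt}
    (h : ∀ᶠ y in 𝓝 x, ∀ b, X b y = Y b y) (a b : Fin 4) :
    covVec g X a b x = covVec g Y a b x := by
  simp only [covVec]
  rw [pd_congr (h.mono fun y hy => hy b)]
  congr 1
  exact Finset.sum_congr rfl fun d _ => by rw [h.self_of_nhds d]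


/-- The index algebra behind `div_current_succ`, with `P = ∇W`, `Q = ∇∇W`, `B = ∇ξ̂` and `D` the
contribution of `∇e`. By the symmetry of `G` and of the pairing, the trace part of the stress
contributes `G^{ac} ξ^d ⟨P_c, Q_{da}⟩`. Against `-G^{ac} ξ^d ⟨P_c, Q_{ad}⟩` this leaves a
commutator, and the remaining second derivatives are contracted to the wave operator. -/
theorem stress_divergence_algebra (G e : Mat) (ξ : Fin 4 → ℝ) (B : Fin 4 → Fin 4 → ℝ) (F : ℝ)
    (S : Fin 4 → Fin 4 → ℝ) (D : Fin 4 → Fin 4 → Fin 4 → ℝ) {k : ℕ}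
    (P : Fin 4 → (Fin k → Fin 4) → ℝ) (Q : Fin 4 → Fin 4 → (Fin k → Fin 4) → ℝ)
    (hG : ∀ a b, G a b = G b a) (hsym : ∀ v w : (Fin k → Fin 4) → ℝ, pairing e v w = pairing e w v) :
    ∑ a, (1 / 2 * (B a a * F + ξ a * ∑ c, ∑ d, G c d * (pairing e (Q a c) (P d) +
        pairing e (P c) (Q a d) + D a c d)) -
      ∑ c, ∑ d, G a c * (ξ d * (pairing e (Q a c) (P d) + pairing e (P c) (Q a d) + D a c d) +
        B a d * S c d)) =
      1 / 2 * ((∑ a, B a a) * F) - (∑ a, ∑ c, ∑ d, G a c * B a d * S c d) +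
      1 / 2 * (∑ a, ∑ c, ∑ d, ξ a * G c d * D a c d) -
      (∑ a, ∑ c, ∑ d, G a c * ξ d * D a c d) -
      (∑ d, ξ d * pairing e (fun I => ∑ a, ∑ b, G a b * Q a b I) (P d)) -
      ∑ a, ∑ c, ∑ d, G a c * ξ d * pairing e (P c) fun I => Q a d I - Q d a I := by
  have e1 : ∀ d, pairing e (fun I => ∑ a, ∑ b, G a b * Q a b I) (P d) =
      ∑ a, ∑ c, G a c * pairing e (Q a c) (P d) := fun d => by
    simp only [pairing_sum_left, pairing_smul_left]
  have e2 : ∀ a c d, pairing e (P c) (fun I => Q a d I - Q d a I) =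
      pairing e (P c) (Q a d) - pairing e (P c) (Q d a) := fun a c d => by
    simp only [pairing_sub_right]
  simp_rw [e2, e1]
  have e3 : ∀ a, ∑ c, ∑ d, G c d * (pairing e (Q a c) (P d) + pairing e (P c) (Q a d)) =
      2 * ∑ c, ∑ d, G c d * pairing e (P c) (Q a d) := fun a => by
    simp only [mul_add, Finset.sum_add_distrib, two_mul]
    congr 1
    rw [Finset.sum_comm]
    exact Finset.sum_congr rfl fun c _ => Finset.sum_congr rfl fun d _ => by
      rw [hsym, hG]
  have e4 : ∑ a, ξ a * ∑ c, ∑ d, G c d * pairing e (P c) (Q a d) =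
      ∑ a, ∑ c, ∑ d, G a c * ξ d * pairing e (P c) (Q d a) := by
    simp only [Finset.mul_sum]
    rw [Finset.sum_comm]
    conv_rhs => rw [Finset.sum_comm]
    refine Finset.sum_congr rfl fun c _ => ?_
    rw [Finset.sum_comm]
    refine Finset.sum_congr rfl fun a _ => Finset.sum_congr rfl fun d _ => ?_
    rw [hG c a]
    ring
  have e5 : ∑ d, ξ d * ∑ a, ∑ c, G a c * pairing e (Q a c) (P d) =
      ∑ a, ∑ c, ∑ d, G a c * ξ d * pairing e (Q a c) (P d) := by
    simp only [Finset.mul_sum]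
    rw [Finset.sum_comm]
    refine Finset.sum_congr rfl fun a _ => ?_
    rw [Finset.sum_comm]
    exact Finset.sum_congr rfl fun c _ => Finset.sum_congr rfl fun d _ => by ring
  rw [e5]
  simp only [mul_sub, Finset.sum_sub_distrib]
  rw [← e4]
  have e6 : ∀ a, ∑ c, ∑ d, G c d * (pairing e (Q a c) (P d) + pairing e (P c) (Q a d) +
      D a c d) = 2 * (∑ c, ∑ d, G c d * pairing e (P c) (Q a d)) +
      ∑ c, ∑ d, G c d * D a c d := fun a => by
    rw [← e3, ← Finset.sum_add_distrib]
    refine Finset.sum_congr rfl fun c _ => ?_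
    rw [← Finset.sum_add_distrib]
    exact Finset.sum_congr rfl fun d _ => by ring
  have e7 : ∀ a, ∑ c, ∑ d, G a c * (ξ d * (pairing e (Q a c) (P d) +
      pairing e (P c) (Q a d) + D a c d) +
      B a d * S c d) =
      (∑ c, ∑ d, G a c * ξ d * pairing e (Q a c) (P d)) +
      (∑ c, ∑ d, G a c * ξ d * pairing e (P c) (Q a d)) +
      (∑ c, ∑ d, G a c * ξ d * D a c d) +
      ∑ c, ∑ d, G a c * B a d * S c d := fun a => by
    simp only [← Finset.sum_add_distrib]
    exact Finset.sum_congr rfl fun c _ => Finset.sum_congr rfl fun d _ => by ring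
  have e8 : ∀ a, ∑ c, ∑ d, ξ a * G c d * D a c d =
      ξ a * ∑ c, ∑ d, G c d * D a c d := fun a => by
    simp only [Finset.mul_sum, mul_assoc]
  simp_rw [e8]
  rw [Finset.sum_congr rfl fun a _ => by rw [e6 a]]
  rw [Finset.sum_congr rfl fun a _ => e7 a]
  simp only [mul_add, Finset.sum_add_distrib, ← Finset.mul_sum, ← Finset.sum_mul]
  have e9 : ∀ F : Fin 4 → ℝ, ∑ a, ξ a * (2 * F a) = 2 * ∑ a, ξ a * F a :=
    fun F => by rw [Finset.mul_sum]; exact Finset.sum_congr rfl fun a _ => by ring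
  rw [e9]
  ring

namespace SmoothLorentz

variable {U : Set Pt} {g : Pt → Mat} (hg : SmoothLorentz U g)
include hg

theorem div_current_zero {u : Pt → ℝ} (hu : ContDiffOn ℝ ∞ u U) {x : Pt} (hx : x ∈ U) :
    ∑ a, covVec g (current g u 0) a a x =
      1 / 2 * (∑ a, covVec g (xiHat g) a a x) * (u x * u x) +
        ∑ a, xiHat g a x * (u x * nabla g u 1 (Fin.cons a Fin.elim0) x) := by
  have hξ : ∀ a, DifferentiableAt ℝ (xiHat g a) x := fun a =>
    differentiableAt_of_smooth hg.isOpen (hg.smooth_xiHat a) hx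
  have hux := differentiableAt_of_smooth hg.isOpen hu hx
  rw [mul_assoc, Finset.sum_mul, Finset.mul_sum, ← Finset.sum_add_distrib]
  refine Finset.sum_congr rfl fun a _ => ?_
  rw [covVec_congr g (Y := fun a y => 1 / 2 * (xiHat g a y * (u y * u y)))
    (eventually_of_mem (hg.isOpen.mem_nhds hx) fun y hy b => hg.current_zero u hy b),
    covVec_const_mul g (fun b => (hξ b).fun_mul (hux.fun_mul hux)),
    covVec_mul g _ _ hξ (hux.fun_mul hux), pd_mul hux hux]
  have : nabla g u 1 (Fin.cons a Fin.elim0) x = pd a u x := by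
    simp [nabla, covD]
  rw [this]
  ring

/-- The divergence of the energy currents. Only the wave operator and commutators of covariant
derivatives occur besides quadratic terms in the first derivatives of `∇ᵏu`. -/
theorem div_current_succ {u : Pt → ℝ} (hu : ContDiffOn ℝ ∞ u U) (k : ℕ) {x : Pt} (hx : x ∈ U) :
    ∑ a, covVec g (current g u (k + 1)) a a x =
      1 / 2 * ((∑ a, covVec g (xiHat g) a a x) * ∑ c, ∑ d, (g x)⁻¹ c d * stress g u k x c d) -
      (∑ a, ∑ c, ∑ d, (g x)⁻¹ a c * covVec g (xiHat g) a d x * stress g u k x c d) +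
      1 / 2 * (∑ a, ∑ c, ∑ d, xiHat g a x * (g x)⁻¹ c d * pairingD (eUp g x) (covE g a x)
        (fun I : Fin k → Fin 4 => nabla g u (k + 1) (Fin.cons c I) x)
        fun I => nabla g u (k + 1) (Fin.cons d I) x) -
      (∑ a, ∑ c, ∑ d, (g x)⁻¹ a c * xiHat g d x * pairingD (eUp g x) (covE g a x)
        (fun I : Fin k → Fin 4 => nabla g u (k + 1) (Fin.cons c I) x)
        fun I => nabla g u (k + 1) (Fin.cons d I) x) -
      (∑ d, xiHat g d x * pairing (eUp g x) (fun I => boxNabla g u k I x)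
        fun I => nabla g u (k + 1) (Fin.cons d I) x) -
      ∑ a, ∑ c, ∑ d, (g x)⁻¹ a c * xiHat g d x * pairing (eUp g x)
        (fun I => nabla g u (k + 1) (Fin.cons c I) x) fun I => commNabla g u k a d I x := by
  have hξ : ∀ a, DifferentiableAt ℝ (xiHat g a) x := fun a =>
    differentiableAt_of_smooth hg.isOpen (hg.smooth_xiHat a) hx
  have hG : ∀ b c, DifferentiableAt ℝ (fun y => (g y)⁻¹ b c) x := fun b c =>
    differentiableAt_of_smooth hg.isOpen (hg.smooth_inv b c) hx
  have hS : ∀ c d, DifferentiableAt ℝ (fun y => stress g u k y c d) x := fun c d =>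
    differentiableAt_of_smooth hg.isOpen (hg.smooth_stress hu k c d) hx
  have hf : DifferentiableAt ℝ (fun y => ∑ c, ∑ d, (g y)⁻¹ c d * stress g u k y c d) x :=
    DifferentiableAt.fun_sum fun c _ => DifferentiableAt.fun_sum fun d _ =>
      (hG c d).fun_mul (hS c d)
  have hZ : ∀ a, DifferentiableAt ℝ
      (fun y => ∑ c, ∑ d, (g y)⁻¹ a c * xiHat g d y * stress g u k y c d) x := fun a =>
    DifferentiableAt.fun_sum fun c _ => DifferentiableAt.fun_sum fun d _ =>
      ((hG a c).fun_mul (hξ d)).fun_mul (hS c d)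
  have h1 : ∀ a, covVec g (current g u (k + 1)) a a x =
      1 / 2 * (covVec g (xiHat g) a a x * (∑ c, ∑ d, (g x)⁻¹ c d * stress g u k x c d) +
        xiHat g a x * pd a (fun y => ∑ c, ∑ d, (g y)⁻¹ c d * stress g u k y c d) x) -
      covVec g (fun b y => ∑ c, ∑ d, (g y)⁻¹ b c * xiHat g d y * stress g u k y c d) a a x := by
    intro a
    rw [covVec_congr g (Y := fun a y =>
      1 / 2 * (xiHat g a y * ∑ c, ∑ d, (g y)⁻¹ c d * stress g u k y c d) -
      ∑ c, ∑ d, (g y)⁻¹ a c * xiHat g d y * stress g u k y c d)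
      (eventually_of_mem (hg.isOpen.mem_nhds hx) fun y hy b => hg.current_succ u k hy b),
      covVec_sub g (fun b => ((hξ b).fun_mul hf).const_mul _) hZ,
      covVec_const_mul g (fun b => (hξ b).fun_mul hf), covVec_mul g _ _ hξ hf]
  simp_rw [h1, hg.pd_contract hx hS (hg.pdMat_stress hu k hx _),
    hg.covVec_contract hx hS hξ (hg.pdMat_stress hu k hx _), Matrix.of_apply]
  exact stress_divergence_algebra _ _ (xiHat g · x) (fun a d => covVec g (xiHat g) a d x) _
    (fun c d => stress g u k x c d) _ (fun c I => nabla g u (k + 1) (Fin.cons c I) x)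
    (fun a c I => nabla g u (k + 2) (Fin.cons a (Fin.cons c I)) x) (hg.inv_symm hx)
    (pairing_comm (hg.eUp_transpose hx))

end SmoothLorentz

/-! ### Pointwise estimates for the energy currents -/

theorem abs_sum_le_card {ι : Type*} [Fintype ι] {f : ι → ℝ} {b : ℝ} (h : ∀ i, |f i| ≤ b) :
    |∑ i, f i| ≤ Fintype.card ι * b := by
  refine (Finset.abs_sum_le_sum_abs _ _).trans ((Finset.sum_le_sum fun i _ => h i).trans ?_)
  simp

theorem abs_sum_fin4_le {f : Fin 4 → ℝ} {b : ℝ} (h : ∀ i, |f i| ≤ b) : |∑ i, f i| ≤ 4 * b := by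
  simpa using abs_sum_le_card h

theorem abs_mul_le_mul {a b A B : ℝ} (ha : |a| ≤ A) (hb : |b| ≤ B) : |a * b| ≤ A * B := by
  rw [abs_mul]
  exact mul_le_mul ha hb (abs_nonneg _) ((abs_nonneg _).trans ha)

theorem abs_pairing_le {E : Mat} {M n m : ℝ} (hE : ∀ a b, |E a b| ≤ M) {k : ℕ}
    {v w : (Fin k → Fin 4) → ℝ} (hv : ∀ I, |v I| ≤ n) (hw : ∀ I, |w I| ≤ m) :
    |pairing E v w| ≤ 4 ^ k * (4 ^ k * (M ^ k * n * m)) := by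
  have := abs_sum_le_card fun I : Fin k → Fin 4 => abs_sum_le_card fun J : Fin k → Fin 4 =>
    abs_mul_le_mul (abs_mul_le_mul (abs_tprod_le hE I J) (hv I)) (hw J)
  simpa [pairing] using this

theorem abs_pairingD_le {E H : Mat} {M L n m : ℝ} (hM : 1 ≤ M) (hE : ∀ a b, |E a b| ≤ M)
    (hH : ∀ a b, |H a b| ≤ L) {k : ℕ}
    {v w : (Fin k → Fin 4) → ℝ} (hv : ∀ I, |v I| ≤ n) (hw : ∀ I, |w I| ≤ m) :
    |pairingD E H v w| ≤ 4 ^ k * (4 ^ k * ((k * (M ^ k * L)) * n * m)) := by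
  have h1 : ∀ (I J : Fin k → Fin 4) (s : Fin k),
      |∏ r ∈ Finset.univ.erase s, E (I r) (J r)| ≤ M ^ k := fun I J s => by
    rw [Finset.abs_prod]
    refine (Finset.prod_le_prod (fun r _ => abs_nonneg _) fun r _ => hE (I r) (J r)).trans ?_
    rw [Finset.prod_const]
    refine pow_le_pow_right₀ hM ((Finset.card_le_univ _).trans ?_)
    simp
  have := abs_sum_le_card fun I : Fin k → Fin 4 => abs_sum_le_card fun J : Fin k → Fin 4 =>
    abs_mul_le_mul (abs_mul_le_mul (abs_sum_le_card fun s : Fin k =>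
      abs_mul_le_mul (h1 I J s) (hH (I s) (J s))) (hv I)) (hw J)
  simpa [pairingD] using this

/-- `sig` is `-dt`, so contraction with it selects minus the time component; this is the reason for
the sign in `current`. -/
theorem sum_energyTensor_eq_current (g : Pt → Mat) (u : Pt → ℝ) (j : ℕ) (x : Pt) :
    ∑ a, ∑ b, energyTensor g u j a b x * sig a * sigHat g b x = current g u j 0 x := by
  have h : ∀ i : Fin 3, ∑ b, energyTensor g u j i.succ b x * sig i.succ * sigHat g b x = 0 :=
    fun i => by simp [sig, dt]
  rw [Fin.sum_univ_succ, Finset.sum_eq_zero fun i _ => h i, add_zero, current,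
    ← Finset.sum_neg_distrib]
  exact Finset.sum_congr rfl fun b _ => by simp [sig, dt]

theorem energy_eq (Ω : Set Pt) (g : Pt → Mat) (u : Pt → ℝ) (k : ℕ) (τ : ℝ) :
    energy Ω g u k τ = ∑ j ∈ Finset.range (k + 1), ∫ y in {y : Fin 3 → ℝ | slicePt τ y ∈ Ω},
      volDensity g (slicePt τ y) * current g u j 0 (slicePt τ y) := by
  simp only [energy, sum_energyTensor_eq_current, mul_comm (volDensity _ _)]

namespace SmoothLorentz

variable {U : Set Pt} {g : Pt → Mat} (hg : SmoothLorentz U g)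
include hg

theorem lapse_sq {x : Pt} (hx : x ∈ U) : lapse g x ^ 2 = -(g x)⁻¹ 0 0 := by
  rw [WaveEnergy.lapse_sq (hg.lorentzian x hx) (hg.timelike x hx), coInner]
  simp [dt, Fin.sum_univ_four]

theorem inv_zero_left {x : Pt} (hx : x ∈ U) (c : Fin 4) : (g x)⁻¹ 0 c = -xi g c x := by
  rw [hg.inv_symm hx]
  simp [xi, sig, dt, Fin.sum_univ_four]

theorem xi_eq {x : Pt} (hx : x ∈ U) (c : Fin 4) : xi g c x = lapse g x * xiHat g c x := by
  have := (hg.lapse_pos hx).ne'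
  rw [xiHat]; field_simp

theorem xi_zero {x : Pt} (hx : x ∈ U) : xi g 0 x = lapse g x ^ 2 := by
  rw [hg.lapse_sq hx, hg.inv_zero_left hx, neg_neg]

theorem xiHat_zero {x : Pt} (hx : x ∈ U) : xiHat g 0 x = lapse g x := by
  have h1 := hg.xi_eq hx 0
  rw [hg.xi_zero hx, sq] at h1
  exact (mul_left_cancel₀ (hg.lapse_pos hx).ne' h1).symm

/-- Since `ξ̂⁰ = V` and `g^{0c} = -V ξ̂^c` for the lapse `V`, the first slot is contracted with
`½V(g^{cd} + 2 ξ̂^c ξ̂^d) = ½V e^{cd}`. All slots are then measured by the Riemannian metric, which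
makes the density nonnegative and coercive. -/
theorem current_time {u : Pt → ℝ} (j : ℕ) {x : Pt} (hx : x ∈ U) :
    current g u j 0 x = 1 / 2 * lapse g x *
      pairing (eUp g x) (fun I => nabla g u j I x) fun I => nabla g u j I x := by
  cases j with
  | zero =>
    rw [hg.current_zero u hx, hg.xiHat_zero hx]
    simp [pairing, tprod, nabla]
    ring
  | succ k =>
    rw [hg.current_succ u k hx, hg.xiHat_zero hx, pairing_cons, Finset.mul_sum, Finset.mul_sum,
      Finset.mul_sum, ← Finset.sum_sub_distrib]
    refine Finset.sum_congr rfl fun c _ => ?_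
    rw [Finset.mul_sum, Finset.mul_sum, Finset.mul_sum, ← Finset.sum_sub_distrib]
    refine Finset.sum_congr rfl fun d _ => ?_
    rw [hg.inv_zero_left hx, hg.xi_eq hx, hg.eUp_apply hx, stress, Matrix.of_apply]
    ring

theorem current_time_nonneg {u : Pt → ℝ} (j : ℕ) {x : Pt} (hx : x ∈ U) :
    0 ≤ current g u j 0 x := by
  rw [hg.current_time j hx]
  have := hg.lapse_pos hx
  have := pairing_self_nonneg (eUp_posSemidef (hg.lorentzian x hx) (hg.timelike x hx))
    (fun I => nabla g u j I x)
  positivity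

theorem sq_sum_le_current {u : Pt → ℝ} (j : ℕ) {x : Pt} (hx : x ∈ U) {M v : ℝ} (hv : 0 < v)
    (hM0 : 0 ≤ M) (hM : ∀ a b, |eLow g x a b| ≤ M) (hV : v ≤ lapse g x) :
    ∑ I, nabla g u j I x ^ 2 ≤ (M ^ j * 4 ^ j * (2 / v)) * current g u j 0 x := by
  have h1 := sq_sum_le_pairing (eLow_posSemidef (hg.lorentzian x hx) (hg.timelike x hx))
    (eLow_mul_eUp (hg.lorentzian x hx) (hg.timelike x hx)) hM (fun I => nabla g u j I x)
  have h2 := pairing_self_nonneg (eUp_posSemidef (hg.lorentzian x hx) (hg.timelike x hx))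
    (fun I => nabla g u j I x)
  refine h1.trans ?_
  rw [hg.current_time j hx, mul_assoc (M ^ j * 4 ^ j)]
  refine mul_le_mul_of_nonneg_left ?_ (by positivity)
  rw [← mul_assoc]
  refine le_mul_of_one_le_left h2 ?_
  rw [show 2 / v * (1 / 2 * lapse g x) = lapse g x / v by ring]
  exact (one_le_div hv).2 hV

/-- The covectors `β` and `-σ̂ = V⁻¹ dt` are time-like and lie in the same half cone, so the
dominant energy condition applies for `j ≥ 1`. For `j = 0` the current is a nonnegative multiple of
`ξ̂`, and the sign of `g⁻¹(β, dt)` suffices. -/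
theorem current_flux_nonneg {u : Pt → ℝ} (j : ℕ) {x : Pt} (hx : x ∈ U) {β : Fin 4 → ℝ}
    (hβ : coInner g x β β < 0) (hβt : coInner g x β dt < 0) : 0 ≤ ∑ a, current g u j a x * β a := by
  have hL := hg.lorentzian x hx
  have hV := hg.lapse_pos hx
  have hs : (fun a => -sigHat g a x) = (lapse g x)⁻¹ • dt := by
    ext a
    rw [sigHat_eq hL]
    simp [sig, div_eq_inv_mul]
  have hdot : ∑ a, xiHat g a x * β a = -form (g x)⁻¹ β (fun a => -sigHat g a x) := by
    rw [xiHat_dot β hL, form_comm hL.inv_transpose]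
    have : (fun a => -sigHat g a x) = -fun a => sigHat g a x := rfl
    rw [this, map_neg, neg_neg]
  have hneg : form (g x)⁻¹ β (fun a => -sigHat g a x) < 0 := by
    rw [hs, map_smul, smul_eq_mul, ← coInner_eq_form]
    exact mul_neg_of_pos_of_neg (inv_pos.2 hV) hβt
  cases j with
  | zero =>
    have : ∑ a, current g u 0 a x * β a = 1 / 2 * (u x * u x) * ∑ a, xiHat g a x * β a := by
      rw [Finset.mul_sum]
      exact Finset.sum_congr rfl fun a _ => by rw [hg.current_zero u hx]; ring
    rw [this, hdot]
    have := mul_self_nonneg (u x)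
    nlinarith
  | succ k =>
    have h1 := hL.dominant_energy_pairing (eUp_posSemidef hL (hg.timelike x hx))
      (α := β) (β := fun a => -sigHat g a x) (by rwa [← coInner_eq_form])
      (by
        rw [hs]
        simp only [map_smul, LinearMap.smul_apply, smul_eq_mul]
        rw [← coInner_eq_form]
        have := hg.timelike x hx
        exact mul_neg_of_pos_of_neg (inv_pos.2 hV) (mul_neg_of_pos_of_neg (inv_pos.2 hV) this))
      hneg (fun c (I : Fin k → Fin 4) => nabla g u (k + 1) (Fin.cons c I) x)
    refine h1.trans_eq ?_
    have h2 : ∀ d, (g x)⁻¹.mulVec (fun a => -sigHat g a x) d = -xiHat g d x := fun d => by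
      rw [← hg.inv_sigHat hx]
      simp [Matrix.mulVec, dotProduct]
    have h3 : ∀ c, (g x)⁻¹.mulVec β c = ∑ a, (g x)⁻¹ a c * β a := fun c => by
      simp only [Matrix.mulVec, dotProduct]
      exact Finset.sum_congr rfl fun a _ => by rw [hg.inv_symm hx]
    have h4 : ∑ a, current g u (k + 1) a x * β a =
        1 / 2 * (∑ a, xiHat g a x * β a) * (∑ c, ∑ d, (g x)⁻¹ c d * stress g u k x c d) -
        ∑ c, ∑ d, (∑ a, (g x)⁻¹ a c * β a) * xiHat g d x * stress g u k x c d := by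
      have : ∑ c, ∑ d, (∑ a, (g x)⁻¹ a c * β a) * xiHat g d x * stress g u k x c d =
          ∑ a, (∑ c, ∑ d, (g x)⁻¹ a c * xiHat g d x * stress g u k x c d) * β a := by
        simp only [Finset.sum_mul]
        rw [Finset.sum_congr rfl fun c _ => Finset.sum_comm, Finset.sum_comm]
        exact Finset.sum_congr rfl fun a _ => Finset.sum_congr rfl fun c _ =>
          Finset.sum_congr rfl fun d _ => by ring
      simp_rw [hg.current_succ u k hx]
      rw [this]
      generalize ∑ c, ∑ d, (g x)⁻¹ c d * stress g u k x c d = F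
      rw [Finset.mul_sum, Finset.sum_mul, ← Finset.sum_sub_distrib]
      exact Finset.sum_congr rfl fun a _ => by ring
    rw [h4, hdot, Finset.mul_sum, ← Finset.sum_sub_distrib]
    refine Finset.sum_congr rfl fun c _ => ?_
    rw [Finset.mul_sum, ← Finset.sum_sub_distrib]
    refine Finset.sum_congr rfl fun d _ => ?_
    rw [h2, h3, stress, Matrix.of_apply]
    ring

/-- From `V² = ξ⁰ = -g^{00}` and `∇g⁻¹ = 0`, the connection term in `∇_a ξ⁰` is `-½ ∂_a ξ⁰`. Hence
`∇_a ξ⁰ = ½ ∂_a(V²) = V ∂_a V`. -/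
theorem pd_lapse {x : Pt} (hx : x ∈ U) (a : Fin 4) :
    pd a (lapse g) x = covVec g (xi g) a 0 x / lapse g x := by
  have hV := differentiableAt_of_smooth hg.isOpen hg.smooth_lapse hx
  have h1 : pd a (fun y => lapse g y * lapse g y) x = pd a (xi g 0) x :=
    pd_congr (eventually_of_mem (hg.isOpen.mem_nhds hx) fun y hy => by
      simp only [hg.xi_zero hy, sq]) a
  have h2 : pd a (fun y => (g y)⁻¹ 0 0) x = -pd a (xi g 0) x := by
    rw [← pd_neg]
    exact pd_congr (eventually_of_mem (hg.isOpen.mem_nhds hx) fun y hy => hg.inv_zero_left hy 0) a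
  have h3 := congrFun (congrFun (hg.pdMat_inv hx a) 0) 0
  have h4 : pd a (fun y => (g y)⁻¹ 0 0) x = 2 * ∑ c, christoffel g 0 a c x * xi g c x := by
    refine h3.trans ?_
    simp only [connMat, Matrix.neg_apply, Matrix.add_apply, Matrix.mul_apply, Matrix.of_apply,
      Matrix.transpose_apply, hg.inv_zero_left hx, hg.inv_symm hx _ 0, Fin.sum_univ_four]
    ring
  rw [pd_mul hV hV] at h1
  have hpos := hg.lapse_pos hx
  rw [eq_div_iff hpos.ne', covVec]
  linarith

/-- The formula contains `∇ξ` but no separate Christoffel symbols, so the bound on `∇ξ` passes to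
`∇ξ̂` without loss of powers of `ε`. -/
theorem covVec_xiHat {x : Pt} (hx : x ∈ U) (a b : Fin 4) :
    covVec g (xiHat g) a b x = (lapse g x)⁻¹ * (covVec g (xi g) a b x -
      (lapse g x)⁻¹ * (lapse g x)⁻¹ * xi g b x * covVec g (xi g) a 0 x) := by
  have hV := differentiableAt_of_smooth hg.isOpen hg.smooth_lapse hx
  have hpos := hg.lapse_pos hx
  have h1 : ∀ b, DifferentiableAt ℝ (xiHat g b) x := fun b =>
    differentiableAt_of_smooth hg.isOpen (hg.smooth_xiHat b) hx
  have h2 : covVec g (xi g) a b x = covVec g (fun b y => xiHat g b y * lapse g y) a b x :=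
    covVec_congr g (eventually_of_mem (hg.isOpen.mem_nhds hx) fun y hy b => by
      rw [hg.xi_eq hy, mul_comm]) a b
  rw [covVec_mul g _ _ h1 hV, hg.pd_lapse hx] at h2
  rw [h2, hg.xi_eq hx b]
  field_simp
  ring

end SmoothLorentz

/-- Uniform bounds at a point for the geometric quantities in the energy estimate. -/
structure GeomBound (g : Pt → Mat) (M : ℝ) (x : Pt) : Prop where
  one_le : 1 ≤ M
  inv : ∀ a b, |(g x)⁻¹ a b| ≤ M
  xiHat : ∀ a, |xiHat g a x| ≤ M
  covVec : ∀ a b, |covVec g (WaveEnergy.xiHat g) a b x| ≤ M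
  eUp : ∀ a b, |eUp g x a b| ≤ M
  eLow : ∀ a b, |eLow g x a b| ≤ M
  lapse : M⁻¹ ≤ lapse g x

/-- `M` is chosen from `C` and `M₀` before the metric, which makes the bound uniform along the net.
Its summands dominate the individual bounds for `g⁻¹`, `V⁻¹`, `ξ̂`, `∇ξ̂`, `e⁻¹` and `e`. -/
theorem exists_geomBound (C M₀ : ℝ) (hM₀ : 0 < M₀) : ∃ M : ℝ, ∀ (U : Set Pt) (g : Pt → Mat),
    SmoothLorentz U g → ∀ x ∈ U, (∀ a b, |g x a b| ≤ C) → (∀ a b, |(g x)⁻¹ a b| ≤ C) →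
    (∀ a b, |covVec g (xi g) a b x| ≤ C) → coInner g x dt dt ≤ -1 / M₀ ^ 2 → GeomBound g M x := by
  refine ⟨1 + |C| + M₀ + M₀ * |C| + M₀ * (|C| + M₀ * M₀ * |C| * |C|) +
    (|C| + 2 * (M₀ * |C|) * (M₀ * |C|)) + (|C| + 2 * M₀ * M₀), ?_⟩
  intro U g hg x hx hgb hGb hcov ht
  have hL := hg.lorentzian x hx
  have hV := hg.lapse_pos hx
  have hC0 : 0 ≤ |C| := abs_nonneg C
  have hgb' := fun a b => (hgb a b).trans (le_abs_self C)
  have hGb' := fun a b => (hGb a b).trans (le_abs_self C)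
  have hcov' := fun a b => (hcov a b).trans (le_abs_self C)
  have hVM : M₀⁻¹ ≤ lapse g x := by
    refine (pow_le_pow_iff_left₀ (by positivity) hV.le two_ne_zero).1 ?_
    rw [WaveEnergy.lapse_sq hL (hg.timelike x hx), inv_pow]
    rw [neg_div, one_div] at ht
    linarith
  have hVi : |(lapse g x)⁻¹| ≤ M₀ := by
    rw [abs_of_pos (inv_pos.2 hV)]
    exact (inv_le_comm₀ hM₀ hV).1 hVM
  have hxi : ∀ a, |xi g a x| ≤ |C| := fun a => by
    have := hg.inv_zero_left hx a
    rw [← abs_neg, ← this]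
    exact hGb' 0 a
  have hxiH : ∀ a, |xiHat g a x| ≤ M₀ * |C| := fun a => by
    rw [xiHat, div_eq_inv_mul]
    exact abs_mul_le_mul hVi (hxi a)
  have hsig : ∀ a, |sigHat g a x| ≤ M₀ := fun a => by
    rw [sigHat_eq hL, div_eq_inv_mul, ← mul_one M₀]
    refine abs_mul_le_mul hVi ?_
    by_cases h : a = 0
    · subst h; simp [sig, dt]
    · simp [sig, dt, h]
  have p1 : 0 ≤ M₀ * |C| := by positivity
  have p2 : 0 ≤ M₀ * (|C| + M₀ * M₀ * |C| * |C|) := by positivity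
  have p3 : 0 ≤ 2 * (M₀ * |C|) * (M₀ * |C|) := by positivity
  have p4 : 0 ≤ 2 * M₀ * M₀ := by positivity
  have two : |(2 : ℝ)| ≤ 2 := by norm_num
  refine ⟨by linarith, fun a b => (hGb' a b).trans (by linarith), fun a =>
    (hxiH a).trans (by linarith), fun a b => ?_, fun a b => ?_, fun a b => ?_, ?_⟩
  · rw [hg.covVec_xiHat hx]
    refine (abs_mul_le_mul hVi ((abs_sub _ _).trans (add_le_add (hcov' a b)
      (abs_mul_le_mul (abs_mul_le_mul (abs_mul_le_mul hVi hVi) (hxi b)) (hcov' a 0))))).trans ?_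
    linarith
  · rw [hg.eUp_apply hx]
    refine ((abs_add_le _ _).trans (add_le_add (hGb' a b) (abs_mul_le_mul
      (abs_mul_le_mul two (hxiH a)) (hxiH b)))).trans ?_
    linarith
  · rw [eLow, Matrix.of_apply]
    refine ((abs_add_le _ _).trans (add_le_add (hgb' a b) (abs_mul_le_mul
      (abs_mul_le_mul two (hsig a)) (hsig b)))).trans ?_
    linarith
  · refine (inv_anti₀ hM₀ ?_).trans hVM
    linarith

/-- The divergence of the zeroth energy current. -/
theorem SmoothLorentz.abs_div_current_zero_le {U : Set Pt} {g : Pt → Mat} (hg : SmoothLorentz U g)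
    {u : Pt → ℝ} (hu : ContDiffOn ℝ ∞ u U) {x : Pt} (hx : x ∈ U) {M n : ℝ} (hM : GeomBound g M x)
    (h0 : |u x| ≤ n) (h1 : ∀ I, |nabla g u 1 I x| ≤ n) :
    |∑ a, covVec g (current g u 0) a a x| ≤ (1 / 2 * (4 * M) + 4 * M) * n ^ 2 := by
  rw [hg.div_current_zero hu hx]
  have half : |(1 / 2 : ℝ)| ≤ 1 / 2 := by rw [abs_of_pos (by norm_num)]
  refine ((abs_add_le _ _).trans (add_le_add
    (abs_mul_le_mul (abs_mul_le_mul half (abs_sum_fin4_le fun a => hM.covVec a a))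
      (abs_mul_le_mul h0 h0))
    (abs_sum_fin4_le fun a => abs_mul_le_mul (hM.xiHat a) (abs_mul_le_mul h0 (h1 _))))).trans_eq ?_
  ring

/-- The divergence of the higher energy currents. -/
theorem exists_abs_div_current_succ_le (k : ℕ) (M : ℝ) : ∃ C : ℝ, 0 ≤ C ∧
    ∀ (U : Set Pt) (g : Pt → Mat), SmoothLorentz U g → ∀ u : Pt → ℝ, ContDiffOn ℝ ∞ u U →
    ∀ x ∈ U, GeomBound g M x → ∀ n : ℝ, (∀ I, |nabla g u (k + 1) I x| ≤ n) →
    (∀ I, |boxNabla g u k I x| ≤ n) → (∀ a b I, |commNabla g u k a b I x| ≤ n) →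
    |∑ a, covVec g (current g u (k + 1)) a a x| ≤ C * n ^ 2 := by
  -- `s` and `d` are the constants of `abs_pairing_le` and `abs_pairingD_le` with the factor `n²`
  -- removed; they depend on `k` and `M` only.
  obtain ⟨s, hs⟩ : ∃ s : ℝ, s = 4 ^ k * (4 ^ k * M ^ k) := ⟨_, rfl⟩
  obtain ⟨d, hd⟩ : ∃ d : ℝ, d = 4 ^ k * (4 ^ k * (k * (M ^ k * (2 * (M * M + M * M))))) := ⟨_, rfl⟩
  refine ⟨|1 / 2 * (4 * M * (4 * (4 * (M * s)))) + 4 * (4 * (4 * (M * M * s))) +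
    1 / 2 * (4 * (4 * (4 * (M * M * d)))) + 4 * (4 * (4 * (M * M * d))) + 4 * (M * s) +
    4 * (4 * (4 * (M * M * s)))|, abs_nonneg _, ?_⟩
  intro U g hg u hu x hx hM n hP hB hC
  rw [hg.div_current_succ hu k hx]
  have half : |(1 / 2 : ℝ)| ≤ 1 / 2 := by rw [abs_of_pos (by norm_num)]
  have two : |(2 : ℝ)| ≤ 2 := by norm_num
  have hpair : ∀ v w : (Fin k → Fin 4) → ℝ, (∀ I, |v I| ≤ n) → (∀ I, |w I| ≤ n) →
      |pairing (eUp g x) v w| ≤ s * n ^ 2 := fun v w hv hw =>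
    (abs_pairing_le hM.eUp hv hw).trans_eq (by rw [hs]; ring)
  have hcovE : ∀ a b c, |covE g a x b c| ≤ 2 * (M * M + M * M) := fun a b c => by
    rw [covE, Matrix.of_apply]
    exact abs_mul_le_mul two ((abs_add_le _ _).trans (add_le_add
      (abs_mul_le_mul (hM.covVec a b) (hM.xiHat c)) (abs_mul_le_mul (hM.xiHat b) (hM.covVec a c))))
  have hpairD : ∀ (a : Fin 4) (v w : (Fin k → Fin 4) → ℝ), (∀ I, |v I| ≤ n) → (∀ I, |w I| ≤ n) →
      |pairingD (eUp g x) (covE g a x) v w| ≤ d * n ^ 2 := fun a v w hv hw =>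
    (abs_pairingD_le hM.one_le hM.eUp (hcovE a) hv hw).trans_eq (by rw [hd]; ring)
  have hst : ∀ c d, |stress g u k x c d| ≤ s * n ^ 2 := fun c d =>
    hpair _ _ (fun I => hP _) fun I => hP _
  have t1 := abs_mul_le_mul half (abs_mul_le_mul (abs_sum_fin4_le fun a => hM.covVec a a)
    (abs_sum_fin4_le fun c => abs_sum_fin4_le fun d => abs_mul_le_mul (hM.inv c d) (hst c d)))
  have t2 := abs_sum_fin4_le fun a => abs_sum_fin4_le fun c => abs_sum_fin4_le fun d =>
    abs_mul_le_mul (abs_mul_le_mul (hM.inv a c) (hM.covVec a d)) (hst c d)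
  have t3 := abs_mul_le_mul half (abs_sum_fin4_le fun a => abs_sum_fin4_le fun c =>
    abs_sum_fin4_le fun d => abs_mul_le_mul (abs_mul_le_mul (hM.xiHat a) (hM.inv c d))
      (hpairD a (fun I => nabla g u (k + 1) (Fin.cons c I) x)
        (fun I => nabla g u (k + 1) (Fin.cons d I) x) (fun I => hP _) fun I => hP _))
  have t4 := abs_sum_fin4_le fun a => abs_sum_fin4_le fun c =>
    abs_sum_fin4_le fun d => abs_mul_le_mul (abs_mul_le_mul (hM.inv a c) (hM.xiHat d))
      (hpairD a (fun I => nabla g u (k + 1) (Fin.cons c I) x)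
        (fun I => nabla g u (k + 1) (Fin.cons d I) x) (fun I => hP _) fun I => hP _)
  have t5 := abs_sum_fin4_le fun d => abs_mul_le_mul (hM.xiHat d)
    (hpair (fun I => boxNabla g u k I x) (fun I => nabla g u (k + 1) (Fin.cons d I) x) hB
      fun I => hP _)
  have t6 := abs_sum_fin4_le fun a => abs_sum_fin4_le fun c => abs_sum_fin4_le fun d =>
    abs_mul_le_mul (abs_mul_le_mul (hM.inv a c) (hM.xiHat d))
      (hpair (fun I => nabla g u (k + 1) (Fin.cons c I) x) (fun I => commNabla g u k a d I x)
        (fun I => hP _) (hC a d))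
  refine ((abs_sub _ _).trans (add_le_add ((abs_sub _ _).trans (add_le_add ((abs_sub _ _).trans
    (add_le_add ((abs_add_le _ _).trans (add_le_add ((abs_sub _ _).trans (add_le_add t1 t2)) t3))
      t4)) t5)) t6)).trans ?_
  refine le_trans (le_of_eq ?_) (mul_le_mul_of_nonneg_right (le_abs_self _) (sq_nonneg n))
  ring

/-! ### Nets of moderate growth -/

theorem iterPd_append_singleton (l : List (Fin 4)) (a : Fin 4) (F : Pt → ℝ) :
    iterPd (l ++ [a]) F = iterPd l (pd a F) := by
  simp [iterPd]

theorem iterPd_congr {U : Set Pt} (hU : IsOpen U) {F G : Pt → ℝ} (h : EqOn F G U) :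
    ∀ l : List (Fin 4), EqOn (iterPd l F) (iterPd l G) U
  | [] => h
  | a :: l => fun _ hx =>
    pd_congr (eventually_of_mem (hU.mem_nhds hx) (iterPd_congr hU h l)) a

theorem smooth_iterPd {U : Set Pt} (hU : IsOpen U) {F : Pt → ℝ} (hF : ContDiffOn ℝ ∞ F U) :
    ∀ l : List (Fin 4), ContDiffOn ℝ ∞ (iterPd l F) U
  | [] => hF
  | a :: l => smooth_pd hU (smooth_iterPd hU hF l) a

theorem iterPd_add {U : Set Pt} (hU : IsOpen U) {F G : Pt → ℝ} (hF : ContDiffOn ℝ ∞ F U)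
    (hG : ContDiffOn ℝ ∞ G U) :
    ∀ l : List (Fin 4), EqOn (iterPd l fun x => F x + G x) (fun x => iterPd l F x + iterPd l G x) U
  | [] => fun _ _ => rfl
  | a :: l => fun x hx => by
    have h1 := pd_congr (eventually_of_mem (hU.mem_nhds hx) (iterPd_add hU hF hG l)) a
    exact h1.trans (pd_add (differentiableAt_of_smooth hU (smooth_iterPd hU hF l) hx)
      (differentiableAt_of_smooth hU (smooth_iterPd hU hG l) hx) a)

/-- A net of smooth functions on `U` whose derivatives are `O(ε⁻ᴺ)` on `K`, with `N` depending on
the derivative. -/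
structure ModNet (U K : Set Pt) (c : ℝ → Pt → ℝ) : Prop where
  smooth : ∀ᶠ ε in 𝓝[>] (0 : ℝ), ContDiffOn ℝ ∞ (c ε) U
  bound : ∀ l : List (Fin 4), ∃ (N : ℕ) (C : ℝ), ∀ᶠ ε in 𝓝[>] (0 : ℝ), ∀ x ∈ K,
    |iterPd l (c ε) x| ≤ C * (ε ^ N)⁻¹

theorem eventually_Ioo : ∀ᶠ ε : ℝ in 𝓝[>] 0, ε ∈ Ioo (0 : ℝ) 1 :=
  Ioo_mem_nhdsGT one_pos

theorem inv_pow_le_inv_pow {ε : ℝ} (hε : ε ∈ Ioo (0 : ℝ) 1) {N N' : ℕ} (h : N ≤ N') :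
    (ε ^ N)⁻¹ ≤ (ε ^ N')⁻¹ :=
  inv_anti₀ (pow_pos hε.1 _) (pow_le_pow_of_le_one hε.1.le hε.2.le h)

namespace ModNet

variable {U K : Set Pt}

theorem congr (hU : IsOpen U) (hK : K ⊆ U) {c d : ℝ → Pt → ℝ} (hc : ModNet U K c)
    (h : ∀ᶠ ε in 𝓝[>] (0 : ℝ), EqOn (c ε) (d ε) U) : ModNet U K d where
  smooth := by
    filter_upwards [hc.smooth, h] with ε h1 h2 using h1.congr h2.symm
  bound l := by
    obtain ⟨N, C, hb⟩ := hc.bound l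
    refine ⟨N, C, ?_⟩
    filter_upwards [hb, h] with ε h1 h2 x hx
    rw [← iterPd_congr hU h2 l (hK hx)]
    exact h1 x hx

theorem pd {c : ℝ → Pt → ℝ} (hU : IsOpen U) (hc : ModNet U K c) (a : Fin 4) :
    ModNet U K fun ε => pd a (c ε) where
  smooth := hc.smooth.mono fun ε h => smooth_pd hU h a
  bound l := by
    obtain ⟨N, C, hb⟩ := hc.bound (l ++ [a])
    exact ⟨N, C, by simpa only [iterPd_append_singleton] using hb⟩

theorem bound_add (hU : IsOpen U) (hK : K ⊆ U) {c d : ℝ → Pt → ℝ}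
    (hcs : ∀ᶠ ε in 𝓝[>] (0 : ℝ), ContDiffOn ℝ ∞ (c ε) U)
    (hds : ∀ᶠ ε in 𝓝[>] (0 : ℝ), ContDiffOn ℝ ∞ (d ε) U) (l : List (Fin 4))
    (hc : ∃ (N : ℕ) (C : ℝ), ∀ᶠ ε in 𝓝[>] (0 : ℝ), ∀ x ∈ K, |iterPd l (c ε) x| ≤ C * (ε ^ N)⁻¹)
    (hd : ∃ (N : ℕ) (C : ℝ), ∀ᶠ ε in 𝓝[>] (0 : ℝ), ∀ x ∈ K, |iterPd l (d ε) x| ≤ C * (ε ^ N)⁻¹) :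
    ∃ (N : ℕ) (C : ℝ), ∀ᶠ ε in 𝓝[>] (0 : ℝ), ∀ x ∈ K,
      |iterPd l (fun x => c ε x + d ε x) x| ≤ C * (ε ^ N)⁻¹ := by
  obtain ⟨N, C, hC⟩ := hc
  obtain ⟨N', C', hC'⟩ := hd
  refine ⟨N + N', |C| + |C'|, ?_⟩
  filter_upwards [hC, hC', hcs, hds, eventually_Ioo] with ε h1 h2 h3 h4 hε x hx
  rw [iterPd_add hU h3 h4 l (hK hx), add_mul]
  refine (abs_add_le _ _).trans (add_le_add ((h1 x hx).trans ?_) ((h2 x hx).trans ?_))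
  · exact mul_le_mul (le_abs_self C) (inv_pow_le_inv_pow hε (Nat.le_add_right _ _))
      (inv_nonneg.2 (pow_nonneg hε.1.le _)) (abs_nonneg _)
  · exact mul_le_mul (le_abs_self C') (inv_pow_le_inv_pow hε (Nat.le_add_left _ _))
      (inv_nonneg.2 (pow_nonneg hε.1.le _)) (abs_nonneg _)

theorem add (hU : IsOpen U) (hK : K ⊆ U) {c d : ℝ → Pt → ℝ} (hc : ModNet U K c)
    (hd : ModNet U K d) : ModNet U K fun ε x => c ε x + d ε x where
  smooth := by filter_upwards [hc.smooth, hd.smooth] with ε h1 h2 using h1.add h2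
  bound l := bound_add hU hK hc.smooth hd.smooth l (hc.bound l) (hd.bound l)

theorem mul (hU : IsOpen U) (hK : K ⊆ U) {c d : ℝ → Pt → ℝ} (hc : ModNet U K c)
    (hd : ModNet U K d) : ModNet U K fun ε x => c ε x * d ε x where
  smooth := by filter_upwards [hc.smooth, hd.smooth] with ε h1 h2 using h1.mul h2
  bound l := by
    -- The last entry of the list is the innermost derivative. Splitting it off by Leibniz' rule
    -- leaves products of moderate nets with a shorter list, hence the generalisation over both
    -- factors.
    induction l using List.reverseRecOn generalizing c d with
    | nil =>
      obtain ⟨N, C, hC⟩ := hc.bound []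
      obtain ⟨N', C', hC'⟩ := hd.bound []
      refine ⟨N + N', C * C', ?_⟩
      filter_upwards [hC, hC'] with ε h1 h2 x hx
      refine (abs_mul_le_mul (h1 x hx) (h2 x hx)).trans_eq ?_
      rw [pow_add, mul_inv]; ring
    | append_singleton l a ih =>
      have h1 := ih (hc.pd hU a) hd
      have h2 := ih hc (hd.pd hU a)
      have hs1 : ∀ᶠ ε in 𝓝[>] (0 : ℝ),
          ContDiffOn ℝ ∞ (fun x => WaveEnergy.pd a (c ε) x * d ε x) U := by
        filter_upwards [(hc.pd hU a).smooth, hd.smooth] with ε h1 h2 using h1.mul h2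
      have hs2 : ∀ᶠ ε in 𝓝[>] (0 : ℝ),
          ContDiffOn ℝ ∞ (fun x => c ε x * WaveEnergy.pd a (d ε) x) U := by
        filter_upwards [hc.smooth, (hd.pd hU a).smooth] with ε h1 h2 using h1.mul h2
      obtain ⟨N, C, hb⟩ := bound_add hU hK hs1 hs2 l h1 h2
      refine ⟨N, C, ?_⟩
      filter_upwards [hb, hc.smooth, hd.smooth] with ε hb hcs hds x hx
      rw [iterPd_append_singleton, iterPd_congr hU (fun y hy => pd_mul
        (differentiableAt_of_smooth hU hcs hy) (differentiableAt_of_smooth hU hds hy) a) l (hK hx)]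
      exact hb x hx

theorem const (hU : IsOpen U) (hK : K ⊆ U) (r : ℝ) : ModNet U K fun _ _ => r where
  smooth := Eventually.of_forall fun _ => contDiffOn_const
  bound l := by
    have h0 : ∀ l : List (Fin 4), EqOn (iterPd l fun _ => (0 : ℝ)) (fun _ => 0) U := by
      intro l
      induction l with
      | nil => exact fun _ _ => rfl
      | cons a l ih =>
        exact fun x hx =>
          (pd_congr (eventually_of_mem (hU.mem_nhds hx) ih) a).trans (pd_const 0 x a)
    refine ⟨0, |r|, Eventually.of_forall fun ε x hx => ?_⟩
    simp only [pow_zero, inv_one, mul_one]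
    induction l using List.reverseRecOn with
    | nil => exact le_rfl
    | append_singleton l a _ =>
      have : WaveEnergy.pd a (fun _ => r) = fun _ => 0 := funext fun x => pd_const r x a
      rw [iterPd_append_singleton, this, h0 l (hK hx)]
      simp

theorem neg (hU : IsOpen U) (hK : K ⊆ U) {c : ℝ → Pt → ℝ} (hc : ModNet U K c) :
    ModNet U K fun ε x => -c ε x :=
  ((const hU hK (-1)).mul hU hK hc).congr hU hK (Eventually.of_forall fun ε x _ => by
    simp)

theorem sub (hU : IsOpen U) (hK : K ⊆ U) {c d : ℝ → Pt → ℝ} (hc : ModNet U K c)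
    (hd : ModNet U K d) : ModNet U K fun ε x => c ε x - d ε x := by
  simpa only [sub_eq_add_neg] using hc.add hU hK (hd.neg hU hK)

theorem sum (hU : IsOpen U) (hK : K ⊆ U) {ι : Type*} (s : Finset ι) {c : ι → ℝ → Pt → ℝ}
    (hc : ∀ i, ModNet U K (c i)) : ModNet U K fun ε x => ∑ i ∈ s, c i ε x := by
  classical
  induction s using Finset.induction_on with
  | empty => simpa using const hU hK 0
  | insert i s hi ih =>
    simp only [Finset.sum_insert hi]
    exact (hc i).add hU hK ih

end ModNet

/-! ### Lower order terms -/

/-- The net of solutions, with the regularity and the bounds that are needed to estimate lower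
order terms on `K`. -/
structure SolutionNet (U K : Set Pt) (g : ℝ → Pt → Mat) (f u : ℝ → Pt → ℝ) : Prop where
  isOpen : IsOpen U
  subset : K ⊆ U
  lorentz : ∀ᶠ ε in 𝓝[>] (0 : ℝ), SmoothLorentz U (g ε)
  metric : ∀ a b, ModNet U K fun ε x => g ε x a b
  inverse : ∀ a b, ModNet U K fun ε x => (g ε x)⁻¹ a b
  smooth_source : ∀ᶠ ε in 𝓝[>] (0 : ℝ), ContDiffOn ℝ ∞ (f ε) U
  source : ∀ (l : List (Fin 4)) (q : ℕ), ∃ C : ℝ, ∀ᶠ ε in 𝓝[>] (0 : ℝ), ∀ x ∈ K,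
    |iterPd l (f ε) x| ≤ C * ε ^ q
  smooth : ∀ᶠ ε in 𝓝[>] (0 : ℝ), ContDiffOn ℝ ∞ (u ε) U
  equation : ∀ᶠ ε in 𝓝[>] (0 : ℝ), ∀ x ∈ U, box (g ε) (u ε) x = f ε x

/-- The linear combinations of the `∇ʲu`, `j < n`, and of derivatives of the source `f`, with
coefficients of moderate growth. -/
inductive Lower (U K : Set Pt) (g : ℝ → Pt → Mat) (f u : ℝ → Pt → ℝ) (n : ℕ) :
    (ℝ → Pt → ℝ) → Prop
  | zero : Lower U K g f u n fun _ _ => 0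
  | add {F G : ℝ → Pt → ℝ} : Lower U K g f u n F → Lower U K g f u n G →
      Lower U K g f u n fun ε x => F ε x + G ε x
  | mul_nabla {c : ℝ → Pt → ℝ} (hc : ModNet U K c) {j : ℕ} (hj : j < n) (I : Fin j → Fin 4) :
      Lower U K g f u n fun ε x => c ε x * nabla (g ε) (u ε) j I x
  | mul_source {c : ℝ → Pt → ℝ} (hc : ModNet U K c) (l : List (Fin 4)) :
      Lower U K g f u n fun ε x => c ε x * iterPd l (f ε) x
  | congr {F G : ℝ → Pt → ℝ} : Lower U K g f u n F →
      (∀ᶠ ε in 𝓝[>] (0 : ℝ), EqOn (F ε) (G ε) U) → Lower U K g f u n G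

namespace Lower

variable {U K : Set Pt} {g : ℝ → Pt → Mat} {f u : ℝ → Pt → ℝ}

theorem mono {n m : ℕ} (hnm : n ≤ m) {F : ℝ → Pt → ℝ} (hF : Lower U K g f u n F) :
    Lower U K g f u m F := by
  induction hF with
  | zero => exact .zero
  | add _ _ h1 h2 => exact .add h1 h2
  | mul_nabla hc hj I => exact .mul_nabla hc (hj.trans_le hnm) I
  | mul_source hc l => exact .mul_source hc l
  | congr _ h ih => exact .congr ih h

theorem sum {n : ℕ} {ι : Type*} (s : Finset ι) {F : ι → ℝ → Pt → ℝ}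
    (hF : ∀ i, Lower U K g f u n (F i)) : Lower U K g f u n fun ε x => ∑ i ∈ s, F i ε x := by
  classical
  induction s using Finset.induction_on with
  | empty => simpa using Lower.zero
  | insert i s hi ih =>
    simp only [Finset.sum_insert hi]
    exact .add (hF i) ih

theorem nabla {n j : ℕ} (h : SolutionNet U K g f u) (hj : j < n) (I : Fin j → Fin 4) :
    Lower U K g f u n fun ε => nabla (g ε) (u ε) j I := by
  simpa using Lower.mul_nabla (g := g) (f := f) (u := u)
    (ModNet.const h.isOpen h.subset 1) hj I

variable (h : SolutionNet U K g f u)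
include h

theorem mul {n : ℕ} {c F : ℝ → Pt → ℝ} (hc : ModNet U K c) (hF : Lower U K g f u n F) :
    Lower U K g f u n fun ε x => c ε x * F ε x := by
  induction hF with
  | zero => simpa using Lower.zero
  | add _ _ h1 h2 => simpa only [mul_add] using Lower.add h1 h2
  | mul_nabla hd hj I =>
    simpa only [mul_assoc] using Lower.mul_nabla (hc.mul h.isOpen h.subset hd) hj I
  | mul_source hd l =>
    simpa only [mul_assoc] using Lower.mul_source (hc.mul h.isOpen h.subset hd) l
  | congr _ he ih => exact .congr ih (he.mono fun ε he x hx => by simp only [he hx])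

theorem neg {n : ℕ} {F : ℝ → Pt → ℝ} (hF : Lower U K g f u n F) :
    Lower U K g f u n fun ε x => -F ε x := by
  simpa using Lower.mul h (ModNet.const h.isOpen h.subset (-1)) hF

theorem sub {n : ℕ} {F G : ℝ → Pt → ℝ} (hF : Lower U K g f u n F) (hG : Lower U K g f u n G) :
    Lower U K g f u n fun ε x => F ε x - G ε x := by
  simpa only [sub_eq_add_neg] using Lower.add hF (hG.neg h)

theorem smooth {n : ℕ} {F : ℝ → Pt → ℝ} (hF : Lower U K g f u n F) :
    ∀ᶠ ε in 𝓝[>] (0 : ℝ), ContDiffOn ℝ ∞ (F ε) U := by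
  induction hF with
  | zero => exact Eventually.of_forall fun _ => contDiffOn_const
  | add _ _ h1 h2 => filter_upwards [h1, h2] with ε h1 h2 using h1.add h2
  | mul_nabla hc hj I =>
    filter_upwards [hc.smooth, h.lorentz, h.smooth] with ε h1 h2 h3
      using h1.mul (h2.smooth_nabla h3 _ I)
  | mul_source hc l =>
    filter_upwards [hc.smooth, h.smooth_source] with ε h1 h2
      using h1.mul (smooth_iterPd h.isOpen h2 l)
  | congr _ he ih => filter_upwards [ih, he] with ε h1 h2 using h1.congr h2.symm

end Lower

namespace SolutionNet

variable {U K : Set Pt} {g : ℝ → Pt → Mat} {f u : ℝ → Pt → ℝ} (h : SolutionNet U K g f u)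
include h

theorem modNet_christoffel (c a b : Fin 4) : ModNet U K fun ε => christoffel (g ε) c a b := by
  have hp : ∀ a b c, ModNet U K fun ε => pd a fun y => g ε y b c := fun a b c =>
    (h.metric b c).pd h.isOpen a
  exact (ModNet.const h.isOpen h.subset (1 / 2)).mul h.isOpen h.subset
    (ModNet.sum h.isOpen h.subset _ fun d => (h.inverse c d).mul h.isOpen h.subset
      (((hp a b d).add h.isOpen h.subset (hp b a d)).sub h.isOpen h.subset (hp d a b)))

theorem lower_conn {n k : ℕ} {T : (Fin k → Fin 4) → ℝ → Pt → ℝ}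
    (hT : ∀ I, Lower U K g f u n (T I)) (a : Fin 4) (I : Fin k → Fin 4) :
    Lower U K g f u n fun ε x =>
      conn (fun c b => christoffel (g ε) c a b x) (fun J => T J ε x) I :=
  Lower.sum _ fun _ => Lower.sum _ fun _ => Lower.mul h (h.modNet_christoffel _ _ _) (hT _)

/-- A partial derivative of `∇ʲu` is `∇ʲ⁺¹u` plus connection terms in `∇ʲu` with moderate
coefficients, so the order rises by one. Derivatives of the coefficients and of the source stay in
the class. -/
theorem lower_pd {n : ℕ} {F : ℝ → Pt → ℝ} (hF : Lower U K g f u n F) (a : Fin 4) :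
    Lower U K g f u (n + 1) fun ε => pd a (F ε) := by
  induction hF with
  | zero => exact Lower.zero.congr (Eventually.of_forall fun ε x _ => (pd_const 0 x a).symm)
  | add hF hG h1 h2 =>
    refine (Lower.add h1 h2).congr ?_
    filter_upwards [hF.smooth h, hG.smooth h] with ε h1 h2 x hx
    exact (pd_add (differentiableAt_of_smooth h.isOpen h1 hx)
      (differentiableAt_of_smooth h.isOpen h2 hx) a).symm
  | @mul_nabla c hc j hj I =>
    have h1 : Lower U K g f u (n + 1) fun ε x =>
        conn (fun c b => christoffel (g ε) c a b x) (fun J => nabla (g ε) (u ε) j J x) I :=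
      h.lower_conn (fun J => Lower.nabla h (hj.trans n.lt_succ_self) J) a I
    refine (((Lower.mul_nabla (hc.pd h.isOpen a) (hj.trans n.lt_succ_self) I).add
      (Lower.mul_nabla hc (Nat.succ_lt_succ hj) (Fin.cons a I))).add (h1.mul h hc)).congr ?_
    filter_upwards [hc.smooth, h.lorentz, h.smooth] with ε h1 h2 h3 x hx
    have hn : nabla (g ε) (u ε) (j + 1) (Fin.cons a I) x = _ :=
      covD_cons (g ε) (nabla (g ε) (u ε) j) a I x
    simp only [Nat.succ_eq_add_one]
    rw [pd_mul (differentiableAt_of_smooth h.isOpen h1 hx)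
      (differentiableAt_of_smooth h.isOpen (h2.smooth_nabla h3 _ I) hx), hn]
    ring
  | @mul_source c hc l =>
    refine ((Lower.mul_source (hc.pd h.isOpen a) l).add (Lower.mul_source hc (a :: l))).congr ?_
    filter_upwards [hc.smooth, h.smooth_source] with ε h1 h2 x hx
    exact (pd_mul (differentiableAt_of_smooth h.isOpen h1 hx)
      (differentiableAt_of_smooth h.isOpen (smooth_iterPd h.isOpen h2 l) hx) a).symm
  | congr _ he ih =>
    exact ih.congr (he.mono fun ε he x hx =>
      pd_congr (eventually_of_mem (h.isOpen.mem_nhds hx) he) a)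

theorem lower_covD {n k : ℕ} {T : ℝ → (Fin k → Fin 4) → Pt → ℝ}
    (hT : ∀ I, Lower U K g f u n fun ε => T ε I) (I : Fin (k + 1) → Fin 4) :
    Lower U K g f u (n + 1) fun ε => covD (g ε) (T ε) I := by
  rw [← Fin.cons_self_tail I]
  exact ((h.lower_pd (hT _) _).sub h ((h.lower_conn hT _ _).mono n.le_succ)).congr
    (Eventually.of_forall fun ε x _ => (covD_cons _ _ _ _ x).symm)

/-- Lower order terms are bounded by the corresponding derivatives, up to powers of `ε` and
negligible terms. -/
theorem lower_bound {n : ℕ} {F : ℝ → Pt → ℝ} (hF : Lower U K g f u n F) :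
    ∃ (N : ℕ) (C : ℝ), 0 ≤ C ∧ ∀ q : ℕ, ∃ C' : ℝ, 0 ≤ C' ∧ ∀ᶠ ε in 𝓝[>] (0 : ℝ), ∀ x ∈ K,
      |F ε x| ≤ C * (ε ^ N)⁻¹ * (∑ j ∈ Finset.range n, ∑ I, |nabla (g ε) (u ε) j I x|) +
        C' * ε ^ q := by
  induction hF with
  | zero => exact ⟨0, 0, le_rfl, fun q => ⟨0, le_rfl, Eventually.of_forall fun ε x _ => by simp⟩⟩
  | add _ _ h1 h2 =>
    obtain ⟨N₁, C₁, hC₁, h1⟩ := h1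
    obtain ⟨N₂, C₂, hC₂, h2⟩ := h2
    refine ⟨N₁ + N₂, C₁ + C₂, add_nonneg hC₁ hC₂, fun q => ?_⟩
    obtain ⟨D₁, hD₁, h1⟩ := h1 q
    obtain ⟨D₂, hD₂, h2⟩ := h2 q
    refine ⟨D₁ + D₂, add_nonneg hD₁ hD₂, ?_⟩
    filter_upwards [h1, h2, eventually_Ioo] with ε h1 h2 hε x hx
    have hS : 0 ≤ ∑ j ∈ Finset.range n, ∑ I, |WaveEnergy.nabla (g ε) (u ε) j I x| :=
      Finset.sum_nonneg fun _ _ => Finset.sum_nonneg fun _ _ => abs_nonneg _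
    have e1 := mul_le_mul_of_nonneg_right (mul_le_mul_of_nonneg_left
      (inv_pow_le_inv_pow hε (Nat.le_add_right N₁ N₂)) hC₁) hS
    have e2 := mul_le_mul_of_nonneg_right (mul_le_mul_of_nonneg_left
      (inv_pow_le_inv_pow hε (Nat.le_add_left N₂ N₁)) hC₂) hS
    refine (abs_add_le _ _).trans ((add_le_add (h1 x hx) (h2 x hx)).trans ?_)
    linarith
  | @mul_nabla c hc j hj I =>
    obtain ⟨N, C, hb⟩ := hc.bound []
    refine ⟨N, |C|, abs_nonneg C, fun q => ⟨0, le_rfl, ?_⟩⟩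
    filter_upwards [hb, eventually_Ioo] with ε hb hε x hx
    rw [zero_mul, add_zero]
    have h1 : |WaveEnergy.nabla (g ε) (u ε) j I x| ≤
        ∑ I, |WaveEnergy.nabla (g ε) (u ε) j I x| :=
      Finset.single_le_sum (f := fun I => |WaveEnergy.nabla (g ε) (u ε) j I x|)
        (fun _ _ => abs_nonneg _) (Finset.mem_univ I)
    have h2 : ∑ I, |WaveEnergy.nabla (g ε) (u ε) j I x| ≤
        ∑ j ∈ Finset.range n, ∑ I, |WaveEnergy.nabla (g ε) (u ε) j I x| :=
      Finset.single_le_sum (f := fun j => ∑ I, |WaveEnergy.nabla (g ε) (u ε) j I x|)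
        (fun _ _ => Finset.sum_nonneg fun _ _ => abs_nonneg _) (Finset.mem_range.2 hj)
    refine abs_mul_le_mul ((hb x hx).trans ?_) (h1.trans h2)
    exact mul_le_mul_of_nonneg_right (le_abs_self C) (inv_nonneg.2 (pow_nonneg hε.1.le _))
  | @mul_source c hc l =>
    obtain ⟨N, C, hb⟩ := hc.bound []
    refine ⟨0, 0, le_rfl, fun q => ?_⟩
    -- The surplus `N` pays for the growth `ε⁻ᴺ` of the coefficient.
    obtain ⟨C', hC'⟩ := h.source l (q + N)
    refine ⟨|C| * |C'|, by positivity, ?_⟩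
    filter_upwards [hb, hC', eventually_Ioo] with ε hb hC' hε x hx
    have hp := pow_pos hε.1 N
    have h1 : |c ε x| ≤ |C| * (ε ^ N)⁻¹ := (hb x hx).trans
      (mul_le_mul_of_nonneg_right (le_abs_self C) (inv_nonneg.2 hp.le))
    have h2 : |iterPd l (f ε) x| ≤ |C'| * ε ^ (q + N) := (hC' x hx).trans
      (mul_le_mul_of_nonneg_right (le_abs_self C') (pow_nonneg hε.1.le _))
    refine (abs_mul_le_mul h1 h2).trans_eq ?_
    rw [pow_add]
    field_simp
    simp
  | congr _ he ih =>
    obtain ⟨N, C, hC, ih⟩ := ih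
    refine ⟨N, C, hC, fun q => ?_⟩
    obtain ⟨C', hC', ih⟩ := ih q
    refine ⟨C', hC', ?_⟩
    filter_upwards [ih, he] with ε ih he x hx
    rw [← he (h.subset hx)]
    exact ih x hx

end SolutionNet

/-! ### Commutators -/

theorem pd_comm {F : Pt → ℝ} {x : Pt} (hF : ContDiffAt ℝ 2 F x) (a b : Fin 4) :
    pd a (pd b F) x = pd b (pd a F) x := by
  have hd : DifferentiableAt ℝ (fderiv ℝ F) x :=
    (hF.fderiv_right (m := 1) (by norm_num)).differentiableAt (by norm_num)
  have h1 : ∀ a b : Fin 4, pd a (pd b F) x =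
      fderiv ℝ (fderiv ℝ F) x (Pi.single a 1) (Pi.single b 1) := fun a b => by
    have h2 : pd b F = fun y => fderiv ℝ F y (Pi.single b 1) := rfl
    rw [h2, pd, fderiv_clm_apply hd (differentiableAt_const _)]
    simp
  rw [h1, h1]
  exact (hF.isSymmSndFDerivAt (by simp)).eq _ _

/-- The curvature term in the commutator of two covariant derivatives of a tensor. -/
def curvTerm (g : Pt → Mat) {k : ℕ} (T : (Fin k → Fin 4) → Pt → ℝ) (a b : Fin 4)
    (I : Fin k → Fin 4) (x : Pt) : ℝ :=
  (∑ s, ∑ c, (pd b (christoffel g c a (I s)) x - pd a (christoffel g c b (I s)) x) *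
    T (Function.update I s c) x) +
  (conn (fun c d => christoffel g c a d x)
      (fun J => conn (fun c d => christoffel g c b d x) (fun K => T K x) J) I -
    conn (fun c d => christoffel g c b d x)
      (fun J => conn (fun c d => christoffel g c a d x) (fun K => T K x) J) I)

theorem conn_sub (γ : Fin 4 → Fin 4 → ℝ) {k : ℕ} (S T : (Fin k → Fin 4) → ℝ) (I : Fin k → Fin 4) :
    conn γ (fun J => S J - T J) I = conn γ S I - conn γ T I := by
  simp only [conn, mul_sub, Finset.sum_sub_distrib]

theorem conn_smul (γ : Fin 4 → Fin 4 → ℝ) {k : ℕ} (c : ℝ) (T : (Fin k → Fin 4) → ℝ)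
    (I : Fin k → Fin 4) : conn γ (fun J => c * T J) I = c * conn γ T I := by
  simp only [conn, Finset.mul_sum]
  exact Finset.sum_congr rfl fun s _ => Finset.sum_congr rfl fun d _ => by ring

theorem conn_sum (γ : Fin 4 → Fin 4 → ℝ) {k : ℕ} {ι : Type*} (t : Finset ι)
    (T : ι → (Fin k → Fin 4) → ℝ) (I : Fin k → Fin 4) :
    conn γ (fun J => ∑ i ∈ t, T i J) I = ∑ i ∈ t, conn γ (T i) I := by
  simp only [conn, Finset.mul_sum]
  rw [Finset.sum_congr rfl fun s _ => Finset.sum_comm, Finset.sum_comm]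

/-- The contraction `g^{ab}∇_a∇_b T`. -/
def boxT (g : Pt → Mat) {k : ℕ} (T : (Fin k → Fin 4) → Pt → ℝ) (I : Fin k → Fin 4) (x : Pt) : ℝ :=
  ∑ a, ∑ b, (g x)⁻¹ a b * covD g (covD g T) (Fin.cons a (Fin.cons b I)) x

/-- The covariant derivative of an antisymmetrised tensor involves only antisymmetrised components.
For `T = ∇∇W` these are curvature terms in `W`, so the left side costs one derivative of `W` instead
of three. -/
theorem covD_cons_cons_cons_sub (g : Pt → Mat) {k : ℕ} {T : (Fin (k + 2) → Fin 4) → Pt → ℝ} {x : Pt}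
    (hT : ∀ I, DifferentiableAt ℝ (T I) x) (a b c : Fin 4) (I : Fin k → Fin 4) :
    covD g T (Fin.cons a (Fin.cons b (Fin.cons c I))) x -
      covD g T (Fin.cons a (Fin.cons c (Fin.cons b I))) x =
    pd a (fun y => T (Fin.cons b (Fin.cons c I)) y - T (Fin.cons c (Fin.cons b I)) y) x -
    (∑ f, christoffel g f a b x *
      (T (Fin.cons f (Fin.cons c I)) x - T (Fin.cons c (Fin.cons f I)) x)) -
    (∑ f, christoffel g f a c x *
      (T (Fin.cons b (Fin.cons f I)) x - T (Fin.cons f (Fin.cons b I)) x)) -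
    conn (fun c b => christoffel g c a b x)
      (fun J => T (Fin.cons b (Fin.cons c J)) x - T (Fin.cons c (Fin.cons b J)) x) I := by
  rw [covD_cons, covD_cons, conn_cons, conn_cons, conn_cons, conn_cons, conn_sub,
    pd_sub (hT _) (hT _)]
  simp only [mul_sub, Finset.sum_sub_distrib]
  ring

namespace SmoothLorentz

variable {U : Set Pt} {g : Pt → Mat} (hg : SmoothLorentz U g)
include hg

/-- The Ricci identity. -/
theorem covD_comm {k : ℕ} {T : (Fin k → Fin 4) → Pt → ℝ} (hT : ∀ I, ContDiffOn ℝ ∞ (T I) U)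
    {x : Pt} (hx : x ∈ U) (a b : Fin 4) (I : Fin k → Fin 4) :
    covD g (covD g T) (Fin.cons a (Fin.cons b I)) x -
      covD g (covD g T) (Fin.cons b (Fin.cons a I)) x = curvTerm g T a b I x := by
  have hd : ∀ J, DifferentiableAt ℝ (T J) x := fun J =>
    differentiableAt_of_smooth hg.isOpen (hT J) hx
  have hdp : ∀ a J, DifferentiableAt ℝ (pd a (T J)) x := fun a J =>
    differentiableAt_of_smooth hg.isOpen (smooth_pd hg.isOpen (hT J) a) hx
  have hΓ : ∀ c a b, DifferentiableAt ℝ (christoffel g c a b) x := fun c a b =>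
    differentiableAt_of_smooth hg.isOpen (hg.smooth_christoffel c a b) hx
  -- In this expansion the second partial derivatives, the term with `Γ^f_{ab}` and the two mixed
  -- terms taken together are symmetric in `a` and `b`. What remains is `curvTerm`.
  have h1 : ∀ a b, covD g (covD g T) (Fin.cons a (Fin.cons b I)) x =
      pd a (pd b (T I)) x -
      (∑ s, ∑ c, pd a (christoffel g c b (I s)) x * T (Function.update I s c) x) -
      conn (fun c d => christoffel g c b d x) (fun J => pd a (T J) x) I -
      (∑ f, christoffel g f a b x * covD g T (Fin.cons f I) x) -
      conn (fun c d => christoffel g c a d x) (fun J => pd b (T J) x) I +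
      conn (fun c d => christoffel g c a d x)
        (fun J => conn (fun c d => christoffel g c b d x) (fun K => T K x) J) I := by
    intro a b
    have h2 : covD g T (Fin.cons b I) = fun y => pd b (T I) y -
        ∑ s, ∑ c, christoffel g c b (I s) y * T (Function.update I s c) y :=
      funext fun y => covD_cons g T b I y
    have h3 : pd a (fun y => ∑ s, ∑ c, christoffel g c b (I s) y * T (Function.update I s c) y) x =
        (∑ s, ∑ c, pd a (christoffel g c b (I s)) x * T (Function.update I s c) x) +
        conn (fun c d => christoffel g c b d x) (fun J => pd a (T J) x) I := by
      rw [pd_sum _ fun s _ => DifferentiableAt.fun_sum fun c _ => (hΓ _ _ _).fun_mul (hd _), conn,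
        ← Finset.sum_add_distrib]
      refine Finset.sum_congr rfl fun s _ => ?_
      rw [pd_sum _ fun c _ => (hΓ _ _ _).fun_mul (hd _), ← Finset.sum_add_distrib]
      exact Finset.sum_congr rfl fun c _ => pd_mul (hΓ _ _ _) (hd _) a
    rw [covD_cons, conn_cons, h2, pd_sub (hdp b I) (DifferentiableAt.fun_sum fun s _ =>
      DifferentiableAt.fun_sum fun c _ => (hΓ _ _ _).fun_mul (hd _)), h3]
    simp only [covD_cons, conn_sub]
    ring
  have h4 : pd a (pd b (T I)) x = pd b (pd a (T I)) x :=
    pd_comm (((hT I).contDiffAt (hg.isOpen.mem_nhds hx)).of_le (by norm_cast)) a b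
  have h5 : ∑ f, christoffel g f a b x * covD g T (Fin.cons f I) x =
      ∑ f, christoffel g f b a x * covD g T (Fin.cons f I) x :=
    Finset.sum_congr rfl fun f _ => by rw [hg.christoffel_symm hx f a b]
  rw [h1, h1, h4, h5, curvTerm]
  simp only [sub_mul, Finset.sum_sub_distrib]
  ring

/-- The covariant derivative commutes with the contraction by the metric. -/
theorem covD_boxT {k : ℕ} {T : (Fin k → Fin 4) → Pt → ℝ} (hT : ∀ I, ContDiffOn ℝ ∞ (T I) U)
    {x : Pt} (hx : x ∈ U) (c : Fin 4) (I : Fin k → Fin 4) :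
    covD g (boxT g T) (Fin.cons c I) x = ∑ a, ∑ b, (g x)⁻¹ a b *
      covD g (covD g (covD g T)) (Fin.cons c (Fin.cons a (Fin.cons b I))) x := by
  have hQ : ∀ J, ContDiffOn ℝ ∞ (covD g (covD g T) J) U := hg.smooth_covD (hg.smooth_covD hT)
  have hS : ∀ a b, DifferentiableAt ℝ
      (fun y => (Matrix.of fun a b => covD g (covD g T) (Fin.cons a (Fin.cons b I)) y : Mat) a b) x :=
    fun a b => differentiableAt_of_smooth hg.isOpen (hQ _) hx
  have h1 := hg.pd_contract hx (a := c)
    (S := fun y => Matrix.of fun a b => covD g (covD g T) (Fin.cons a (Fin.cons b I)) y) hS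
    (R := Matrix.of fun a b =>
      covD g (covD g (covD g T)) (Fin.cons c (Fin.cons a (Fin.cons b I))) x +
      conn (fun f d => christoffel g f c d x)
        (fun J => covD g (covD g T) (Fin.cons a (Fin.cons b J)) x) I)
    (by
      ext a b
      simp only [pdMat, Matrix.of_apply, Matrix.add_apply, Matrix.mul_apply,
        Matrix.transpose_apply, connMat]
      rw [covD_cons, conn_cons, conn_cons]
      simp only [mul_comm (covD _ _ _ _)]
      ring)
  simp only [Matrix.of_apply] at h1
  have h2 : boxT g T I = fun y => ∑ a, ∑ b, (g y)⁻¹ a b *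
      covD g (covD g T) (Fin.cons a (Fin.cons b I)) y := rfl
  rw [covD_cons, h2, h1]
  simp only [boxT, conn_sum, conn_smul, mul_add, Finset.sum_add_distrib]
  ring

/-- The d'Alembertian is the contraction of the second covariant derivative. -/
theorem box_eq {u : Pt → ℝ} (hu : ContDiffOn ℝ ∞ u U) {x : Pt} (hx : x ∈ U) (I : Fin 0 → Fin 4) :
    boxNabla g u 0 I x = box g u x := by
  have hp : ∀ b, DifferentiableAt ℝ (pd b u) x := fun b =>
    differentiableAt_of_smooth hg.isOpen (smooth_pd hg.isOpen hu b) hx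
  have hG : ∀ b c, DifferentiableAt ℝ (fun y => (g y)⁻¹ b c) x := fun b c =>
    differentiableAt_of_smooth hg.isOpen (hg.smooth_inv b c) hx
  have hn1 : ∀ b, nabla g u 1 (Fin.cons b I) = pd b u := fun b => funext fun y => by
    simp [nabla, covD]
  have hn2 : ∀ a b, nabla g u 2 (Fin.cons a (Fin.cons b I)) x =
      pd a (pd b u) x - ∑ f, christoffel g f a b x * pd f u x := fun a b => by
    have : nabla g u 2 (Fin.cons a (Fin.cons b I)) x = _ := covD_cons g (nabla g u 1) a _ x
    rw [this, conn_cons, hn1]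
    simp [hn1, conn]
  have hX : ∀ a, DifferentiableAt ℝ (fun y => ∑ b, (g y)⁻¹ a b * pd b u y) x := fun a =>
    DifferentiableAt.fun_sum fun b _ => (hG a b).fun_mul (hp b)
  rw [box, hg.div_density hx (X := fun a y => ∑ b, (g y)⁻¹ a b * pd b u y) hX, ← mul_assoc,
    inv_mul_cancel₀ (hg.volDensity_pos hx).ne', one_mul, boxNabla]
  refine Finset.sum_congr rfl fun a _ => ?_
  have h1 : pd a (fun y => ∑ b, (g y)⁻¹ a b * pd b u y) x =
      ((pdMat a (fun y => (g y)⁻¹) x).mulVec fun b => pd b u x) a +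
        ∑ b, (g x)⁻¹ a b * pd a (pd b u) x := by
    rw [pd_sum _ fun b _ => (hG a b).fun_mul (hp b)]
    simp only [Matrix.mulVec, dotProduct, ← Finset.sum_add_distrib]
    exact Finset.sum_congr rfl fun b _ => pd_mul (hG a b) (hp b) a
  have h2 : ∑ c, christoffel g a a c x * ∑ b, (g x)⁻¹ c b * pd b u x =
      ((connMat g a x * (g x)⁻¹).mulVec fun b => pd b u x) a := by
    rw [← Matrix.mulVec_mulVec]
    rfl
  have h3 : ∑ b, (g x)⁻¹ a b * ∑ f, christoffel g f a b x * pd f u x =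
      (((g x)⁻¹ * (connMat g a x).transpose).mulVec fun b => pd b u x) a := by
    rw [← Matrix.mulVec_mulVec]
    rfl
  rw [covVec, h1, h2, hg.pdMat_inv hx]
  simp only [hn2, mul_sub, Finset.sum_sub_distrib, h3, neg_add, Matrix.add_mulVec,
    Matrix.neg_mulVec, Pi.add_apply, Pi.neg_apply]
  ring

end SmoothLorentz

namespace SolutionNet

variable {U K : Set Pt} {g : ℝ → Pt → Mat} {f u : ℝ → Pt → ℝ} (h : SolutionNet U K g f u)
include h

theorem lower_curvTerm {n k : ℕ} {T : ℝ → (Fin k → Fin 4) → Pt → ℝ}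
    (hT : ∀ I, Lower U K g f u n fun ε => T ε I) (a b : Fin 4) (I : Fin k → Fin 4) :
    Lower U K g f u n fun ε => curvTerm (g ε) (T ε) a b I :=
  Lower.add (Lower.sum _ fun _ => Lower.sum _ fun _ => Lower.mul h
      (((h.modNet_christoffel _ _ _).pd h.isOpen _).sub h.isOpen h.subset
        ((h.modNet_christoffel _ _ _).pd h.isOpen _)) (hT _))
    (Lower.sub h (h.lower_conn (T := fun J ε x =>
        conn (fun c d => christoffel (g ε) c b d x) (fun K => T ε K x) J)
      (fun J => h.lower_conn (T := fun K ε => T ε K) hT b J) a I)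
      (h.lower_conn (T := fun J ε x =>
        conn (fun c d => christoffel (g ε) c a d x) (fun K => T ε K x) J)
      (fun J => h.lower_conn (T := fun K ε => T ε K) hT a J) b I))

theorem eventually_smooth {n k : ℕ} {T : ℝ → (Fin k → Fin 4) → Pt → ℝ}
    (hT : ∀ I, Lower U K g f u n fun ε => T ε I) :
    ∀ᶠ ε in 𝓝[>] (0 : ℝ), ∀ I, ContDiffOn ℝ ∞ (T ε I) U :=
  eventually_all.2 fun I => (hT I).smooth h

/-- By the Ricci identity no derivative of `T` survives in the commutator, so the order does not
rise. -/
theorem lower_comm {n k : ℕ} {T : ℝ → (Fin k → Fin 4) → Pt → ℝ}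
    (hT : ∀ I, Lower U K g f u n fun ε => T ε I) (a b : Fin 4) (I : Fin k → Fin 4) :
    Lower U K g f u n fun ε x => covD (g ε) (covD (g ε) (T ε)) (Fin.cons a (Fin.cons b I)) x -
      covD (g ε) (covD (g ε) (T ε)) (Fin.cons b (Fin.cons a I)) x :=
  (h.lower_curvTerm hT a b I).congr (by
    filter_upwards [h.lorentz, h.eventually_smooth hT] with ε h1 h2 x hx
    exact (h1.covD_comm h2 hx a b I).symm)

/-- The commutator of the wave operator with the covariant derivative is of lower order. -/
theorem lower_boxT_covD {n k : ℕ} {T : ℝ → (Fin k → Fin 4) → Pt → ℝ}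
    (hT : ∀ I, Lower U K g f u n fun ε => T ε I) (c : Fin 4) (I : Fin k → Fin 4) :
    Lower U K g f u (n + 1) fun ε x => boxT (g ε) (covD (g ε) (T ε)) (Fin.cons c I) x -
      covD (g ε) (boxT (g ε) (T ε)) (Fin.cons c I) x := by
  have hP : ∀ J, Lower U K g f u (n + 1) fun ε => covD (g ε) (T ε) J := h.lower_covD hT
  have h1 : ∀ a b, Lower U K g f u (n + 1) fun ε x =>
      covD (g ε) (covD (g ε) (covD (g ε) (T ε))) (Fin.cons a (Fin.cons b (Fin.cons c I))) x -
      covD (g ε) (covD (g ε) (covD (g ε) (T ε))) (Fin.cons a (Fin.cons c (Fin.cons b I))) x := by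
    intro a b
    refine ((((h.lower_pd (h.lower_comm hT b c I) a).sub h
      (Lower.sum Finset.univ fun f => Lower.mul h (h.modNet_christoffel f a b)
        ((h.lower_comm hT f c I).mono n.le_succ))).sub h
      (Lower.sum Finset.univ fun f => Lower.mul h (h.modNet_christoffel f a c)
        ((h.lower_comm hT b f I).mono n.le_succ))).sub h
      (h.lower_conn (fun J => (h.lower_comm hT b c J).mono n.le_succ) a I)).congr ?_
    filter_upwards [h.lorentz, h.eventually_smooth hT] with ε h1 h2 x hx
    exact (covD_cons_cons_cons_sub (g ε) (fun J => differentiableAt_of_smooth h.isOpen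
      (h1.smooth_covD (h1.smooth_covD h2) J) hx) a b c I).symm
  -- `∇_a∇_b∇_c - ∇_c∇_a∇_b` is split as `∇_a[∇_b, ∇_c] + [∇_a, ∇_c]∇_b` and contracted with
  -- `g^{ab}`.
  refine (Lower.sum Finset.univ fun a => Lower.sum Finset.univ fun b => Lower.mul h
    (h.inverse a b) ((h1 a b).add (h.lower_comm hP a c (Fin.cons b I)))).congr ?_
  filter_upwards [h.lorentz, h.eventually_smooth hT] with ε h1 h2 x hx
  beta_reduce
  rw [h1.covD_boxT h2 hx, boxT, ← Finset.sum_sub_distrib]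
  refine Finset.sum_congr rfl fun a _ => ?_
  rw [← Finset.sum_sub_distrib]
  exact Finset.sum_congr rfl fun b _ => by ring

/-- Induction starting from `□u = f`: up to a commutator, `□∇ᵏ⁺¹u` is `∇(□∇ᵏu)`. The value 0 at `k =
0` is essential, because the order-one estimate must not contain `u` itself with a coefficient that
grows in `1/ε`. -/
theorem lower_boxNabla (k : ℕ) (I : Fin k → Fin 4) :
    Lower U K g f u (if k = 0 then 0 else k + 1) fun ε => boxNabla (g ε) (u ε) k I := by
  induction k with
  | zero =>
    refine (Lower.mul_source (ModNet.const h.isOpen h.subset 1) []).congr ?_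
    filter_upwards [h.lorentz, h.smooth, h.equation] with ε h1 h2 h3 x hx
    rw [h1.box_eq h2 hx, h3 x hx]
    exact one_mul _
  | succ k ih =>
    rw [if_neg k.succ_ne_zero, ← Fin.cons_self_tail I]
    have h1 := h.lower_covD (T := fun ε => boxNabla (g ε) (u ε) k) ih (Fin.cons (I 0) (Fin.tail I))
    have h2 := h.lower_boxT_covD (T := fun ε => nabla (g ε) (u ε) k)
      (fun J => Lower.nabla h k.lt_succ_self J) (I 0) (Fin.tail I)
    refine (h2.add (h1.mono (m := k + 1 + 1) ?_)).congr (Eventually.of_forall fun ε x _ => ?_)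
    · split_ifs <;> omega
    · exact sub_add_cancel _ _

theorem lower_commNabla (k : ℕ) (a b : Fin 4) (I : Fin k → Fin 4) :
    Lower U K g f u (if k = 0 then 0 else k + 1) fun ε => commNabla (g ε) (u ε) k a b I := by
  have h1 : ∀ᶠ ε in 𝓝[>] (0 : ℝ), EqOn (fun x => curvTerm (g ε) (nabla (g ε) (u ε) k) a b I x)
      (commNabla (g ε) (u ε) k a b I) U := by
    filter_upwards [h.lorentz, h.smooth] with ε h1 h2 x hx
    exact (h1.covD_comm (fun J => h1.smooth_nabla h2 k J) hx a b I).symm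
  refine Lower.congr ?_ h1
  split_ifs with hk
  · subst hk
    refine Lower.zero.congr (Eventually.of_forall fun ε x _ => ?_)
    simp [curvTerm, conn]
  · exact h.lower_curvTerm (T := fun ε => nabla (g ε) (u ε) k)
      (fun J => Lower.nabla h k.lt_succ_self J) a b I

end SolutionNet

/-! ### The energy inequality for a single metric -/

theorem covVec_sum_mul (g : Pt → Mat) {ι : Type*} (s : Finset ι) (w : ι → ℝ)
    {X : ι → Fin 4 → Pt → ℝ} {x : Pt} (hX : ∀ i b, DifferentiableAt ℝ (X i b) x) (a b : Fin 4) :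
    covVec g (fun b y => ∑ i ∈ s, w i * X i b y) a b x =
      ∑ i ∈ s, w i * covVec g (X i) a b x := by
  simp only [covVec, mul_add, Finset.sum_add_distrib, Finset.mul_sum]
  rw [pd_sum _ fun i _ => (hX i b).const_mul (w i), Finset.sum_comm]
  congr 1
  · exact Finset.sum_congr rfl fun i _ => pd_const_mul (hX i b) _ _
  · exact Finset.sum_congr rfl fun i _ => Finset.sum_congr rfl fun c _ => by ring

theorem pd_exp_time (l : ℝ) (x : Pt) (a : Fin 4) :
    pd a (fun y => Real.exp (-(l * y 0))) x = if a = 0 then -l * Real.exp (-(l * x 0)) else 0 := by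
  have h1 : HasDerivAt (fun s : ℝ => Real.exp (-(l * s))) (Real.exp (-(l * x 0)) * (-l)) (x 0) := by
    simpa using (((hasDerivAt_id (x 0)).const_mul l).neg).exp
  rw [pd_comp (F := fun y => y 0) h1 (differentiableAt_apply 0 x)]
  have h2 : pd a (fun y : Pt => y 0) x = if a = 0 then 1 else 0 := by
    rw [pd, (hasFDerivAt_apply (𝕜 := ℝ) (0 : Fin 4) x).fderiv]
    by_cases h : a = 0
    · subst h; simp
    · simp [h, Ne.symm h]
  rw [h2]
  split_ifs <;> ring

namespace SmoothLorentz

variable {U Ω : Set Pt} {g : Pt → Mat} (hg : SmoothLorentz U g)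
include hg

theorem integrableOn_slice (hcpt : IsCompact (closure Ω)) (hsub : closure Ω ⊆ U) {u : Pt → ℝ}
    (hu : ContDiffOn ℝ ∞ u U) (j : ℕ) (τ : ℝ) :
    IntegrableOn (fun y => volDensity g (slicePt τ y) * current g u j 0 (slicePt τ y))
      {y | slicePt τ y ∈ Ω} := by
  have hK : IsCompact {y | slicePt τ y ∈ closure Ω} := by
    obtain ⟨R, hR⟩ := hcpt.isBounded.exists_norm_le
    exact Metric.isCompact_of_isClosed_isBounded (isClosed_closure.preimage (continuous_slicePt τ))
      (isBounded_iff_forall_norm_le.2 ⟨R, fun y hy => (norm_le_slicePt τ y).trans (hR _ hy)⟩)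
  have hc : ContinuousOn (fun x => volDensity g x * current g u j 0 x) U :=
    (hg.smooth_volDensity.mul (hg.smooth_current hu j 0)).continuousOn
  exact ((hc.comp (continuous_slicePt τ).continuousOn fun y hy => hsub hy).integrableOn_compact
    hK).mono_set fun y hy => subset_closure hy

theorem slice_nonneg (hsub : closure Ω ⊆ U) {u : Pt → ℝ} (j : ℕ) {τ : ℝ} {y : Fin 3 → ℝ}
    (hy : slicePt τ y ∈ Ω) :
    0 ≤ volDensity g (slicePt τ y) * current g u j 0 (slicePt τ y) :=
  mul_nonneg (hg.volDensity_pos (hsub (subset_closure hy))).le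
    (hg.current_time_nonneg j (hsub (subset_closure hy)))

theorem slice_integral_nonneg (hΩ : IsOpen Ω) (hsub : closure Ω ⊆ U) {u : Pt → ℝ} (j : ℕ)
    (τ : ℝ) : 0 ≤ ∫ y in {y : Fin 3 → ℝ | slicePt τ y ∈ Ω},
      volDensity g (slicePt τ y) * current g u j 0 (slicePt τ y) :=
  setIntegral_nonneg (hΩ.preimage (continuous_slicePt τ)).measurableSet
    fun _ hy => hg.slice_nonneg hsub j hy

theorem energy_nonneg (hΩ : IsOpen Ω) (hsub : closure Ω ⊆ U) {u : Pt → ℝ} (k : ℕ) (τ : ℝ) :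
    0 ≤ energy Ω g u k τ := by
  rw [energy_eq]
  exact Finset.sum_nonneg fun j _ => hg.slice_integral_nonneg hΩ hsub j τ

theorem energy_mono (hΩ : IsOpen Ω) (hsub : closure Ω ⊆ U) {u : Pt → ℝ} {k l : ℕ} (hkl : k ≤ l)
    (τ : ℝ) : energy Ω g u k τ ≤ energy Ω g u l τ := by
  rw [energy_eq, energy_eq]
  exact Finset.sum_le_sum_of_subset_of_nonneg (Finset.range_mono (Nat.succ_le_succ hkl))
    fun j _ _ => hg.slice_integral_nonneg hΩ hsub j τ

/-- The current `e^{-lt} |g|^{1/2} ∑ⱼ wⱼ Jⱼ`, where the `Jⱼ` are the energy currents. -/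
theorem div_weighted {u : Pt → ℝ} (hu : ContDiffOn ℝ ∞ u U) (k : ℕ) (w : ℕ → ℝ) (l : ℝ) {x : Pt}
    (hx : x ∈ U) :
    ∑ a, pd a (fun y => Real.exp (-(l * y 0)) * (volDensity g y *
      ∑ j ∈ Finset.range (k + 1), w j * current g u j a y)) x =
    Real.exp (-(l * x 0)) * (volDensity g x *
      ((∑ j ∈ Finset.range (k + 1), w j * ∑ a, covVec g (current g u j) a a x) -
        l * ∑ j ∈ Finset.range (k + 1), w j * current g u j 0 x)) := by
  have hd : ∀ j a, DifferentiableAt ℝ (current g u j a) x := fun j a =>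
    differentiableAt_of_smooth hg.isOpen (hg.smooth_current hu j a) hx
  have hX : ∀ a, DifferentiableAt ℝ
      (fun y => ∑ j ∈ Finset.range (k + 1), w j * current g u j a y) x := fun a =>
    DifferentiableAt.fun_sum fun j _ => (hd j a).const_mul _
  have hv := differentiableAt_of_smooth hg.isOpen hg.smooth_volDensity hx
  have he : DifferentiableAt ℝ (fun y : Pt => Real.exp (-(l * y 0))) x :=
    (((differentiableAt_apply 0 x).const_mul l).neg).exp
  have h1 : ∀ a, pd a (fun y => Real.exp (-(l * y 0)) * (volDensity g y *
      ∑ j ∈ Finset.range (k + 1), w j * current g u j a y)) x =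
      (if a = 0 then -l * Real.exp (-(l * x 0)) else 0) * (volDensity g x *
        ∑ j ∈ Finset.range (k + 1), w j * current g u j a x) + Real.exp (-(l * x 0)) *
        pd a (fun y => volDensity g y *
          ∑ j ∈ Finset.range (k + 1), w j * current g u j a y) x := fun a => by
    rw [pd_mul he (hv.fun_mul (hX a)), pd_exp_time]
  have h2 : ∑ a, covVec g (fun a y => ∑ j ∈ Finset.range (k + 1), w j * current g u j a y) a a x =
      ∑ j ∈ Finset.range (k + 1), w j * ∑ a, covVec g (current g u j) a a x := by
    simp only [covVec_sum_mul g _ w hd, Finset.mul_sum]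
    exact Finset.sum_comm
  simp only [h1, Finset.sum_add_distrib, ite_mul, zero_mul, Finset.sum_ite_eq', Finset.mem_univ,
    if_true, ← Finset.mul_sum]
  rw [hg.div_density hx hX, h2]
  ring

/-- The energy inequality: a bound for the divergence of a weighted sum of the energy currents
yields a bound for the energies. -/
theorem energy_le (hΩ : IsOpen Ω) (hcpt : IsCompact (closure Ω)) (hsub : closure Ω ⊆ U)
    {u : Pt → ℝ} (hu : ContDiffOn ℝ ∞ u U) {γ : ℝ}
    (hb : ∀ q ∈ outerBoundary Ω γ, ∃ (N : Set Pt) (φ : Pt → ℝ), IsOpen N ∧ q ∈ N ∧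
      ContDiffOn ℝ 1 φ N ∧ (∀ x ∈ N, 0 ≤ x 0 → (x ∈ Ω ↔ φ x < 0)) ∧
      ∀ x ∈ N ∩ outerBoundary Ω γ,
        coInner g x (dF φ x) (dF φ x) < 0 ∧ coInner g x (dF φ x) dt < 0)
    {k : ℕ} {w : ℕ → ℝ} {l R V W : ℝ} (hl : 0 ≤ l) (hR : 0 ≤ R) (hw : ∀ j, 1 ≤ w j)
    (hW : ∀ j, w j ≤ W) (hV : ∀ x ∈ closure Ω, volDensity g x ≤ V)
    (hdiv : ∀ x ∈ closure Ω,
      |∑ j ∈ Finset.range (k + 1), w j * ∑ a, covVec g (current g u j) a a x| ≤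
        l * (∑ j ∈ Finset.range (k + 1), w j * current g u j 0 x) + R)
    {τ : ℝ} (hτ : 0 ≤ τ) (hτγ : τ ≤ γ) :
    energy Ω g u k τ ≤ Real.exp (l * γ) * (W * energy Ω g u k 0 + volume.real Ω * (V * R)) := by
  set J : Fin 4 → Pt → ℝ := fun a y => Real.exp (-(l * y 0)) * (volDensity g y *
    ∑ j ∈ Finset.range (k + 1), w j * current g u j a y) with hJdef
  have hw0 : ∀ j, 0 ≤ w j := fun j => zero_le_one.trans (hw j)
  have hexp : ContDiff ℝ ∞ fun y : Pt => Real.exp (-(l * y 0)) :=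
    Real.contDiff_exp.comp ((contDiff_const.mul (contDiff_apply ℝ ℝ (0 : Fin 4))).neg)
  have hJ : ∀ a, ContDiffOn ℝ ∞ (J a) U := fun a =>
    hexp.contDiffOn.mul (hg.smooth_volDensity.mul
      (ContDiffOn.sum fun j _ => contDiffOn_const.mul (hg.smooth_current hu j a)))
  have hJ1 : ∀ a, ContDiffOn ℝ 1 (J a) U := fun a => (hJ a).of_le (by exact_mod_cast le_top)
  have hflux := flux_le hg.isOpen hΩ hcpt hsub hJ1 (γ := γ) (fun q hq => by
    obtain ⟨N, φ, hN, hqN, hφ, hgraph, hsp⟩ := hb q hq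
    have hqU : q ∈ U := hsub (closure_mono inter_subset_left (frontier_subset_closure hq.1))
    have hNU : IsOpen (N ∩ U) := hN.inter hg.isOpen
    have hdφ : ∀ a, ContinuousOn (pd a φ) (N ∩ U) := fun a =>
      (contDiffOn_pd hN hφ (m := 0) (by simp) a).continuousOn.mono inter_subset_left
    have hGc : ∀ a b, ContinuousOn (fun x => (g x)⁻¹ a b) (N ∩ U) := fun a b =>
      (hg.smooth_inv a b).continuousOn.mono inter_subset_right
    have hc1 : ContinuousOn (fun x => coInner g x (dF φ x) (dF φ x)) (N ∩ U) :=
      continuousOn_finsetSum _ fun a _ => continuousOn_finsetSum _ fun b _ =>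
        ((hGc a b).mul (hdφ a)).mul (hdφ b)
    have hc2 : ContinuousOn (fun x => coInner g x (dF φ x) dt) (N ∩ U) :=
      continuousOn_finsetSum _ fun a _ => continuousOn_finsetSum _ fun b _ =>
        ((hGc a b).mul (hdφ a)).mul continuousOn_const
    -- The sign conditions on `dφ` hold only on the boundary, while the flux inequality needs an
    -- outward field on a whole chart. Both conditions are open, so the chart is shrunk by
    -- continuity.
    refine ⟨(N ∩ U ∩ (fun x => coInner g x (dF φ x) (dF φ x)) ⁻¹' Iio 0) ∩
      (N ∩ U ∩ (fun x => coInner g x (dF φ x) dt) ⁻¹' Iio 0), φ,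
      (hc1.isOpen_inter_preimage hNU isOpen_Iio).inter (hc2.isOpen_inter_preimage hNU isOpen_Iio),
      ⟨⟨⟨hqN, hqU⟩, (hsp q ⟨hqN, hq⟩).1⟩, ⟨hqN, hqU⟩, (hsp q ⟨hqN, hq⟩).2⟩,
      hφ.mono fun x hx => hx.1.1.1, fun x hx => hgraph x hx.1.1.1, fun x hx => ?_⟩
    have hxU := hx.2
    have h1 : ∑ a, J a x * pd a φ x = Real.exp (-(l * x 0)) * (volDensity g x *
        ∑ j ∈ Finset.range (k + 1), w j * ∑ a, current g u j a x * dF φ x a) := by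
      simp only [hJdef, dF, Finset.mul_sum, Finset.sum_mul]
      rw [Finset.sum_comm]
      exact Finset.sum_congr rfl fun j _ => Finset.sum_congr rfl fun a _ => by ring
    rw [h1]
    exact mul_nonneg (Real.exp_pos _).le (mul_nonneg (hg.volDensity_pos hxU).le
      (Finset.sum_nonneg fun j _ => mul_nonneg (hw0 j)
        (hg.current_flux_nonneg j hxU hx.1.1.2 hx.1.2.2)))) hτ hτγ
  set S : ℕ → ℝ → ℝ := fun j τ => ∫ y in {y : Fin 3 → ℝ | slicePt τ y ∈ Ω},
      volDensity g (slicePt τ y) * current g u j 0 (slicePt τ y) with hS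
  have hS0 : ∀ j τ, 0 ≤ S j τ := fun j τ => hg.slice_integral_nonneg hΩ hsub j τ
  have hslice : ∀ τ, (∫ y in {y | slicePt τ y ∈ Ω}, J 0 (slicePt τ y)) =
      Real.exp (-(l * τ)) * ∑ j ∈ Finset.range (k + 1), w j * S j τ := fun τ => by
    have h1 : ∀ y : Fin 3 → ℝ, J 0 (slicePt τ y) = Real.exp (-(l * τ)) *
        ∑ j ∈ Finset.range (k + 1),
          w j * (volDensity g (slicePt τ y) * current g u j 0 (slicePt τ y)) := fun y => by
      have : slicePt τ y 0 = τ := rfl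
      simp only [hJdef, this, Finset.mul_sum]
      exact Finset.sum_congr rfl fun j _ => by ring
    simp only [h1]
    rw [integral_const_mul, integral_finsetSum _ fun j _ =>
      (hg.integrableOn_slice hcpt hsub hu j τ).const_mul (w j)]
    simp only [integral_const_mul, hS]
  have hbound : ∫ x in slab τ ∩ Ω, ∑ a, pd a (J a) x ≤ volume.real Ω * (V * R) := by
    have hm : MeasurableSet (slab τ ∩ Ω) := (isClosed_slab τ).measurableSet.inter hΩ.measurableSet
    have hfin : volume Ω ≠ ⊤ := (measure_mono subset_closure).trans_lt hcpt.measure_lt_top |>.ne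
    have hfin' : volume (slab τ ∩ Ω) ≠ ⊤ :=
      ((measure_mono inter_subset_right).trans_lt hfin.lt_top).ne
    have hVR : ∀ x ∈ slab τ ∩ Ω, ∑ a, pd a (J a) x ≤ V * R := fun x hx => by
      have hxc : x ∈ closure Ω := subset_closure hx.2
      have hxU := hsub hxc
      have hv := hg.volDensity_pos hxU
      have he1 : Real.exp (-(l * x 0)) ≤ 1 := Real.exp_le_one_iff.2 (by
        have := mul_nonneg hl hx.1.1; linarith)
      -- Differentiating `e^{-lt}` produces `-l` times the weighted density, which cancels the
      -- corresponding term in `hdiv` and leaves `R`.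
      rw [hg.div_weighted hu k w l hxU]
      have h2 := (le_abs_self _).trans (hdiv x hxc)
      calc _ ≤ Real.exp (-(l * x 0)) * (volDensity g x * R) :=
            mul_le_mul_of_nonneg_left (mul_le_mul_of_nonneg_left (by linarith) hv.le)
              (Real.exp_pos _).le
        _ ≤ 1 * (volDensity g x * R) := mul_le_mul_of_nonneg_right he1 (mul_nonneg hv.le hR)
        _ ≤ V * R := by rw [one_mul]; exact mul_le_mul_of_nonneg_right (hV x hxc) hR
    have hint : IntegrableOn (fun x => ∑ a, pd a (J a) x) (slab τ ∩ Ω) :=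
      ((continuousOn_finsetSum _ fun a _ =>
        (smooth_pd hg.isOpen (hJ a) a).continuousOn.mono hsub).integrableOn_compact hcpt).mono_set
          fun x hx => subset_closure hx.2
    have hV0 : 0 ≤ volume.real Ω * (V * R) := by
      rcases Ω.eq_empty_or_nonempty with he | ⟨x, hx⟩
      · simp [he]
      · exact mul_nonneg measureReal_nonneg (mul_nonneg
          ((hg.volDensity_pos (hsub (subset_closure hx))).le.trans (hV x (subset_closure hx))) hR)
    rcases (slab τ ∩ Ω).eq_empty_or_nonempty with he | ⟨x, hx⟩
    · simpa [he] using hV0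
    · refine (setIntegral_mono_on hint (integrableOn_const hfin') hm hVR).trans ?_
      rw [setIntegral_const, smul_eq_mul]
      refine mul_le_mul_of_nonneg_right (measureReal_mono inter_subset_right hfin) (mul_nonneg ?_ hR)
      exact (hg.volDensity_pos (hsub (subset_closure hx.2))).le.trans (hV x (subset_closure hx.2))
  rw [hslice, hslice] at hflux
  have h0 : Real.exp (-(l * 0)) = 1 := by simp
  rw [h0, one_mul] at hflux
  have hW0 : ∑ j ∈ Finset.range (k + 1), w j * S j 0 ≤ W * energy Ω g u k 0 := by
    rw [energy_eq, Finset.mul_sum]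
    exact Finset.sum_le_sum fun j _ => mul_le_mul_of_nonneg_right (hW j) (hS0 j 0)
  have hE : energy Ω g u k τ ≤ ∑ j ∈ Finset.range (k + 1), w j * S j τ := by
    rw [energy_eq]
    exact Finset.sum_le_sum fun j _ => le_mul_of_one_le_left (hS0 j τ) (hw j)
  have hsum : Real.exp (-(l * τ)) * energy Ω g u k τ ≤
      W * energy Ω g u k 0 + volume.real Ω * (V * R) := by
    have := mul_le_mul_of_nonneg_left hE (Real.exp_pos (-(l * τ))).le
    linarith
  have hpos : 0 ≤ W * energy Ω g u k 0 + volume.real Ω * (V * R) :=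
    (mul_nonneg (Real.exp_pos _).le (hg.energy_nonneg hΩ hsub k τ)).trans hsum
  calc energy Ω g u k τ = Real.exp (l * τ) * (Real.exp (-(l * τ)) * energy Ω g u k τ) := by
        rw [← mul_assoc, ← Real.exp_add]; simp
    _ ≤ Real.exp (l * τ) * (W * energy Ω g u k 0 + volume.real Ω * (V * R)) :=
        mul_le_mul_of_nonneg_left hsum (Real.exp_pos _).le
    _ ≤ _ := mul_le_mul_of_nonneg_right
        (Real.exp_le_exp.2 (mul_le_mul_of_nonneg_left hτγ hl)) hpos

end SmoothLorentz

/-! ### Estimates along the net -/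

theorem exists_uniform_bound {ι : Type*} [Finite ι] {K : Set Pt} {F : ι → ℝ → Pt → ℝ}
    (h : ∀ i, ∃ C : ℝ, ∀ᶠ ε in 𝓝[>] (0 : ℝ), ∀ x ∈ K, F i ε x ≤ C) :
    ∃ C : ℝ, ∀ᶠ ε in 𝓝[>] (0 : ℝ), ∀ x ∈ K, ∀ i, F i ε x ≤ C := by
  cases nonempty_fintype ι
  choose C hC using h
  refine ⟨∑ i, |C i|, (eventually_all.2 hC).mono fun ε h x hx i => (h i x hx).trans ?_⟩
  exact (le_abs_self _).trans
    (Finset.single_le_sum (f := fun i => |C i|) (fun i _ => abs_nonneg _) (Finset.mem_univ i))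

namespace AdmissibleMetricNet

variable {U K : Set Pt} {g : ℝ → Pt → Mat} (hg : AdmissibleMetricNet U g)
include hg

theorem eventually_smoothLorentz (hU : IsOpen U) :
    ∀ᶠ ε in 𝓝[>] (0 : ℝ), SmoothLorentz U (g ε) := by
  obtain ⟨M₀, hM₀, h⟩ := hg.timelike
  filter_upwards [h, eventually_Ioo] with ε h hε
  refine ⟨hU, hg.smooth ε ⟨hε.1, hε.2.le⟩, hg.lorentzian ε ⟨hε.1, hε.2.le⟩, fun x hx =>
    (h x hx).trans_lt ?_⟩
  exact div_neg_of_neg_of_pos (by norm_num) (by positivity)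

theorem exists_metric_bound (hK : IsCompact K) (hKU : K ⊆ U) :
    ∃ C : ℝ, ∀ᶠ ε in 𝓝[>] (0 : ℝ), ∀ x ∈ K, ∀ a b, |g ε x a b| ≤ C := by
  obtain ⟨C, hC⟩ := exists_uniform_bound (ι := Fin 4 × Fin 4)
    (F := fun i ε x => |g ε x i.1 i.2|) fun i => by
      simpa [iterPd] using hg.metric_bound K hK hKU [] i.1 i.2
  exact ⟨C, hC.mono fun ε h x hx a b => h x hx (a, b)⟩

theorem eventually_geomBound (hU : IsOpen U) (hK : IsCompact K) (hKU : K ⊆ U) :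
    ∃ M : ℝ, ∀ᶠ ε in 𝓝[>] (0 : ℝ), ∀ x ∈ K, GeomBound (g ε) M x := by
  obtain ⟨M₀, hM₀, ht⟩ := hg.timelike
  obtain ⟨C₁, h1⟩ := hg.exists_metric_bound hK hKU
  obtain ⟨C₂, h2⟩ := exists_uniform_bound (ι := Fin 4 × Fin 4)
    (F := fun i ε x => |(g ε x)⁻¹ i.1 i.2|) fun i => by
      simpa [iterPd] using hg.inverse_bound K hK hKU [] i.1 i.2
  obtain ⟨C₃, h3⟩ := exists_uniform_bound (ι := Fin 4 × Fin 4)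
    (F := fun i ε x => |covVec (g ε) (xi (g ε)) i.1 i.2 x|)
      fun i => hg.normal_bound K hK hKU i.1 i.2
  obtain ⟨M, hM⟩ := exists_geomBound (max C₁ (max C₂ C₃)) M₀ hM₀
  refine ⟨M, ?_⟩
  filter_upwards [h1, h2, h3, ht, hg.eventually_smoothLorentz hU] with ε h1 h2 h3 ht hL x hx
  exact hM U (g ε) hL x (hKU hx) (fun a b => (h1 x hx a b).trans (le_max_left _ _))
    (fun a b => (h2 x hx (a, b)).trans ((le_max_left _ _).trans (le_max_right _ _)))
    (fun a b => (h3 x hx (a, b)).trans ((le_max_right _ _).trans (le_max_right _ _)))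
    (ht x (hKU hx))

theorem eventually_volDensity_le (hK : IsCompact K) (hKU : K ⊆ U) :
    ∃ V : ℝ, ∀ᶠ ε in 𝓝[>] (0 : ℝ), ∀ x ∈ K, volDensity (g ε) x ≤ V := by
  obtain ⟨C, hC⟩ := hg.exists_metric_bound hK hKU
  refine ⟨Real.sqrt ((Fintype.card (Fin 4)).factorial • C ^ Fintype.card (Fin 4)), ?_⟩
  filter_upwards [hC] with ε h x hx
  exact Real.sqrt_le_sqrt (Matrix.det_le (abv := AbsoluteValue.abs) (A := g ε x)
    fun a b => h x hx a b)

theorem solutionNet (hU : IsOpen U) (hK : IsCompact K) (hKU : K ⊆ U) {f u : ℝ → Pt → ℝ}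
    (hf : NegligibleFunNet U f) {v w : ℝ → (Fin 3 → ℝ) → ℝ}
    (hu : ∀ᶠ ε in 𝓝[>] (0 : ℝ), SolvesIVP U (g ε) (f ε) (v ε) (w ε) (u ε)) :
    SolutionNet U K g f u where
  isOpen := hU
  subset := hKU
  lorentz := hg.eventually_smoothLorentz hU
  metric a b := ⟨(hg.eventually_smoothLorentz hU).mono fun _ h => h.smooth a b,
    fun l => ⟨l.length, hg.metric_bound K hK hKU l a b⟩⟩
  inverse a b := ⟨(hg.eventually_smoothLorentz hU).mono fun _ h => h.smooth_inv a b,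
    fun l => ⟨l.length, hg.inverse_bound K hK hKU l a b⟩⟩
  smooth_source := eventually_Ioo.mono fun ε hε => hf.smooth ε ⟨hε.1, hε.2.le⟩
  source := hf.estimate K hK hKU
  smooth := hu.mono fun _ h => h.smooth
  equation := hu.mono fun _ h => h.equation

end AdmissibleMetricNet

/-- Every chart has its own threshold for `ε`. The outer boundary is compact, so finitely many
charts suffice and one threshold serves them all. -/
theorem EnergyDomain.eventually_spacelike {U Ω : Set Pt} {γ : ℝ} {g : ℝ → Pt → Mat}
    (hΩ : EnergyDomain U Ω γ g) :
    ∀ᶠ ε in 𝓝[>] (0 : ℝ), ∀ q ∈ outerBoundary Ω γ, ∃ (N : Set Pt) (φ : Pt → ℝ),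
      IsOpen N ∧ q ∈ N ∧ ContDiffOn ℝ 1 φ N ∧ (∀ x ∈ N, 0 ≤ x 0 → (x ∈ Ω ↔ φ x < 0)) ∧
      ∀ x ∈ N ∩ outerBoundary Ω γ,
        coInner (g ε) x (dF φ x) (dF φ x) < 0 ∧ coInner (g ε) x (dF φ x) dt < 0 := by
  have hcl : IsClosed (outerBoundary Ω γ) :=
    isClosed_frontier.inter (hΩ.isOpen.isClosed_compl.inter
      (isClosed_le (continuous_apply 0) continuous_const))
  have hcpt : IsCompact (outerBoundary Ω γ) := hΩ.compact_closure.of_isClosed_subset hcl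
    fun q hq => closure_mono inter_subset_left (frontier_subset_closure hq.1)
  choose! N φ hN hqN hφ hgraph hev using hΩ.spacelike
  obtain ⟨t, hcover⟩ := hcpt.elim_nhds_subcover' (fun q _ => N q)
    fun q hq => (hN q hq).mem_nhds (hqN q hq)
  filter_upwards [(Finset.eventually_all t).2 fun q _ => hev q q.2] with ε hε q hq
  obtain ⟨p, hp, hqp⟩ := mem_iUnion₂.1 (hcover hq)
  exact ⟨N p, φ p, hN p p.2, hqp, hφ p p.2, hgraph p p.2, hε p hp⟩

/-- The derivatives are bounded by the energy density. -/
theorem GeomBound.sq_sum_abs_le {U : Set Pt} {g : Pt → Mat} (hg : SmoothLorentz U g) {M : ℝ}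
    {x : Pt} (hx : x ∈ U) (hM : GeomBound g M x) (u : Pt → ℝ) (j : ℕ) :
    (∑ I, |nabla g u j I x|) ^ 2 ≤ 4 ^ j * (M ^ j * 4 ^ j * (2 * M)) * current g u j 0 x := by
  have hM0 : 0 < M := one_pos.trans_le hM.one_le
  have h1 := hg.sq_sum_le_current (u := u) j hx (inv_pos.2 hM0) hM0.le hM.eLow hM.lapse
  have h2 := sq_sum_le_card_mul_sum_sq (s := Finset.univ)
    (f := fun I : Fin j → Fin 4 => |nabla g u j I x|)
  simp only [sq_abs, Finset.card_univ, Fintype.card_fun, Fintype.card_fin] at h2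
  refine h2.trans ?_
  push_cast
  rw [mul_assoc]
  rw [div_inv_eq_mul] at h1
  exact mul_le_mul_of_nonneg_left h1 (by positivity)

namespace SolutionNet

variable {U K : Set Pt} {g : ℝ → Pt → Mat} {f u : ℝ → Pt → ℝ} (h : SolutionNet U K g f u)
include h

theorem lower_bound_finite {n : ℕ} {ι : Type*} [Finite ι] {F : ι → ℝ → Pt → ℝ}
    (hF : ∀ i, Lower U K g f u n (F i)) :
    ∃ (N : ℕ) (C : ℝ), 0 ≤ C ∧ ∀ q : ℕ, ∃ C' : ℝ, 0 ≤ C' ∧ ∀ᶠ ε in 𝓝[>] (0 : ℝ), ∀ x ∈ K, ∀ i,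
      |F i ε x| ≤ C * (ε ^ N)⁻¹ * (∑ j ∈ Finset.range n, ∑ I, |nabla (g ε) (u ε) j I x|) +
        C' * ε ^ q := by
  cases nonempty_fintype ι
  choose N C hC hb using fun i => h.lower_bound (hF i)
  refine ⟨∑ i, N i, ∑ i, C i, Finset.sum_nonneg fun i _ => hC i, fun q => ?_⟩
  choose C' hC' hb using fun i => hb i q
  refine ⟨∑ i, C' i, Finset.sum_nonneg fun i _ => hC' i, ?_⟩
  filter_upwards [eventually_all.2 hb, eventually_Ioo] with ε hb hε x hx i
  have hR : 0 ≤ ∑ j ∈ Finset.range n, ∑ I, |nabla (g ε) (u ε) j I x| :=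
    Finset.sum_nonneg fun j _ => Finset.sum_nonneg fun I _ => abs_nonneg _
  refine (hb i x hx).trans (add_le_add (mul_le_mul_of_nonneg_right (mul_le_mul
    (Finset.single_le_sum (fun i _ => hC i) (Finset.mem_univ i))
    (inv_pow_le_inv_pow hε (Finset.single_le_sum (f := N) (fun i _ => Nat.zero_le _)
      (Finset.mem_univ i))) (inv_nonneg.2 (pow_nonneg hε.1.le _))
    (Finset.sum_nonneg fun i _ => hC i)) hR) (mul_le_mul_of_nonneg_right
    (Finset.single_le_sum (fun i _ => hC' i) (Finset.mem_univ i)) (pow_nonneg hε.1.le _)))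

/-- The divergence of the energy currents of positive order is bounded by the energy density of
the same order, up to lower order and negligible terms. -/
theorem abs_div_current_succ_le {M : ℝ}
    (hM : ∀ᶠ ε in 𝓝[>] (0 : ℝ), ∀ x ∈ K, GeomBound (g ε) M x) (k : ℕ) :
    ∃ (N : ℕ) (C : ℝ), 0 ≤ C ∧ ∀ q : ℕ, ∃ C' : ℝ, 0 ≤ C' ∧ ∀ᶠ ε in 𝓝[>] (0 : ℝ), ∀ x ∈ K,
      |∑ a, covVec (g ε) (current (g ε) (u ε) (k + 1)) a a x| ≤
        C * current (g ε) (u ε) (k + 1) 0 x + C * (ε ^ N)⁻¹ *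
          (∑ j ∈ Finset.range (if k = 0 then 0 else k + 1), current (g ε) (u ε) j 0 x) +
        C' * ε ^ q := by
  set m := if k = 0 then 0 else k + 1 with hm
  obtain ⟨N₁, C₁, hC₁, h1⟩ := h.lower_bound_finite (fun I => h.lower_boxNabla k I)
  obtain ⟨N₂, C₂, hC₂, h2⟩ := h.lower_bound_finite
    (fun i : Fin 4 × Fin 4 × (Fin k → Fin 4) => h.lower_commNabla k i.1 i.2.1 i.2.2)
  obtain ⟨D, hD, hdiv⟩ := exists_abs_div_current_succ_le k M
  set A : ℕ → ℝ := fun j => 4 ^ j * (|M| ^ j * 4 ^ j * (2 * |M|)) with hA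
  have hA0 : ∀ j, 0 ≤ A j := fun j => by positivity
  set B : ℝ := m * ∑ j ∈ Finset.range m, A j with hB
  have hB0 : 0 ≤ B := mul_nonneg (Nat.cast_nonneg _) (Finset.sum_nonneg fun j _ => hA0 j)
  -- The exponent doubles because the divergence bound is quadratic in the lower order terms. One
  -- constant is taken for both places where `C` occurs.
  refine ⟨2 * (N₁ + N₂), D * 3 * A (k + 1) + D * 3 * (C₁ + C₂) ^ 2 * B, by positivity,
    fun q => ?_⟩
  obtain ⟨C₁', hC₁', h1⟩ := h1 q
  obtain ⟨C₂', hC₂', h2⟩ := h2 q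
  refine ⟨D * 3 * (C₁' + C₂') ^ 2, by positivity, ?_⟩
  filter_upwards [h1, h2, hM, h.lorentz, h.smooth, eventually_Ioo] with ε h1 h2 hM hg hu hε x hx
  have hxU := h.subset hx
  have hMx := hM x hx
  have hM0 : 0 < M := one_pos.trans_le hMx.one_le
  have hAM : ∀ j, (∑ I, |nabla (g ε) (u ε) j I x|) ^ 2 ≤ A j * current (g ε) (u ε) j 0 x :=
    fun j => by
      have := hMx.sq_sum_abs_le hg hxU (u ε) j
      rwa [hA, abs_of_pos hM0]
  have he : ∀ j, 0 ≤ current (g ε) (u ε) j 0 x := fun j => hg.current_time_nonneg j hxU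
  set R : ℝ := ∑ j ∈ Finset.range m, ∑ I, |nabla (g ε) (u ε) j I x| with hR
  set S : ℝ := ∑ I, |nabla (g ε) (u ε) (k + 1) I x| with hS
  have hR0 : 0 ≤ R := Finset.sum_nonneg fun j _ => Finset.sum_nonneg fun I _ => abs_nonneg _
  have hS0 : 0 ≤ S := Finset.sum_nonneg fun I _ => abs_nonneg _
  have hεp : ∀ n : ℕ, 0 < ε ^ n := fun n => pow_pos hε.1 n
  set P : ℝ := (ε ^ (N₁ + N₂))⁻¹ with hP
  have hP0 : 0 ≤ P := (inv_pos.2 (hεp _)).le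
  have hPN₁ : (ε ^ N₁)⁻¹ ≤ P := inv_pow_le_inv_pow hε (Nat.le_add_right _ _)
  have hPN₂ : (ε ^ N₂)⁻¹ ≤ P := inv_pow_le_inv_pow hε (Nat.le_add_left _ _)
  have hq0 := (hεp q).le
  -- A common bound for `∇ᵏ⁺¹u`, `□∇ᵏu` and the commutator, as `exists_abs_div_current_succ_le`
  -- requires.
  set n : ℝ := S + (C₁ + C₂) * P * R + (C₁' + C₂') * ε ^ q with hn
  have hle : ∀ {C Q C' : ℝ}, 0 ≤ C → 0 ≤ Q → C ≤ C₁ + C₂ → Q ≤ P → C' ≤ C₁' + C₂' →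
      C * Q * R + C' * ε ^ q ≤ n := fun hC hQ hCC hQP hC' => by
    have h3 := mul_le_mul_of_nonneg_right (mul_le_mul hCC hQP hQ (hC.trans hCC)) hR0
    have h4 := mul_le_mul_of_nonneg_right hC' hq0
    rw [hn]; linarith
  have hmain := hdiv U (g ε) hg (u ε) hu x hxU hMx n
    (fun I => by
      have h3 : |nabla (g ε) (u ε) (k + 1) I x| ≤ S :=
        Finset.single_le_sum (f := fun I => |nabla (g ε) (u ε) (k + 1) I x|)
          (fun I _ => abs_nonneg _) (Finset.mem_univ I)
      have h4 : 0 ≤ (C₁ + C₂) * P * R := by positivity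
      have h5 : 0 ≤ (C₁' + C₂') * ε ^ q := by positivity
      rw [hn]; linarith)
    (fun I => (h1 x hx I).trans
      (hle hC₁ (inv_pos.2 (hεp _)).le (by linarith) hPN₁ (by linarith)))
    (fun a b I => (h2 x hx (a, b, I)).trans
      (hle hC₂ (inv_pos.2 (hεp _)).le (by linarith) hPN₂ (by linarith)))
  have hRsq : R ^ 2 ≤ B * ∑ j ∈ Finset.range m, current (g ε) (u ε) j 0 x := by
    have h3 := sq_sum_le_card_mul_sum_sq (s := Finset.range m)
      (f := fun j => ∑ I, |nabla (g ε) (u ε) j I x|)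
    rw [Finset.card_range] at h3
    refine h3.trans ?_
    rw [hB, mul_assoc, Finset.mul_sum (Finset.range m) _ (∑ j ∈ Finset.range m, A j)]
    refine mul_le_mul_of_nonneg_left (Finset.sum_le_sum fun j hj => (hAM j).trans ?_)
      (Nat.cast_nonneg _)
    exact mul_le_mul_of_nonneg_right (Finset.single_le_sum (fun i _ => hA0 i) hj) (he j)
  have hn2 : n ^ 2 ≤ 3 * (S ^ 2 + ((C₁ + C₂) * P * R) ^ 2 + ((C₁' + C₂') * ε ^ q) ^ 2) := by
    rw [hn]
    nlinarith [sq_nonneg (S - (C₁ + C₂) * P * R), sq_nonneg (S - (C₁' + C₂') * ε ^ q),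
      sq_nonneg ((C₁ + C₂) * P * R - (C₁' + C₂') * ε ^ q)]
  have hq2 : (ε ^ q) ^ 2 ≤ ε ^ q := by
    rw [sq]
    exact mul_le_of_le_one_left hq0 (pow_le_one₀ hε.1.le hε.2.le)
  have hP2 : (ε ^ (2 * (N₁ + N₂)))⁻¹ = P ^ 2 := by rw [hP, inv_pow, ← pow_mul, mul_comm]
  have hP1 : 1 ≤ P ^ 2 := by
    rw [← hP2]
    exact (one_le_inv₀ (hεp _)).2 (pow_le_one₀ hε.1.le hε.2.le)
  rw [hP2]
  set E := ∑ j ∈ Finset.range m, current (g ε) (u ε) j 0 x with hE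
  have hE0 : 0 ≤ E := Finset.sum_nonneg fun j _ => he j
  have t1 : D * 3 * S ^ 2 ≤ D * 3 * (A (k + 1) * current (g ε) (u ε) (k + 1) 0 x) :=
    mul_le_mul_of_nonneg_left (hAM (k + 1)) (by positivity)
  have t2 : D * 3 * ((C₁ + C₂) ^ 2 * P ^ 2) * R ^ 2 ≤
      D * 3 * ((C₁ + C₂) ^ 2 * P ^ 2) * (B * E) :=
    mul_le_mul_of_nonneg_left hRsq (by positivity)
  have t3 : D * 3 * (C₁' + C₂') ^ 2 * (ε ^ q) ^ 2 ≤ D * 3 * (C₁' + C₂') ^ 2 * ε ^ q :=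
    mul_le_mul_of_nonneg_left hq2 (by positivity)
  have t4 : D * n ^ 2 ≤ _ := mul_le_mul_of_nonneg_left hn2 hD
  have t5 : 0 ≤ D * 3 * (C₁ + C₂) ^ 2 * B * current (g ε) (u ε) (k + 1) 0 x :=
    mul_nonneg (by positivity) (he _)
  have t6 : 0 ≤ D * 3 * A (k + 1) * P ^ 2 * E :=
    mul_nonneg (mul_nonneg (mul_nonneg (by positivity) (hA0 _)) (sq_nonneg P)) hE0
  linarith

/-- The divergence of `½u²ξ̂` contains `u` and `∇u` with bounded coefficients only. No power of
`1/ε` enters, so orders 0 and 1 may carry the same weight. -/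
theorem abs_div_current_zero_le {M : ℝ}
    (hM : ∀ᶠ ε in 𝓝[>] (0 : ℝ), ∀ x ∈ K, GeomBound (g ε) M x) :
    ∃ C : ℝ, 0 ≤ C ∧ ∀ᶠ ε in 𝓝[>] (0 : ℝ), ∀ x ∈ K,
      |∑ a, covVec (g ε) (current (g ε) (u ε) 0) a a x| ≤
        C * (current (g ε) (u ε) 0 0 x + current (g ε) (u ε) 1 0 x) := by
  refine ⟨(1 / 2 * (4 * |M|) + 4 * |M|) * (2 * (2 * |M| + 4 * (|M| * 4 * (2 * |M|)))),
    by positivity, ?_⟩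
  filter_upwards [hM, h.lorentz, h.smooth] with ε hM hg hu x hx
  have hxU := h.subset hx
  have hMx := hM x hx
  have hM0 : 0 < M := one_pos.trans_le hMx.one_le
  rw [abs_of_pos hM0]
  have e0 := hg.current_time_nonneg (u := u ε) 0 hxU
  have e1 := hg.current_time_nonneg (u := u ε) 1 hxU
  have s0 := hMx.sq_sum_abs_le hg hxU (u ε) 0
  have s1 := hMx.sq_sum_abs_le hg hxU (u ε) 1
  have hs0 : |u ε x| ≤ ∑ I, |nabla (g ε) (u ε) 0 I x| := by simp [nabla]
  have hs1 : ∀ I, |nabla (g ε) (u ε) 1 I x| ≤ ∑ I, |nabla (g ε) (u ε) 1 I x| := fun I =>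
    Finset.single_le_sum (f := fun I => |nabla (g ε) (u ε) 1 I x|)
      (fun I _ => abs_nonneg _) (Finset.mem_univ I)
  have p0 : 0 ≤ ∑ I, |nabla (g ε) (u ε) 0 I x| := Finset.sum_nonneg fun I _ => abs_nonneg _
  have p1 : 0 ≤ ∑ I, |nabla (g ε) (u ε) 1 I x| := Finset.sum_nonneg fun I _ => abs_nonneg _
  have hmain := hg.abs_div_current_zero_le hu hxU hMx
    (n := (∑ I, |nabla (g ε) (u ε) 0 I x|) + ∑ I, |nabla (g ε) (u ε) 1 I x|)
    (by linarith) fun I => (hs1 I).trans (by linarith)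
  refine hmain.trans ?_
  rw [mul_assoc]
  refine mul_le_mul_of_nonneg_left ?_ (by positivity)
  simp only [pow_zero, one_mul, pow_one] at s0 s1
  generalize (∑ I, |nabla (g ε) (u ε) 0 I x|) = r at *
  generalize (∑ I, |nabla (g ε) (u ε) 1 I x|) = s at *
  have q0 : 0 ≤ 4 * (M * 4 * (2 * M)) * current (g ε) (u ε) 0 0 x := by positivity
  have q1 : 0 ≤ 2 * M * current (g ε) (u ε) 1 0 x := by positivity
  nlinarith [sq_nonneg (r - s)]

end SolutionNet

/-! ### Energy estimates along the net -/

/-- A weight which makes the lower order terms in the energy estimates uniformly small. -/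
def orderWeight (N k : ℕ) (ε : ℝ) (j : ℕ) : ℝ := (ε ^ (N * (k - max j 1)))⁻¹

theorem one_le_orderWeight (N k : ℕ) {ε : ℝ} (hε : ε ∈ Ioo (0 : ℝ) 1) (j : ℕ) :
    1 ≤ orderWeight N k ε j :=
  (one_le_inv₀ (pow_pos hε.1 _)).2 (pow_le_one₀ hε.1.le hε.2.le)

theorem orderWeight_le (N k : ℕ) {ε : ℝ} (hε : ε ∈ Ioo (0 : ℝ) 1) (j : ℕ) :
    orderWeight N k ε j ≤ (ε ^ (N * k))⁻¹ :=
  inv_pow_le_inv_pow hε (Nat.mul_le_mul_left N (Nat.sub_le _ _))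

/-- Descending from order `i + 1` to a lower order gains at least one factor `ε⁻ᴺ`. For `i = 0` this
fails, as the weights of orders 0 and 1 agree. -/
theorem orderWeight_succ_mul_le {N n k i j : ℕ} {ε : ℝ} (hε : ε ∈ Ioo (0 : ℝ) 1) (hn : n ≤ N)
    (hik : i < k) (hi : i ≠ 0) (hj : j ≤ i) :
    orderWeight N k ε (i + 1) * (ε ^ n)⁻¹ ≤ orderWeight N k ε j := by
  rw [orderWeight, orderWeight, ← mul_inv, ← pow_add]
  refine inv_pow_le_inv_pow hε ?_
  calc N * (k - max (i + 1) 1) + n ≤ N * (k - max (i + 1) 1 + 1) := by rw [mul_add, mul_one]; omega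
    _ ≤ N * (k - max j 1) := Nat.mul_le_mul_left N (by omega)

/-- The constant `l` is independent of `ε`, which is the purpose of the weights: each coefficient
`ε⁻ⁿ` in front of a lower order density is absorbed by the larger weight of that density. -/
theorem SolutionNet.weighted_div_le {U K : Set Pt} {g : ℝ → Pt → Mat} {f u : ℝ → Pt → ℝ}
    (h : SolutionNet U K g f u) {M : ℝ}
    (hM : ∀ᶠ ε in 𝓝[>] (0 : ℝ), ∀ x ∈ K, GeomBound (g ε) M x) {k : ℕ} (hk : 1 ≤ k) :
    ∃ (N : ℕ) (l : ℝ), 0 ≤ l ∧ ∀ q : ℕ, ∃ R : ℝ, 0 ≤ R ∧ ∀ᶠ ε in 𝓝[>] (0 : ℝ), ∀ x ∈ K,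
      |∑ j ∈ Finset.range (k + 1), orderWeight N k ε j *
          ∑ a, covVec (g ε) (current (g ε) (u ε) j) a a x| ≤
        l * (∑ j ∈ Finset.range (k + 1), orderWeight N k ε j * current (g ε) (u ε) j 0 x) +
          R * ε ^ q := by
  obtain ⟨C₀, hC₀, h0⟩ := h.abs_div_current_zero_le hM
  choose n C hC hb using h.abs_div_current_succ_le hM
  set N := ∑ i ∈ Finset.range k, n i with hN
  refine ⟨N, (∑ i ∈ Finset.range k, 2 * C i) + 2 * C₀,
    add_nonneg (Finset.sum_nonneg fun i _ => mul_nonneg two_pos.le (hC i)) (by positivity),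
    fun q => ?_⟩
  -- The weights are at most `ε^{-Nk}`; the additional power `N * k` keeps the weighted remainder of
  -- size `ε^q`.
  choose C' hC' hb using fun i => hb i (q + N * k)
  refine ⟨∑ i ∈ Finset.range k, C' i, Finset.sum_nonneg fun i _ => hC' i, ?_⟩
  filter_upwards [(Finset.eventually_all (Finset.range k)).2 fun i _ => hb i, h0, h.lorentz,
    eventually_Ioo] with ε hb h0 hg hε x hx
  have he : ∀ j, 0 ≤ current (g ε) (u ε) j 0 x := fun j =>
    hg.current_time_nonneg j (h.subset hx)
  have hw0 : ∀ j, 0 ≤ orderWeight N k ε j := fun j =>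
    zero_le_one.trans (one_le_orderWeight N k hε j)
  set W := ∑ j ∈ Finset.range (k + 1), orderWeight N k ε j * current (g ε) (u ε) j 0 x with hW
  have hterm : ∀ j, 0 ≤ orderWeight N k ε j * current (g ε) (u ε) j 0 x := fun j =>
    mul_nonneg (hw0 j) (he j)
  have hsingle : ∀ j, j ≤ k → orderWeight N k ε j * current (g ε) (u ε) j 0 x ≤ W := fun j hj =>
    Finset.single_le_sum (f := fun j => orderWeight N k ε j * current (g ε) (u ε) j 0 x)
      (fun i _ => hterm i) (Finset.mem_range.2 (Nat.lt_succ_of_le hj))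
  have hzero : |orderWeight N k ε 0 * ∑ a, covVec (g ε) (current (g ε) (u ε) 0) a a x| ≤
      2 * C₀ * W := by
    rw [abs_mul, abs_of_nonneg (hw0 0)]
    have h1 := mul_le_mul_of_nonneg_left (h0 x hx) (hw0 0)
    have h2 := hsingle 0 k.zero_le
    have h3 := hsingle 1 hk
    have h4 : orderWeight N k ε 1 = orderWeight N k ε 0 := rfl
    rw [h4] at h3
    have h5 := mul_le_mul_of_nonneg_left (add_le_add h2 h3) hC₀
    linarith
  have hsucc : ∀ i ∈ Finset.range k, |orderWeight N k ε (i + 1) *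
      ∑ a, covVec (g ε) (current (g ε) (u ε) (i + 1)) a a x| ≤ 2 * C i * W + C' i * ε ^ q := by
    intro i hi
    have hik := Finset.mem_range.1 hi
    rw [abs_mul, abs_of_nonneg (hw0 _)]
    have h1 := mul_le_mul_of_nonneg_left (hb i hi x hx) (hw0 (i + 1))
    have h2 := mul_le_mul_of_nonneg_left (hsingle (i + 1) hik) (hC i)
    have h3 : orderWeight N k ε (i + 1) * (ε ^ n i)⁻¹ *
        (∑ j ∈ Finset.range (if i = 0 then 0 else i + 1), current (g ε) (u ε) j 0 x) ≤ W := by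
      rw [Finset.mul_sum]
      refine (Finset.sum_le_sum fun j hj => ?_).trans
        (Finset.sum_le_sum_of_subset_of_nonneg (Finset.range_mono ?_) fun j _ _ => hterm j)
      · refine mul_le_mul_of_nonneg_right ?_ (he j)
        have hj' := Finset.mem_range.1 hj
        split_ifs at hj' with hi0
        · omega
        · exact orderWeight_succ_mul_le hε
            (Finset.single_le_sum (f := n) (fun i _ => Nat.zero_le _) hi) hik hi0 (by omega)
      · split_ifs <;> omega
    have h4 : orderWeight N k ε (i + 1) * ε ^ (q + N * k) ≤ ε ^ q := by
      have h5 := mul_le_mul_of_nonneg_right (orderWeight_le N k hε (i + 1))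
        (pow_nonneg hε.1.le (q + N * k))
      refine h5.trans_eq ?_
      rw [pow_add, mul_comm (ε ^ q), inv_mul_cancel_left₀ (pow_pos hε.1 _).ne']
    have h5 := mul_le_mul_of_nonneg_left h3 (hC i)
    have h6 := mul_le_mul_of_nonneg_left h4 (hC' i)
    linarith
  rw [Finset.sum_range_succ', add_mul]
  refine (abs_add_le _ _).trans ?_
  have h1 := (Finset.abs_sum_le_sum_abs _ _).trans (Finset.sum_le_sum hsucc)
  rw [Finset.sum_add_distrib, ← Finset.sum_mul, ← Finset.sum_mul] at h1
  linarith

section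

variable {U Ω : Set Pt} {γ : ℝ} {g : ℝ → Pt → Mat} {f u : ℝ → Pt → ℝ}
  {v w : ℝ → (Fin 3 → ℝ) → ℝ}

/-- The energy estimate: the growth of the energies of the solutions is at most polynomial in
`1/ε`, up to negligible terms. -/
theorem exists_energy_le (hU : IsOpen U) (hg : AdmissibleMetricNet U g)
    (hΩ : EnergyDomain U Ω γ g) (hf : NegligibleFunNet U f)
    (hu : ∀ᶠ ε in 𝓝[>] (0 : ℝ), SolvesIVP U (g ε) (f ε) (v ε) (w ε) (u ε)) {k : ℕ} (hk : 1 ≤ k) :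
    ∃ (N : ℕ) (C : ℝ), ∀ q : ℕ, ∃ C' : ℝ, ∀ᶠ ε in 𝓝[>] (0 : ℝ), ∀ τ ∈ Icc 0 γ,
      energy Ω (g ε) (u ε) k τ ≤
        C * ((ε ^ N)⁻¹ * energy Ω (g ε) (u ε) k 0) + C' * ε ^ q := by
  obtain ⟨M, hM⟩ := hg.eventually_geomBound hU hΩ.compact_closure hΩ.closure_subset
  obtain ⟨V, hV⟩ := hg.eventually_volDensity_le hΩ.compact_closure hΩ.closure_subset
  have hS := hg.solutionNet hU hΩ.compact_closure hΩ.closure_subset hf hu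
  obtain ⟨N, l, hl, hdiv⟩ := hS.weighted_div_le hM hk
  refine ⟨N * k, Real.exp (l * γ), fun q => ?_⟩
  obtain ⟨R, hR, hdiv⟩ := hdiv q
  refine ⟨Real.exp (l * γ) * (volume.real Ω * (V * R)), ?_⟩
  filter_upwards [hV, hdiv, hS.lorentz, hS.smooth, hΩ.eventually_spacelike, eventually_Ioo]
    with ε hV hdiv hL hsm hsp hε τ hτ
  refine (hL.energy_le hΩ.isOpen hΩ.compact_closure hΩ.closure_subset hsm hsp hl
    (mul_nonneg hR (pow_nonneg hε.1.le q)) (one_le_orderWeight N k hε) (orderWeight_le N k hε) hV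
    hdiv hτ.1 hτ.2).trans_eq ?_
  ring

theorem eventually_energy_nonneg (hU : IsOpen U) (hg : AdmissibleMetricNet U g)
    (hΩ : EnergyDomain U Ω γ g) (u : ℝ → Pt → ℝ) (k : ℕ) :
    ∀ᶠ ε in 𝓝[>] (0 : ℝ), ∀ τ, 0 ≤ energy Ω (g ε) (u ε) k τ :=
  (hg.eventually_smoothLorentz hU).mono fun _ h τ =>
    h.energy_nonneg hΩ.isOpen hΩ.closure_subset k τ

/-- The energy estimate for the suprema of the energies. -/
theorem exists_supEnergy_le (hU : IsOpen U) (hγ : 0 ≤ γ) (hg : AdmissibleMetricNet U g)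
    (hΩ : EnergyDomain U Ω γ g) (hf : NegligibleFunNet U f)
    (hu : ∀ᶠ ε in 𝓝[>] (0 : ℝ), SolvesIVP U (g ε) (f ε) (v ε) (w ε) (u ε)) {k : ℕ} (hk : 1 ≤ k) :
    ∃ (N : ℕ) (C : ℝ), ∀ q : ℕ, ∃ C' : ℝ, ∀ᶠ ε in 𝓝[>] (0 : ℝ),
      ‖supEnergy Ω (g ε) (u ε) k γ‖ ≤
        C * ((ε ^ N)⁻¹ * energy Ω (g ε) (u ε) k 0) + C' * ε ^ q := by
  obtain ⟨N, C, h⟩ := exists_energy_le hU hg hΩ hf hu hk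
  refine ⟨N, C, fun q => ?_⟩
  obtain ⟨C', h⟩ := h q
  refine ⟨C', ?_⟩
  filter_upwards [h, eventually_energy_nonneg hU hg hΩ u k] with ε h h0
  have : Nonempty (Icc (0 : ℝ) γ) := ⟨⟨0, le_rfl, hγ⟩⟩
  rw [supEnergy, Real.norm_of_nonneg (Real.iSup_nonneg fun τ : Icc (0 : ℝ) γ => h0 τ)]
  exact ciSup_le fun τ => h τ τ.2

theorem eventually_bddAbove_energy (hU : IsOpen U) (hg : AdmissibleMetricNet U g)
    (hΩ : EnergyDomain U Ω γ g) (hf : NegligibleFunNet U f)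
    (hu : ∀ᶠ ε in 𝓝[>] (0 : ℝ), SolvesIVP U (g ε) (f ε) (v ε) (w ε) (u ε)) (k : ℕ) :
    ∀ᶠ ε in 𝓝[>] (0 : ℝ), BddAbove ((fun τ => energy Ω (g ε) (u ε) k τ) '' Icc 0 γ) := by
  -- The estimate needs positive order. It is applied at order `k + 1`, whose energy dominates that
  -- of order `k` because every summand is nonnegative.
  obtain ⟨N, C, h⟩ := exists_energy_le hU hg hΩ hf hu (Nat.le_add_left 1 k)
  obtain ⟨C', h⟩ := h 0
  filter_upwards [h, hg.eventually_smoothLorentz hU] with ε h hL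
  refine ⟨C * ((ε ^ N)⁻¹ * energy Ω (g ε) (u ε) (k + 1) 0) + C' * ε ^ 0,
    forall_mem_image.2 fun τ hτ => ?_⟩
  exact (hL.energy_mono hΩ.isOpen hΩ.closure_subset k.le_succ τ).trans (h τ hτ)

theorem moderateNet_supEnergy (hU : IsOpen U) (hγ : 0 ≤ γ) (hg : AdmissibleMetricNet U g)
    (hΩ : EnergyDomain U Ω γ g) (hf : NegligibleFunNet U f)
    (hu : ∀ᶠ ε in 𝓝[>] (0 : ℝ), SolvesIVP U (g ε) (f ε) (v ε) (w ε) (u ε)) {k : ℕ} (hk : 1 ≤ k)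
    (h0 : ModerateNet fun ε => energy Ω (g ε) (u ε) k 0) :
    ModerateNet fun ε => supEnergy Ω (g ε) (u ε) k γ := by
  obtain ⟨N, C, h⟩ := exists_supEnergy_le hU hγ hg hΩ hf hu hk
  obtain ⟨C', h⟩ := h 0
  obtain ⟨n, h0⟩ := h0
  refine ⟨N + n, (Asymptotics.IsBigO.of_norm_eventuallyLE h).trans (.add ?_ ?_)⟩
  · refine (((Asymptotics.isBigO_refl (fun ε : ℝ => (ε ^ N)⁻¹) _).mul h0).const_mul_left C).congr_right
      fun ε => ?_
    rw [pow_add, mul_inv]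
  · refine Asymptotics.IsBigO.of_bound |C'| ?_
    filter_upwards [eventually_Ioo] with ε hε
    rw [pow_zero, mul_one, Real.norm_eq_abs, Real.norm_of_nonneg (inv_nonneg.2 (pow_nonneg hε.1.le _))]
    exact le_mul_of_one_le_right (abs_nonneg _)
      ((one_le_inv₀ (pow_pos hε.1 _)).2 (pow_le_one₀ hε.1.le hε.2.le))

theorem negligibleNet_supEnergy (hU : IsOpen U) (hγ : 0 ≤ γ) (hg : AdmissibleMetricNet U g)
    (hΩ : EnergyDomain U Ω γ g) (hf : NegligibleFunNet U f)
    (hu : ∀ᶠ ε in 𝓝[>] (0 : ℝ), SolvesIVP U (g ε) (f ε) (v ε) (w ε) (u ε)) {k : ℕ} (hk : 1 ≤ k)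
    (h0 : NegligibleNet fun ε => energy Ω (g ε) (u ε) k 0) :
    NegligibleNet fun ε => supEnergy Ω (g ε) (u ε) k γ := by
  obtain ⟨N, C, h⟩ := exists_supEnergy_le hU hγ hg hΩ hf hu hk
  intro m
  obtain ⟨C', h⟩ := h m
  refine (Asymptotics.IsBigO.of_norm_eventuallyLE h).trans
    (.add ?_ ((Asymptotics.isBigO_refl _ _).const_mul_left C'))
  -- Since `N` is fixed before `m`, negligibility of the initial energy can be used with exponent `N
  -- + m` to compensate the loss `ε⁻ᴺ`.
  refine (((Asymptotics.isBigO_refl (fun ε : ℝ => (ε ^ N)⁻¹) _).mul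
    (h0 (N + m))).const_mul_left C).congr' .rfl ?_
  filter_upwards [eventually_Ioo] with ε hε
  rw [pow_add, inv_mul_cancel_left₀ (pow_pos hε.1 _).ne']

end

end

end WaveEnergy

theorem corollary2 (U Ω : Set WaveEnergy.Pt) (hU : IsOpen U) (γ : ℝ) (hγ : 0 < γ)
    (g : ℝ → WaveEnergy.Pt → WaveEnergy.Mat) (hg : WaveEnergy.AdmissibleMetricNet U g)
    (hΩ : WaveEnergy.EnergyDomain U Ω γ g)
    (f u : ℝ → WaveEnergy.Pt → ℝ) (v w : ℝ → (Fin 3 → ℝ) → ℝ)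
    (hf : WaveEnergy.NegligibleFunNet U f)
    (hu : ∀ᶠ ε in 𝓝[>] (0 : ℝ), WaveEnergy.SolvesIVP U (g ε) (f ε) (v ε) (w ε) (u ε)) :
    (∀ k : ℕ, ∀ᶠ ε in 𝓝[>] (0 : ℝ),
      BddAbove ((fun τ => WaveEnergy.energy Ω (g ε) (u ε) k τ) '' Icc 0 γ)) ∧
    ((∀ k : ℕ, 1 ≤ k →
        WaveEnergy.ModerateNet fun ε => WaveEnergy.energy Ω (g ε) (u ε) k 0) →
      ∀ k : ℕ, 1 ≤ k →
        WaveEnergy.ModerateNet fun ε => WaveEnergy.supEnergy Ω (g ε) (u ε) k γ) ∧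
    ((∀ k : ℕ, 1 ≤ k →
        WaveEnergy.NegligibleNet fun ε => WaveEnergy.energy Ω (g ε) (u ε) k 0) →
      ∀ k : ℕ, 1 ≤ k →
        WaveEnergy.NegligibleNet fun ε => WaveEnergy.supEnergy Ω (g ε) (u ε) k γ) := by
  open WaveEnergy in
  exact ⟨eventually_bddAbove_energy hU hg hΩ hf hu,
    fun h0 k hk => moderateNet_supEnergy hU hγ.le hg hΩ hf hu hk (h0 k hk),
    fun h0 k hk => negligibleNet_supEnergy hU hγ.le hg hΩ hf hu hk (h0 k hk)⟩
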